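/- Let $0<\beta<1$. Let $L=\{\xi\in\partial\mathbb D:\operatorname{Im}\xi\le 0\}$ and $T=\{\xi\in\partial\mathbb D:\operatorname{Im}\xi\ge 0\}$ be the closed lower and upper semicircles. For compact $G\subset\mathbb C$ let $C^\beta(G)$ be the space of complex $\beta$-Hölder functions on $G$, $C^\beta_{\mathbb R}(G)$ its real-valued members, and let $A^\beta(\mathbb D)$ be the space of functions in $C^\beta(\overline{\mathbb D})$ that are holomorphic in $\mathbb D$. Let $B\in C^\beta(T)$ be nowhere zero, and let $\beta_1,\beta_{-1}\in(-1,1)\setminus\{0\}$ be such that $$\frac{B(1)}{|B(1)|}=-i\,e^{i\pi\beta_1},\qquad \frac{B(-1)}{|B(-1)|}=-i\,e^{-i\pi\beta_{-1}}.$$ For $j=\pm1$ put $\delta_j=1-\beta_j$ if $\beta_j>0$ and $\delta_j=|\beta_j|$ if $\beta_j<0$. In powers of $\xi-1$ and $\xi+1$ (also of $\frac{\xi-1}{|\xi-1|}$ and $\frac{\xi+1}{|\xi+1|}$) with exponents $\delta_1,\delta_{-1}$, the argument of $\xi-1$ is taken in $[\frac\pi2,\frac{3\pi}2]$ and that of $\xi+1$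 in $[-\frac\pi2,\frac\pi2]$. Define $\widetilde B$ on $\partial\mathbb D\setminus\{\pm1\}$ by $$\overline{\widetilde B(\xi)}=\begin{cases}\overline{B(\xi)}\left(\frac{\xi-1}{|\xi-1|}\right)^{\delta_1}\left(\frac{\xi+1}{|\xi+1|}\right)^{\delta_{-1}},&\operatorname{Im}\xi>0,\\[2pt] \pm i\left(\frac{\xi-1}{|\xi-1|}\right)^{\delta_1}\left(\frac{\xi+1}{|\xi+1|}\right)^{\delta_{-1}},&\operatorname{Im}\xi<0,\end{cases}$$ with the sign $+$ if $\beta_{-1}<0$ and $-$ if $\beta_{-1}>0$. Then $\widetilde B/|\widetilde B|$ extends continuously to $-1$, and its one-sided limits at $1$ are equal or opposite. Let $W(B)\in\frac12\mathbb Z$ be the winding number of $\widetilde B$, that is, $\frac1{2\pi}$ times the total change of a continuous argument of $\widetilde B(e^{i\theta})$ as $\theta$ goes from $0^+$ to $2\pi^-$. Suppose that $W(B)\ge-\frac12$. Then for every real function $b$ on $\partial\mathbb D$ of the form $b(\xi)=|\xi-1|^{\delta_1}|\xi+1|^{\delta_{-1}}\,\widetilde b(\xi)$, where $\widetilde b\in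 C^\beta_{\mathbb R}(\partial\mathbb D)$ vanishes on $L$, there is a continuous function $f$ on $\overline{\mathbb D}$, holomorphic in $\mathbb D$, with $$\operatorname{Im} f(\xi)=0\ \ (\xi\in L),\qquad \operatorname{Re}\bigl(\overline{B(\xi)}f(\xi)\bigr)=b(\xi)\ \ (\xi\in T),$$ which is of the form $$f(\xi)=(\xi-1)^{\delta_1}(\xi+1)^{\delta_{-1}}\kappa(\xi),\qquad \kappa\in A^\beta(\mathbb D).$$ The solutions of this form of the homogeneous problem ($b=0$) form a real vector space of dimension $2W(B)+1$, and for every such $b$ the set of all solutions of this form is a translate of this space. If moreover $\beta\le\min\{\delta_1,\delta_{-1}\}$ (in particular if $\beta<\min\{|\beta_1|,1-|\beta_1|,|\beta_{-1}|,1-|\beta_{-1}|\}$), then all these solutions belong to $A^\beta(\mathbb D)$, so that the space of homogeneous solutions is a real subspace of $A^\beta(\mathbb D)$ of dimension $2W(B)+1$. -/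

import Mathlib

open Complex Set Metric
open scoped NNReal ComplexConjugate

noncomputable section

/-- The closed unit disc, as a type. -/
abbrev ClosedDisc : Type := closedBall (0 : ℂ) 1

/-- The closed lower semicircle `L`. -/
def lowerArc : Set ℂ := {ξ | ‖ξ‖ = 1 ∧ ξ.im ≤ 0}

/-- The closed upper semicircle, i.e. the unit circle without the relative interior of `L`. -/
def upperArc : Set ℂ := {ξ | ‖ξ‖ = 1 ∧ 0 ≤ ξ.im}

/-- Membership in the Hölder class `C^β(G)` for a set `G` of the plane. -/
def HolderClassOn {E : Type*} [PseudoEMetricSpace E] (β : ℝ≥0) (G : Set ℂ) (g : ℂ → E) : Prop :=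
  ∃ C : ℝ≥0, HolderOnWith C β g G

/-- A function on the closed disc is holomorphic in the open disc. -/
def HolomorphicInside (f : ClosedDisc → ℂ) : Prop :=
  ∃ F : ℂ → ℂ, DifferentiableOn ℂ F (ball 0 1) ∧
    ∀ z : ClosedDisc, (z : ℂ) ∈ ball (0 : ℂ) 1 → f z = F z

theorem HolomorphicInside.add {f g : ClosedDisc → ℂ} (hf : HolomorphicInside f)
    (hg : HolomorphicInside g) : HolomorphicInside (f + g) := by
  obtain ⟨F, hF, hfF⟩ := hf
  obtain ⟨G, hG, hgG⟩ := hg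
  exact ⟨F + G, hF.add hG, fun z hz => by simp [hfF z hz, hgG z hz]⟩

theorem HolomorphicInside.smul {f : ClosedDisc → ℂ} (c : ℝ) (hf : HolomorphicInside f) :
    HolomorphicInside (c • f) := by
  obtain ⟨F, hF, hfF⟩ := hf
  exact ⟨c • F, hF.const_smul c, fun z hz => by simp [hfF z hz]⟩

theorem HolomorphicInside.zero : HolomorphicInside 0 :=
  ⟨fun _ => 0, differentiableOn_const 0, fun _ _ => rfl⟩

/-- The disc algebra `A(𝔻)`, as a real vector space: continuous on the closed disc, holomorphic
inside. -/
def discAlgebra : Submodule ℝ (ClosedDisc → ℂ) where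
  carrier := {f | Continuous f ∧ HolomorphicInside f}
  add_mem' := fun hf hg => ⟨hf.1.add hg.1, hf.2.add hg.2⟩
  zero_mem' := ⟨continuous_const, HolomorphicInside.zero⟩
  smul_mem' := fun c _ hf => ⟨hf.1.const_smul c, hf.2.smul c⟩

/-- `A^β(𝔻)`, as a real vector space: the functions of the disc algebra that are `β`-Hölder on
the closed disc. -/
def holderDiscAlgebra (β : ℝ≥0) : Submodule ℝ (ClosedDisc → ℂ) where
  carrier := {f | f ∈ discAlgebra ∧ MemHolder β f}
  add_mem' := fun hf hg => ⟨discAlgebra.add_mem hf.1 hg.1, hf.2.add hg.2⟩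
  zero_mem' := ⟨discAlgebra.zero_mem, memHolder_zero⟩
  smul_mem' := fun c _ hf => ⟨discAlgebra.smul_mem c hf.1, hf.2.smul⟩

/-- The power `w ^ δ` with the argument of `w` in `(0, 2π)` (cut along the positive reals):
`arg w = π + Arg (-w)`. It is used for `Re w ≤ 0` only, and equals `0` at `w = 0` if `δ ≠ 0`. -/
def powPosCut (w : ℂ) (δ : ℝ) : ℂ :=
  exp (Real.pi * δ * I) * (-w) ^ (δ : ℂ)

/-- The function `(z - 1)^{δ₁} (z + 1)^{δ₋₁}` on the closed disc: the argument of `z - 1` lies in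
`(π/2, 3π/2)` and that of `z + 1` in `(-π/2, π/2)`. -/
def weight (δ₁ δm₁ : ℝ) (z : ℂ) : ℂ :=
  powPosCut (z - 1) δ₁ * (z + 1) ^ (δm₁ : ℂ)

/-- The exponent `δ` belonging to the angle `πβ`: `1 - β` for `β ∈ (0,1)`, `|β|` for
`β ∈ (-1,0)`. -/
def deltaOf (b : ℝ) : ℝ := if 0 < b then 1 - b else |b|

/-- The complex conjugate of the function `B̃` on the unit circle without `±1`; `βm₁` enters the
sign on the lower semicircle. The values at `±1` play no role. -/
def conjBTilde (B : ℂ → ℂ) (β₁ βm₁ : ℝ) (ξ : ℂ) : ℂ :=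
  let phase : ℂ := powPosCut ((ξ - 1) / ‖ξ - 1‖) (deltaOf β₁) *
    ((ξ + 1) / ‖ξ + 1‖) ^ ((deltaOf βm₁ : ℝ) : ℂ)
  if 0 < ξ.im then conj (B ξ) * phase
  else if βm₁ < 0 then I * phase
  else -I * phase

/-- `w` is the winding number of `g`, a function on the unit circle without `±1` which never
vanishes: `g` has an argument `φ` along `θ ↦ e^{iθ}` which is continuous on `[0, 2π]` (so that
`g / |g|` extends continuously through `-1` and has one-sided limits at `1`), and `w` is the total
change of `φ` divided by `2π`. The value is an integer if the limits at `1` agree, and half an odd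
integer if they are opposite. -/
def HasWindingNumber (g : ℂ → ℂ) (w : ℝ) : Prop :=
  ∃ φ : ℝ → ℝ, ContinuousOn φ (Icc 0 (2 * Real.pi)) ∧
    (∀ θ ∈ Ioo (0 : ℝ) (2 * Real.pi), θ ≠ Real.pi →
      g (exp (θ * I)) ≠ 0 ∧ g (exp (θ * I)) = ‖g (exp (θ * I))‖ * exp (φ θ * I)) ∧
    w = (φ (2 * Real.pi) - φ 0) / (2 * Real.pi)

open Classical in
/-- The winding number `W(B) = W(B̃)`. -/
def windingNumber (B : ℂ → ℂ) (β₁ βm₁ : ℝ) : ℝ :=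
  if h : ∃ w, HasWindingNumber (fun ξ => conj (conjBTilde B β₁ βm₁ ξ)) w then h.choose else 0

/-- `f` solves the linear Cherepanov problem with data `B` and `b`. -/
structure SolvesCherepanov (B : ℂ → ℂ) (b : ℂ → ℝ) (f : ClosedDisc → ℂ) : Prop where
  mem_discAlgebra : f ∈ discAlgebra
  im_eq_zero : ∀ ξ : ClosedDisc, (ξ : ℂ) ∈ lowerArc → (f ξ).im = 0
  re_eq : ∀ ξ : ClosedDisc, (ξ : ℂ) ∈ upperArc → (conj (B ξ) * f ξ).re = b ξ

/-- The solutions of the form `f = (ξ - 1)^{δ₁} (ξ + 1)^{δ₋₁} κ` with `κ ∈ A^β(𝔻)`. -/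
def weightedSolutions (β : ℝ≥0) (δ₁ δm₁ : ℝ) (B : ℂ → ℂ) (b : ℂ → ℝ) : Set (ClosedDisc → ℂ) :=
  {f | SolvesCherepanov B b f ∧
    ∃ κ ∈ holderDiscAlgebra β, ∀ z : ClosedDisc, f z = weight δ₁ δm₁ z * κ z}

/-- The solutions of this form of the homogeneous problem, as a real vector space. -/
def homogeneousSolutions (β : ℝ≥0) (δ₁ δm₁ : ℝ) (B : ℂ → ℂ) : Submodule ℝ (ClosedDisc → ℂ) where
  carrier := weightedSolutions β δ₁ δm₁ B (fun _ => 0)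
  add_mem' := by
    rintro f g ⟨hf, κ, hκ, hfκ⟩ ⟨hg, μ, hμ, hgμ⟩
    refine ⟨⟨discAlgebra.add_mem hf.1 hg.1, fun ξ hξ => ?_, fun ξ hξ => ?_⟩,
      κ + μ, (holderDiscAlgebra β).add_mem hκ hμ, fun z => ?_⟩
    · simp [hf.2 ξ hξ, hg.2 ξ hξ]
    · have h1 := hf.3 ξ hξ
      have h2 := hg.3 ξ hξ
      rw [Pi.add_apply, mul_add, add_re, h1, h2, add_zero]
    · simp [hfκ z, hgμ z, mul_add]
  zero_mem' := by
    refine ⟨⟨discAlgebra.zero_mem, fun ξ hξ => by simp, fun ξ hξ => by simp⟩,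
      0, (holderDiscAlgebra β).zero_mem, fun z => by simp⟩
  smul_mem' := by
    rintro c f ⟨hf, κ, hκ, hfκ⟩
    refine ⟨⟨discAlgebra.smul_mem c hf.1, fun ξ hξ => ?_, fun ξ hξ => ?_⟩,
      c • κ, (holderDiscAlgebra β).smul_mem c hκ, fun z => ?_⟩
    · simp [hf.2 ξ hξ]
    · have h1 := hf.3 ξ hξ
      rw [Pi.smul_apply, mul_smul_comm, smul_re, h1, smul_zero]
    · simp [hfκ z, mul_left_comm]

end

/-! Dividing a solution by the weight turns the mixed problem into a Riemann–Hilbert problem for κ.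
On the circle (ξ-1)^{δ₁}(ξ+1)^{δ₋₁} has modulus |ξ-1|^{δ₁}|ξ+1|^{δ₋₁} and, on each semicircle, an
argument affine in θ. After division by the modulus both boundary conditions read Re(e^{-iφ}κ) = c,
where φ is a continuous argument of B̃ and c is b̃/|B| on T and 0 on L (`solvesCherepanov_iff`). The
exponents are such that φ exists across -1 (`exists_hasWindingNumber`) and changes by kπ around the
circle for some integer k (`IsArgument.exists_int`). Then k = 2W(B), and W(B) ≥ -1/2 says that n = k
+ 1 is a natural number.

The Riemann–Hilbert problem is solved in `exists_riemannHilbert`. With m = (n-1)/2 the function φ(θ)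
- mθ is periodic and Hölder, hence the real part of the boundary values of a Hölder holomorphic h.
The substitution κ = e^{ih}μ leaves Re(e^{-imθ}μ) = c e^{Im h}. For c = 0 this is ξμ + ξ^n conj μ =
0, and comparison of Fourier coefficients shows that μ is a polynomial of degree less than n with
a_{n-1-k} = -conj a_k (`exists_eq_selfReciprocal`), which leaves n = 2W(B) + 1 real parameters. For
general c, split c e^{Im h} e^{imθ} = P + conj(ξR) and take μ = P + ξ^n R.

The analytic input is Privalov's theorem `exists_holderDisc_add_conj`, which provides such
splittings: the derivative of the Cauchy integral of a β-Hölder function is O((1-|z|)^{β-1}), the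
Hardy–Littlewood theorem turns this into a Hölder extension, and the Poisson kernel identifies the
boundary values. The final regularity claim holds because the weight itself is β-Hölder when β is at
most both exponents. -/

/-- `f` is Hölder continuous on `s` with exponent `β`, in terms of real distances. -/
def IsHolder {X E : Type*} [PseudoMetricSpace X] [PseudoMetricSpace E] (β : ℝ) (s : Set X)
    (f : X → E) : Prop :=
  ∃ C : ℝ, 0 ≤ C ∧ ∀ x ∈ s, ∀ y ∈ s, dist (f x) (f y) ≤ C * dist x y ^ β

/-! ### Calculus of Hölder functions. -/

namespace IsHolder

section Basic

variable {X Y E F : Type*} [PseudoMetricSpace X] [PseudoMetricSpace Y] [PseudoMetricSpace E]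
  [PseudoMetricSpace F] {β : ℝ} {s : Set X} {f g : X → E}

/-- The estimates below use real distances; this is the bridge to the Hölder classes of the main
statement. -/
theorem _root_.isHolder_iff_holderOnWith {β : ℝ≥0} :
    IsHolder β s f ↔ ∃ C : ℝ≥0, HolderOnWith C β f s := by
  constructor
  · rintro ⟨C, hC, h⟩
    lift C to ℝ≥0 using hC
    refine ⟨C, fun x hx y hy => ?_⟩
    have h1 : nndist (f x) (f y) ≤ C * nndist x y ^ (β : ℝ) := by
      rw [← NNReal.coe_le_coe]
      push_cast
      exact h x hx y hy
    rw [edist_nndist, edist_nndist, ← ENNReal.coe_rpow_of_nonneg _ β.coe_nonneg]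
    exact_mod_cast h1
  · rintro ⟨C, h⟩
    exact ⟨C, C.coe_nonneg, fun x hx y hy => h.dist_le hx hy⟩

theorem congr (h : IsHolder β s f) (hfg : EqOn g f s) : IsHolder β s g := by
  obtain ⟨C, hC, h⟩ := h
  exact ⟨C, hC, fun x hx y hy => by rw [hfg hx, hfg hy]; exact h x hx y hy⟩

theorem const (c : E) : IsHolder β s (fun _ => c) :=
  ⟨0, le_rfl, fun x _ y _ => by simp⟩

theorem continuousOn (hβ : 0 < β) (h : IsHolder β s f) : ContinuousOn f s := by
  lift β to ℝ≥0 using hβ.le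
  obtain ⟨C, hC⟩ := isHolder_iff_holderOnWith.1 h
  exact hC.continuousOn (by exact_mod_cast hβ)

theorem lipschitz_comp {K : ℝ≥0} {u : Set E} {k : E → F} (hk : LipschitzOnWith K k u)
    (h : IsHolder β s f) (hu : MapsTo f s u) : IsHolder β s (k ∘ f) := by
  obtain ⟨C, hC, h⟩ := h
  refine ⟨K * C, by positivity, fun x hx y hy => ?_⟩
  calc dist (k (f x)) (k (f y)) ≤ K * dist (f x) (f y) :=
        hk.dist_le_mul _ (hu hx) _ (hu hy)
    _ ≤ K * (C * dist x y ^ β) := by gcongr; exact h x hx y hy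
    _ = K * C * dist x y ^ β := by ring

theorem comp_lipschitz {K : ℝ≥0} {u : Set Y} {k : Y → X} (hβ : 0 ≤ β) (h : IsHolder β s f)
    (hk : LipschitzOnWith K k u) (hu : MapsTo k u s) : IsHolder β u (f ∘ k) := by
  obtain ⟨C, hC, h⟩ := h
  refine ⟨C * (K : ℝ) ^ β, by positivity, fun x hx y hy => ?_⟩
  calc dist (f (k x)) (f (k y)) ≤ C * dist (k x) (k y) ^ β := h _ (hu hx) _ (hu hy)
    _ ≤ C * (K * dist x y) ^ β := by
        gcongr; exact hk.dist_le_mul _ hx _ hy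
    _ = C * (K : ℝ) ^ β * dist x y ^ β := by
        rw [Real.mul_rpow K.coe_nonneg dist_nonneg]; ring

theorem of_exponent_le {γ : ℝ} (hs : Bornology.IsBounded s) (hβ : 0 < β) (hβγ : β ≤ γ)
    (h : IsHolder γ s f) : IsHolder β s f := by
  obtain ⟨C, hC, h⟩ := h
  obtain ⟨D, hD⟩ := Metric.isBounded_iff.1 hs
  refine ⟨C * (max D 0) ^ (γ - β), by positivity, fun x hx y hy => (h x hx y hy).trans ?_⟩
  rw [mul_assoc]
  gcongr
  have h1 : dist x y ^ γ = dist x y ^ (γ - β) * dist x y ^ β := by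
    rcases eq_or_lt_of_le (dist_nonneg (x := x) (y := y)) with h0 | h0
    · rw [← h0, Real.zero_rpow (by linarith : γ ≠ 0), Real.zero_rpow hβ.ne', mul_zero]
    · rw [← Real.rpow_add h0]; congr 1; ring
  rw [h1]
  gcongr ?_ * _
  exact Real.rpow_le_rpow dist_nonneg ((hD hx hy).trans (le_max_left _ _)) (by linarith)

theorem of_lipschitzOnWith {K : ℝ≥0} (hs : Bornology.IsBounded s) (hβ : 0 < β) (hβ1 : β ≤ 1)
    (h : LipschitzOnWith K f s) : IsHolder β s f := by
  refine of_exponent_le hs hβ hβ1 ⟨K, K.coe_nonneg, fun x hx y hy => ?_⟩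
  rw [Real.rpow_one]
  exact h.dist_le_mul _ hx _ hy

end Basic

section Normed

variable {X E : Type*} [PseudoMetricSpace X] {β : ℝ} {s : Set X}

theorem add [SeminormedAddCommGroup E] {f g : X → E} (hf : IsHolder β s f) (hg : IsHolder β s g) :
    IsHolder β s (fun x => f x + g x) := by
  obtain ⟨C, hC, hf⟩ := hf
  obtain ⟨D, hD, hg⟩ := hg
  refine ⟨C + D, by positivity, fun x hx y hy => ?_⟩
  calc dist (f x + g x) (f y + g y) ≤ dist (f x) (f y) + dist (g x) (g y) := dist_add_add_le _ _ _ _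
    _ ≤ C * dist x y ^ β + D * dist x y ^ β := add_le_add (hf x hx y hy) (hg x hx y hy)
    _ = (C + D) * dist x y ^ β := by ring

theorem exists_norm_le [SeminormedAddCommGroup E] {f : X → E} (hβ : 0 ≤ β)
    (hs : Bornology.IsBounded s) (hf : IsHolder β s f) : ∃ M, 0 ≤ M ∧ ∀ x ∈ s, ‖f x‖ ≤ M := by
  obtain ⟨C, hC, hf⟩ := hf
  rcases s.eq_empty_or_nonempty with rfl | ⟨x₀, hx₀⟩
  · exact ⟨0, le_rfl, by simp⟩
  obtain ⟨D, hD⟩ := Metric.isBounded_iff.1 hs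
  have hD0 : 0 ≤ D := dist_nonneg.trans (hD hx₀ hx₀)
  refine ⟨‖f x₀‖ + C * D ^ β, by positivity, fun x hx => ?_⟩
  have h1 : dist (f x) (f x₀) ≤ C * D ^ β := (hf x hx x₀ hx₀).trans (by gcongr; exact hD hx hx₀)
  rw [dist_eq_norm] at h1
  have := norm_add_le (f x₀) (f x - f x₀)
  simp only [add_sub_cancel] at this
  linarith

theorem mul [NormedRing E] {f g : X → E} (hβ : 0 ≤ β) (hs : Bornology.IsBounded s)
    (hf : IsHolder β s f) (hg : IsHolder β s g) : IsHolder β s (fun x => f x * g x) := by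
  obtain ⟨M, hM, hfM⟩ := hf.exists_norm_le hβ hs
  obtain ⟨N, hN, hgN⟩ := hg.exists_norm_le hβ hs
  obtain ⟨C, hC, hf⟩ := hf
  obtain ⟨D, hD, hg⟩ := hg
  refine ⟨C * N + M * D, by positivity, fun x hx y hy => ?_⟩
  have h1 := hf x hx y hy
  have h2 := hg x hx y hy
  rw [dist_eq_norm] at h1 h2 ⊢
  calc ‖f x * g x - f y * g y‖ = ‖(f x - f y) * g x + f y * (g x - g y)‖ := by
        congr 1; noncomm_ring
    _ ≤ ‖f x - f y‖ * ‖g x‖ + ‖f y‖ * ‖g x - g y‖ :=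
        (norm_add_le _ _).trans (add_le_add (norm_mul_le _ _) (norm_mul_le _ _))
    _ ≤ (C * dist x y ^ β) * N + M * (D * dist x y ^ β) := by
        gcongr
        exacts [hgN x hx, hfM y hy]
    _ = _ := by ring

theorem inv {f : X → ℝ} {c : ℝ} (hc : 0 < c) (hfc : ∀ x ∈ s, c ≤ f x)
    (hf : IsHolder β s f) : IsHolder β s (fun x => (f x)⁻¹) := by
  obtain ⟨C, hC, hf⟩ := hf
  refine ⟨C * (c⁻¹ * c⁻¹), by positivity, fun x hx y hy => ?_⟩
  have h1 := hf x hx y hy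
  have hx0 := hc.trans_le (hfc x hx)
  have hy0 := hc.trans_le (hfc y hy)
  rw [Real.dist_eq, inv_sub_inv hx0.ne' hy0.ne', abs_div, abs_of_pos (mul_pos hx0 hy0),
    abs_sub_comm, ← Real.dist_eq, div_eq_mul_inv, mul_inv]
  calc dist (f x) (f y) * ((f x)⁻¹ * (f y)⁻¹) ≤ (C * dist x y ^ β) * (c⁻¹ * c⁻¹) := by
        gcongr
        exacts [hfc x hx, hfc y hy]
    _ = _ := by ring

theorem ofReal {f : X → ℝ} (hf : IsHolder β s f) : IsHolder β s (fun x => (f x : ℂ)) := by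
  obtain ⟨C, hC, hf⟩ := hf
  refine ⟨C, hC, fun x hx y hy => ?_⟩
  rw [Complex.dist_eq, ← Complex.ofReal_sub, Complex.norm_real, ← dist_eq_norm]
  exact hf x hx y hy

theorem norm [SeminormedAddCommGroup E] {f : X → E} (hf : IsHolder β s f) :
    IsHolder β s (fun x => ‖f x‖) := by
  obtain ⟨C, hC, hf⟩ := hf
  refine ⟨C, hC, fun x hx y hy => (hf x hx y hy).trans' ?_⟩
  rw [dist_eq_norm, dist_eq_norm]
  exact abs_norm_sub_norm_le _ _

theorem conjugate {f : X → ℂ} (hf : IsHolder β s f) : IsHolder β s (fun x => (starRingEnd ℂ) (f x)) := by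
  obtain ⟨C, hC, hf⟩ := hf
  refine ⟨C, hC, fun x hx y hy => (hf x hx y hy).trans' ?_⟩
  rw [Complex.dist_conj_conj]

/-- The exponential of a Hölder function on a bounded set. -/
theorem exp_comp {f : X → ℂ} (hβ : 0 ≤ β) (hs : Bornology.IsBounded s) (hf : IsHolder β s f) :
    IsHolder β s (fun x => exp (f x)) := by
  obtain ⟨M, hM, hfM⟩ := hf.exists_norm_le hβ hs
  have h1 : LipschitzOnWith (Real.exp M).toNNReal Complex.exp (closedBall 0 M) := by
    refine (convex_closedBall (0 : ℂ) M).lipschitzOnWith_of_nnnorm_deriv_le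
      (fun x _ => Complex.differentiable_exp x) fun x hx => ?_
    rw [← NNReal.coe_le_coe, coe_nnnorm, Complex.deriv_exp, Real.coe_toNNReal _ (Real.exp_pos M).le,
      Complex.norm_exp]
    exact Real.exp_le_exp.2 ((Complex.re_le_norm x).trans (by simpa using hx))
  exact hf.lipschitz_comp h1 fun x hx => by simpa using hfM x hx

/-- If a function has Hölder estimates at small scale and is bounded, it is Hölder. -/
theorem of_local [SeminormedAddCommGroup E] {f : X → E} {ε C M : ℝ} (hβ : 0 ≤ β) (hε : 0 < ε)
    (hC : 0 ≤ C) (hM : ∀ x ∈ s, ‖f x‖ ≤ M)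
    (h : ∀ x ∈ s, ∀ y ∈ s, dist x y < ε → dist (f x) (f y) ≤ C * dist x y ^ β) :
    IsHolder β s f := by
  refine ⟨max C (2 * M * (ε ^ β)⁻¹), le_max_of_le_left hC, fun x hx y hy => ?_⟩
  rcases lt_or_ge (dist x y) ε with hd | hd
  · exact (h x hx y hy hd).trans (by gcongr; exact le_max_left _ _)
  · have hM0 : 0 ≤ M := (norm_nonneg _).trans (hM x hx)
    have h1 : dist (f x) (f y) ≤ 2 * M := by
      rw [dist_eq_norm]
      have := norm_sub_le (f x) (f y)
      linarith [hM x hx, hM y hy]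
    have h2 : ε ^ β ≤ dist x y ^ β := by gcongr
    have h3 : 0 < ε ^ β := by positivity
    calc dist (f x) (f y) ≤ 2 * M * (ε ^ β)⁻¹ * ε ^ β := by
          rw [mul_assoc, inv_mul_cancel₀ h3.ne', mul_one]; exact h1
      _ ≤ max C (2 * M * (ε ^ β)⁻¹) * dist x y ^ β := by gcongr; exact le_max_right _ _

/-- A continuous real function on a compact set is Hölder if its complex exponential is. -/
theorem of_exp_mul_I {f : X → ℝ} (hβ : 0 ≤ β) (hs : IsCompact s) (hf : ContinuousOn f s)
    (h : IsHolder β s (fun x => exp (f x * I))) : IsHolder β s f := by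
  obtain ⟨C, hC, h⟩ := h
  obtain ⟨M, hM⟩ := hs.exists_bound_of_continuousOn hf
  have hu := hs.uniformContinuousOn_of_continuous hf
  -- The oscillation bound π is what Jordan's inequality needs: for |t| ≤ π the chord 2|sin(t/2)| is
  -- at least 2|t|/π, so differences of `f` are controlled by those of its exponential.
  obtain ⟨ε, hε, hε1⟩ := Metric.uniformContinuousOn_iff.1 hu Real.pi Real.pi_pos
  refine of_local (C := Real.pi / 2 * C) hβ hε (by positivity) hM fun x hx y hy hxy => ?_
  have h1 := hε1 x hx y hy hxy
  have h2 := h x hx y hy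
  rw [Real.dist_eq] at h1 ⊢
  have h3 : dist (exp (f x * I)) (exp (f y * I)) = 2 * |Real.sin ((f x - f y) / 2)| := by
    rw [Complex.dist_eq]
    have : exp (f x * I) - exp (f y * I) = exp (f y * I) * (exp (I * ((f x - f y : ℝ) : ℂ)) - 1) := by
      rw [mul_sub, ← Complex.exp_add, mul_one]; congr 2; push_cast; ring
    rw [this, norm_mul, Complex.norm_exp_ofReal_mul_I, one_mul, Complex.norm_exp_I_mul_ofReal_sub_one,
      Real.norm_eq_abs, abs_mul]
    norm_num
  have h4 : 2 / Real.pi * |(f x - f y) / 2| ≤ |Real.sin ((f x - f y) / 2)| := by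
    apply Real.mul_abs_le_abs_sin
    rw [abs_div, abs_two]; linarith
  rw [abs_div, abs_two] at h4
  have hp := Real.pi_pos
  rw [h3] at h2
  calc |f x - f y| = Real.pi / 2 * (2 * (2 / Real.pi * (|f x - f y| / 2))) := by field_simp
    _ ≤ Real.pi / 2 * (C * dist x y ^ β) := by gcongr Real.pi / 2 * ?_; linarith
    _ = _ := by ring

end Normed

/-- Hölder functions on adjacent intervals. -/
theorem Icc_union {E : Type*} [PseudoMetricSpace E] {β a b c : ℝ} {f : ℝ → E} (hβ : 0 ≤ β)
    (h₁ : IsHolder β (Icc a b) f) (h₂ : IsHolder β (Icc b c) f) : IsHolder β (Icc a c) f := by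
  obtain ⟨C, hC, h₁⟩ := h₁
  obtain ⟨D, hD, h₂⟩ := h₂
  have key : ∀ x ∈ Icc a c, ∀ y ∈ Icc a c, x ≤ y → dist (f x) (f y) ≤ (C + D) * dist x y ^ β := by
    intro x hx y hy hxy
    rcases le_total y b with hyb | hyb
    · refine (h₁ x ⟨hx.1, hxy.trans hyb⟩ y ⟨hy.1, hyb⟩).trans ?_
      gcongr; linarith
    rcases le_total b x with hxb | hxb
    · refine (h₂ x ⟨hxb, hx.2⟩ y ⟨hyb, hy.2⟩).trans ?_
      gcongr; linarith
    have h3 := h₁ x ⟨hx.1, hxb⟩ b ⟨hx.1.trans hxb, le_rfl⟩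
    have h4 := h₂ b ⟨le_rfl, hyb.trans hy.2⟩ y ⟨hyb, hy.2⟩
    have h5 : dist x b ≤ dist x y := by
      rw [Real.dist_eq, Real.dist_eq, abs_sub_comm, abs_sub_comm x, abs_of_nonneg, abs_of_nonneg] <;>
        linarith
    have h6 : dist b y ≤ dist x y := by
      rw [Real.dist_eq, Real.dist_eq, abs_sub_comm, abs_sub_comm x, abs_of_nonneg, abs_of_nonneg] <;>
        linarith
    calc dist (f x) (f y) ≤ dist (f x) (f b) + dist (f b) (f y) := dist_triangle _ _ _
      _ ≤ C * dist x b ^ β + D * dist b y ^ β := add_le_add h3 h4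
      _ ≤ C * dist x y ^ β + D * dist x y ^ β := by gcongr
      _ = _ := by ring
  refine ⟨C + D, by positivity, fun x hx y hy => ?_⟩
  rcases le_total x y with h | h
  · exact key x hx y hy h
  · rw [dist_comm, dist_comm x]; exact key y hy x hx h

/-- A function on the unit circle is Hölder if its pull-back to `[0, 2π]` is. -/
theorem sphere_of_exp {E : Type*} [PseudoMetricSpace E] {β : ℝ} {g : ℂ → E} (hβ : 0 ≤ β)
    (h : IsHolder β (Icc 0 (2 * Real.pi)) (fun θ : ℝ => g (exp (θ * I)))) :
    IsHolder β (sphere 0 1) g := by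
  obtain ⟨C, hC, h⟩ := h
  have hp := Real.pi_pos
  have hchord : ∀ s t : ℝ, dist (exp (s * I)) (exp (t * I)) = 2 * |Real.sin ((t - s) / 2)| := by
    intro s t
    rw [dist_comm, Complex.dist_eq]
    have : exp (t * I) - exp (s * I) = exp (s * I) * (exp (I * ((t - s : ℝ) : ℂ)) - 1) := by
      rw [mul_sub, ← Complex.exp_add, mul_one]; congr 2; push_cast; ring
    rw [this, norm_mul, Complex.norm_exp_ofReal_mul_I, one_mul, Complex.norm_exp_I_mul_ofReal_sub_one,
      Real.norm_eq_abs, abs_mul]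
    norm_num
  have key : ∀ s ∈ Icc 0 (2 * Real.pi), ∀ t ∈ Icc 0 (2 * Real.pi), s ≤ t →
      dist (g (exp (s * I))) (g (exp (t * I))) ≤
        2 * C * (Real.pi / 2) ^ β * dist (exp (s * I)) (exp (t * I)) ^ β := by
    intro s hs t ht hst
    rw [hchord, mul_assoc (2 * C), ← Real.mul_rpow (by positivity) (by positivity)]
    -- For an arc of length at most π the chord is comparable to t - s. Otherwise it is comparable
    -- to the complementary length 2π - (t - s), and the comparison goes through the point 1, where
    -- the parameters 0 and 2π meet; the two pieces give the factor 2.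
    rcases le_total (t - s) Real.pi with hd | hd
    · have h1 : 2 / Real.pi * ((t - s) / 2) ≤ |Real.sin ((t - s) / 2)| :=
        (Real.mul_le_sin (by linarith) (by linarith)).trans (le_abs_self _)
      have h2 : t - s ≤ Real.pi / 2 * (2 * |Real.sin ((t - s) / 2)|) := by
        calc t - s = Real.pi / 2 * (2 * (2 / Real.pi * ((t - s) / 2))) := by field_simp
          _ ≤ _ := by gcongr
      have h3 := h s hs t ht
      rw [dist_comm s, Real.dist_eq, abs_of_nonneg (by linarith : 0 ≤ t - s)] at h3
      calc _ ≤ C * (t - s) ^ β := h3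
        _ ≤ 2 * C * (Real.pi / 2 * (2 * |Real.sin ((t - s) / 2)|)) ^ β := by
          gcongr
          linarith
    · have h1 : 2 / Real.pi * ((2 * Real.pi - (t - s)) / 2) ≤ |Real.sin ((t - s) / 2)| := by
        have h0 : Real.sin ((t - s) / 2) = Real.sin ((2 * Real.pi - (t - s)) / 2) := by
          rw [← Real.sin_pi_sub]; congr 1; ring
        rw [h0]
        exact (Real.mul_le_sin (by linarith [hs.1, ht.2]) (by linarith)).trans (le_abs_self _)
      have h2 : 2 * Real.pi - (t - s) ≤ Real.pi / 2 * (2 * |Real.sin ((t - s) / 2)|) := by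
        calc 2 * Real.pi - (t - s)
            = Real.pi / 2 * (2 * (2 / Real.pi * ((2 * Real.pi - (t - s)) / 2))) := by field_simp
          _ ≤ _ := by gcongr
      have h3 := h 0 ⟨le_rfl, by positivity⟩ s hs
      have h4 := h t ht (2 * Real.pi) ⟨by positivity, le_rfl⟩
      rw [dist_comm 0, Real.dist_eq, sub_zero, abs_of_nonneg hs.1] at h3
      rw [dist_comm t, Real.dist_eq, abs_of_nonneg (by linarith [ht.2])] at h4
      have h5 : g (exp ((0 : ℝ) * I)) = g (exp ((2 * Real.pi : ℝ) * I)) := by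
        push_cast
        rw [Complex.exp_two_pi_mul_I]; simp
      have h6 : dist (g (exp (s * I))) (g (exp (t * I))) ≤ C * s ^ β + C * (2 * Real.pi - t) ^ β := by
        refine (dist_triangle_left _ _ (g (exp ((0 : ℝ) * I)))).trans (add_le_add h3 ?_)
        rw [h5, dist_comm]; exact h4
      set u := Real.pi / 2 * (2 * |Real.sin ((t - s) / 2)|)
      have h7 : s ^ β ≤ u ^ β := by
        gcongr
        · exact hs.1
        · linarith [ht.2]
      have h8 : (2 * Real.pi - t) ^ β ≤ u ^ β := by
        gcongr
        · linarith [ht.2]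
        · linarith [hs.1]
      calc _ ≤ _ := h6
        _ ≤ C * u ^ β + C * u ^ β := by gcongr
        _ = _ := by ring
  have hparam : ∀ z ∈ sphere (0 : ℂ) 1, ∃ θ ∈ Icc 0 (2 * Real.pi), exp (θ * I) = z := by
    intro z hz
    have h0 : ‖z‖ = 1 := by simpa using hz
    have h1 : exp (z.arg * I) = z := by
      have := Complex.norm_mul_exp_arg_mul_I z
      rwa [h0, ofReal_one, one_mul] at this
    rcases le_total 0 z.arg with h2 | h2
    · exact ⟨z.arg, ⟨h2, by linarith [Complex.arg_le_pi z]⟩, h1⟩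
    · refine ⟨z.arg + 2 * Real.pi, ⟨by linarith [Complex.neg_pi_lt_arg z], by linarith⟩, ?_⟩
      push_cast
      rw [add_mul, Complex.exp_add, Complex.exp_two_pi_mul_I, mul_one, h1]
  refine ⟨2 * C * (Real.pi / 2) ^ β, by positivity, fun x hx y hy => ?_⟩
  obtain ⟨s, hs, rfl⟩ := hparam x hx
  obtain ⟨t, ht, rfl⟩ := hparam y hy
  rcases le_total s t with hst | hst
  · exact key s hs t ht hst
  · rw [dist_comm, dist_comm (exp (s * I))]; exact key t ht s hs hst

end IsHolder

/-! ### The Hardy–Littlewood theorem and extension to the closed disc. -/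

open Filter Topology MeasureTheory

/-- Hölder functions on the closed unit disc which are holomorphic inside. -/
structure HolderDisc (β : ℝ) (F : ℂ → ℂ) : Prop where
  differentiableOn : DifferentiableOn ℂ F (ball 0 1)
  isHolder : IsHolder β (closedBall 0 1) F

theorem norm_ofReal_mul_lt_one {z : ℂ} {r : ℝ} (hr0 : 0 ≤ r) (hr1 : r ≤ 1) (hz : ‖z‖ < 1) :
    ‖(r : ℂ) * z‖ < 1 := by
  rw [norm_mul, Complex.norm_real, Real.norm_of_nonneg hr0]
  exact (mul_le_of_le_one_left (norm_nonneg _) hr1).trans_lt hz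

/-- The radial part of the Hardy–Littlewood estimate. -/
theorem norm_sub_radial_le {β C : ℝ} (hβ : 0 < β) (hβ1 : β ≤ 1) {F : ℂ → ℂ} (hC : 0 ≤ C)
    (hF : DifferentiableOn ℂ F (ball 0 1))
    (h : ∀ z ∈ ball (0 : ℂ) 1, ‖deriv F z‖ ≤ C * (1 - ‖z‖) ^ (β - 1))
    {z : ℂ} (hz : z ∈ ball (0 : ℂ) 1) {d : ℝ} (hd0 : 0 ≤ d) (hd1 : d ≤ 1) :
    ‖F (((1 - d : ℝ) : ℂ) * z) - F z‖ ≤ C / β * d ^ β := by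
  have hz1 : ‖z‖ < 1 := by simpa using hz
  have hmem : ∀ s ∈ Icc 0 d, ((1 - s : ℝ) : ℂ) * z ∈ ball (0 : ℂ) 1 := fun s hs => by
    rw [mem_ball_zero_iff]
    exact norm_ofReal_mul_lt_one (by linarith [hs.2]) (by linarith [hs.1]) hz1
  have hderiv : ∀ s ∈ Icc 0 d, HasDerivAt (fun s : ℝ => F (((1 - s : ℝ) : ℂ) * z))
      (-z * deriv F (((1 - s : ℝ) : ℂ) * z)) s := fun s hs => by
    have h1 : HasDerivAt (fun s : ℝ => ((1 - s : ℝ) : ℂ) * z) (-z) s := by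
      have h0 : HasDerivAt (fun s : ℝ => (1 : ℝ) - s) (-1) s := by
        simpa using (hasDerivAt_id s).const_sub 1
      have h2 := (h0.ofReal_comp).mul_const z
      simpa using h2
    have h2 := (hF.differentiableAt (isOpen_ball.mem_nhds (hmem s hs))).hasDerivAt
    have := HasDerivAt.scomp s h2 h1
    simpa [smul_eq_mul, Function.comp_def] using this
  have hcont : ContinuousOn (fun s : ℝ => -z * deriv F (((1 - s : ℝ) : ℂ) * z)) (Icc 0 d) := by
    refine continuousOn_const.mul ?_
    refine (hF.deriv isOpen_ball).continuousOn.comp (t := ball 0 1) ?_ hmem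
    fun_prop
  have hint := intervalIntegral.integral_eq_sub_of_hasDerivAt
    (f := fun s : ℝ => F (((1 - s : ℝ) : ℂ) * z)) (a := 0) (b := d)
    (fun s hs => hderiv s (by rwa [uIcc_of_le hd0] at hs))
    (ContinuousOn.intervalIntegrable (by rwa [uIcc_of_le hd0]))
  simp only [sub_zero, ofReal_one, one_mul] at hint
  rw [← hint]
  have hb : IntervalIntegrable (fun s : ℝ => C * s ^ (β - 1)) volume 0 d :=
    (intervalIntegral.intervalIntegrable_rpow' (by linarith)).const_mul C
  refine (intervalIntegral.norm_integral_le_of_norm_le hd0 (Eventually.of_forall ?_) hb).trans ?_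
  · intro s hs
    have hs' : s ∈ Icc 0 d := ⟨hs.1.le, hs.2⟩
    rw [norm_mul, norm_neg]
    have h1 := h _ (hmem s hs')
    rw [norm_mul, Complex.norm_real, Real.norm_of_nonneg (by linarith [hs.2] : 0 ≤ 1 - s)] at h1
    -- The point (1-s)z has distance at least s from the circle and the exponent is nonpositive. The
    -- resulting bound s^(β-1) is integrable at 0 because β > 0.
    have h2 : (1 - (1 - s) * ‖z‖) ^ (β - 1) ≤ s ^ (β - 1) := by
      apply Real.rpow_le_rpow_of_nonpos hs.1 _ (by linarith)
      nlinarith [norm_nonneg z, hs.1, hs.2]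
    calc ‖z‖ * ‖deriv F (((1 - s : ℝ) : ℂ) * z)‖ ≤ 1 * (C * (1 - (1 - s) * ‖z‖) ^ (β - 1)) := by
          gcongr
      _ ≤ C * s ^ (β - 1) := by rw [one_mul]; gcongr
  · rw [intervalIntegral.integral_const_mul, integral_rpow (Or.inl (by linarith))]
    simp only [sub_add_cancel]
    rw [Real.zero_rpow hβ.ne', sub_zero]
    apply le_of_eq; ring

/-- The Hardy–Littlewood theorem: a growth condition on the derivative implies Hölder
continuity. -/
theorem isHolder_of_norm_deriv_le {β C : ℝ} (hβ : 0 < β) (hβ1 : β ≤ 1) {F : ℂ → ℂ} (hC : 0 ≤ C)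
    (hF : DifferentiableOn ℂ F (ball 0 1))
    (h : ∀ z ∈ ball (0 : ℂ) 1, ‖deriv F z‖ ≤ C * (1 - ‖z‖) ^ (β - 1)) :
    IsHolder β (ball 0 1) F := by
  refine ⟨C / β + C + C / β, by positivity, fun z hz w hw => ?_⟩
  have hz1 : ‖z‖ < 1 := by simpa using hz
  have hw1 : ‖w‖ < 1 := by simpa using hw
  -- Both points are pulled inwards by the factor 1 - d, each at cost (C/β)d^β. In the convex disc
  -- of radius 1 - d the derivative is at most C d^(β-1), so the remaining step costs C d^β. The cap
  -- at 1 keeps the factor nonnegative.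
  set d := min (dist z w) 1 with hd
  have hd0 : 0 ≤ d := le_min dist_nonneg zero_le_one
  have hd1 : d ≤ 1 := min_le_right _ _
  have hdd : d ≤ dist z w := min_le_left _ _
  have h1 := norm_sub_radial_le hβ hβ1 hC hF h hz hd0 hd1
  have h2 := norm_sub_radial_le hβ hβ1 hC hF h hw hd0 hd1
  have h3 : ‖F (((1 - d : ℝ) : ℂ) * z) - F (((1 - d : ℝ) : ℂ) * w)‖ ≤ C * d ^ β := by
    rcases eq_or_lt_of_le hd0 with h0 | h0
    · have : z = w := by
        by_contra hne
        have : 0 < d := lt_min (dist_pos.2 hne) one_pos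
        linarith
      subst this
      simp only [sub_self, norm_zero]
      positivity
    rcases eq_or_lt_of_le hd1 with h4 | h4
    · rw [h4]; simpa using hC
    have hsub : closedBall (0 : ℂ) (1 - d) ⊆ ball 0 1 := closedBall_subset_ball (by linarith)
    have hm : ∀ u : ℂ, ‖u‖ < 1 → ((1 - d : ℝ) : ℂ) * u ∈ closedBall (0 : ℂ) (1 - d) := fun u hu => by
      rw [mem_closedBall_zero_iff, norm_mul, Complex.norm_real, Real.norm_of_nonneg (by linarith)]
      exact mul_le_of_le_one_right (by linarith) hu.le
    have := (convex_closedBall (0 : ℂ) (1 - d)).norm_image_sub_le_of_norm_deriv_le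
      (f := F) (C := C * d ^ (β - 1))
      (fun x hx => hF.differentiableAt (isOpen_ball.mem_nhds (hsub hx)))
      (fun x hx => (h x (hsub hx)).trans (by
        refine mul_le_mul_of_nonneg_left (Real.rpow_le_rpow_of_nonpos h0 ?_ (by linarith)) hC
        have : ‖x‖ ≤ 1 - d := by simpa using hx
        linarith)) (hm w hw1) (hm z hz1)
    refine this.trans ?_
    rw [← mul_sub, norm_mul, Complex.norm_real, Real.norm_of_nonneg (by linarith)]
    have h5 : d ^ β = d ^ (β - 1) * d := by
      rw [Real.rpow_sub_one h0.ne']; field_simp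
    rw [h5, mul_assoc]
    have h6 : (1 - d) * ‖z - w‖ ≤ d := by
      rw [← dist_eq_norm]
      have h8 : dist z w = d ∨ d = 1 := by
        rcases min_choice (dist z w) 1 with h | h
        · left; rw [hd, h]
        · right; rw [hd, h]
      rcases h8 with h8 | h8
      · rw [h8]; nlinarith
      · linarith
    gcongr
  have h9 : d ^ β ≤ dist z w ^ β := Real.rpow_le_rpow hd0 hdd hβ.le
  rw [dist_eq_norm]
  set a := F (((1 - d : ℝ) : ℂ) * z)
  set b := F (((1 - d : ℝ) : ℂ) * w)
  calc ‖F z - F w‖ = ‖-(a - F z) + (a - b) + (b - F w)‖ := by congr 1; ring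
    _ ≤ ‖a - F z‖ + ‖a - b‖ + ‖b - F w‖ := by
        refine (norm_add₃_le).trans ?_
        rw [norm_neg]
    _ ≤ C / β * d ^ β + C * d ^ β + C / β * d ^ β := by gcongr
    _ = (C / β + C + C / β) * d ^ β := by ring
    _ ≤ _ := by gcongr

/-- A holomorphic Hölder function on the open disc extends to the closed disc. -/
theorem exists_holderDisc_of_isHolder_ball {β : ℝ} (hβ : 0 < β) {F : ℂ → ℂ}
    (hF : DifferentiableOn ℂ F (ball 0 1)) (h : IsHolder β (ball 0 1) F) :
    ∃ G, HolderDisc β G ∧ EqOn G F (ball 0 1) := by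
  have hcont := h.continuousOn hβ
  obtain ⟨C, hC, h⟩ := h
  -- The extension is the limit of the dilates F(r_n z). They converge by the Hölder bound along
  -- radii, and since dilations contract distances the limit keeps the same Hölder constant.
  let r : ℕ → ℝ := fun n => 1 - 1 / ((n : ℝ) + 1)
  have hr0 : ∀ n, 0 ≤ r n := fun n => by
    have : 1 / ((n : ℝ) + 1) ≤ 1 := by rw [div_le_one (by positivity)]; simp
    simp only [r]; linarith
  have hr1 : ∀ n, r n < 1 := fun n => by
    have : 0 < 1 / ((n : ℝ) + 1) := by positivity
    simp only [r]; linarith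
  have hrt : Tendsto r atTop (𝓝 1) := by
    have := (tendsto_one_div_add_atTop_nhds_zero_nat (𝕜 := ℝ)).const_sub 1
    simpa [r] using this
  have hmem : ∀ n, ∀ z ∈ closedBall (0 : ℂ) 1, (r n : ℂ) * z ∈ ball (0 : ℂ) 1 := fun n z hz => by
    have hz1 : ‖z‖ ≤ 1 := by simpa using hz
    rw [mem_ball_zero_iff, norm_mul, Complex.norm_real, Real.norm_of_nonneg (hr0 n)]
    exact (mul_le_of_le_one_right (hr0 n) hz1).trans_lt (hr1 n)
  have hdist : ∀ n, ∀ z w : ℂ, dist ((r n : ℂ) * z) (r n * w) ≤ dist z w := fun n z w => by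
    rw [dist_eq_norm, dist_eq_norm, ← mul_sub, norm_mul, Complex.norm_real,
      Real.norm_of_nonneg (hr0 n)]
    exact mul_le_of_le_one_left (norm_nonneg _) (hr1 n).le
  have hlim : ∀ z ∈ closedBall (0 : ℂ) 1, ∃ a, Tendsto (fun n => F (r n * z)) atTop (𝓝 a) := by
    intro z hz
    have hz1 : ‖z‖ ≤ 1 := by simpa using hz
    apply cauchySeq_tendsto_of_complete
    have hcs := hrt.cauchySeq
    rw [Metric.cauchySeq_iff] at hcs ⊢
    intro ε hε
    obtain ⟨N, hN⟩ := hcs ((ε / (C + 1)) ^ β⁻¹) (by positivity)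
    refine ⟨N, fun m hm n hn => ?_⟩
    have h1 := h _ (hmem m z hz) _ (hmem n z hz)
    have h2 : dist ((r m : ℂ) * z) (r n * z) ≤ dist (r m) (r n) := by
      rw [dist_eq_norm, ← sub_mul, norm_mul, ← ofReal_sub, Complex.norm_real, ← dist_eq_norm]
      exact mul_le_of_le_one_right dist_nonneg hz1
    have h3 : dist (r m) (r n) ^ β ≤ ε / (C + 1) := by
      calc dist (r m) (r n) ^ β ≤ ((ε / (C + 1)) ^ β⁻¹) ^ β := by
            gcongr; exact (hN m hm n hn).le
        _ = ε / (C + 1) := Real.rpow_inv_rpow (by positivity) hβ.ne'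
    calc _ ≤ C * dist ((r m : ℂ) * z) (r n * z) ^ β := h1
      _ ≤ C * (ε / (C + 1)) := by
        gcongr
        exact (Real.rpow_le_rpow dist_nonneg h2 hβ.le).trans h3
      _ < ε := by
        rw [← mul_div_assoc, div_lt_iff₀ (by positivity)]; nlinarith
  choose! G hG using hlim
  have hGF : EqOn G F (ball 0 1) := fun z hz => by
    refine tendsto_nhds_unique (hG z (ball_subset_closedBall hz)) ?_
    have h1 : Tendsto (fun n => (r n : ℂ) * z) atTop (𝓝 z) := by
      have := ((Complex.continuous_ofReal.tendsto 1).comp hrt).mul_const z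
      simpa [Function.comp_def] using this
    exact ((hcont.continuousAt (isOpen_ball.mem_nhds hz)).tendsto).comp h1
  refine ⟨G, ⟨hF.congr hGF, C, hC, fun z hz w hw => ?_⟩, hGF⟩
  refine le_of_tendsto' ((hG z hz).dist (hG w hw)) fun n => ?_
  refine (h _ (hmem n z hz) _ (hmem n w hw)).trans ?_
  gcongr
  exact hdist n z w

theorem exists_holderDisc_of_norm_deriv_le {β C : ℝ} (hβ : 0 < β) (hβ1 : β ≤ 1) {F : ℂ → ℂ}
    (hC : 0 ≤ C) (hF : DifferentiableOn ℂ F (ball 0 1))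
    (h : ∀ z ∈ ball (0 : ℂ) 1, ‖deriv F z‖ ≤ C * (1 - ‖z‖) ^ (β - 1)) :
    ∃ G, HolderDisc β G ∧ EqOn G F (ball 0 1) :=
  exists_holderDisc_of_isHolder_ball hβ hF (isHolder_of_norm_deriv_le hβ hβ1 hC hF h)

/-- Two continuous functions on the closed disc that agree on the open disc agree. -/
theorem eqOn_closedBall_of_eqOn_ball {F G : ℂ → ℂ} (hF : ContinuousOn F (closedBall 0 1))
    (hG : ContinuousOn G (closedBall 0 1)) (h : EqOn F G (ball 0 1)) :
    EqOn F G (closedBall 0 1) :=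
  h.of_subset_closure hF hG ball_subset_closedBall
    (by rw [closure_ball _ one_ne_zero])

/-! ### Integrals of |ζ - z|^(β-2) over the circle. -/

theorem norm_exp_mul_I_sub_one (t : ℝ) : ‖exp (t * I) - 1‖ = 2 * |Real.sin (t / 2)| := by
  rw [mul_comm, Complex.norm_exp_I_mul_ofReal_sub_one, Real.norm_eq_abs, abs_mul]
  norm_num

/-- The distance |e^{it} - r| dominates both (1-r)/π and, by Jordan's inequality and the triangle
inequality, |t|/π; adding the two bounds gives the constant 1/(2π). -/
theorem add_abs_le_norm_exp_sub {r t : ℝ} (hr0 : 0 ≤ r) (hr1 : r ≤ 1) (ht : |t| ≤ Real.pi) :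
    (2 * Real.pi)⁻¹ * ((1 - r) + |t|) ≤ ‖exp (t * I) - r‖ := by
  have hp := Real.pi_pos
  have h1 : 1 - r ≤ ‖exp (t * I) - r‖ := by
    have := norm_sub_norm_le (exp (t * I)) (r : ℂ)
    rwa [Complex.norm_exp_ofReal_mul_I, Complex.norm_real, Real.norm_of_nonneg hr0] at this
  have h2 : 2 / Real.pi * |t| ≤ ‖exp (t * I) - 1‖ := by
    rw [norm_exp_mul_I_sub_one]
    have : 2 / Real.pi * |t / 2| ≤ |Real.sin (t / 2)| := by
      apply Real.mul_abs_le_abs_sin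
      rw [abs_div, abs_two]; linarith
    rw [abs_div, abs_two] at this
    linarith
  have h3 : ‖exp (t * I) - 1‖ ≤ ‖exp (t * I) - r‖ + (1 - r) := by
    calc ‖exp (t * I) - 1‖ = ‖(exp (t * I) - r) + ((r - 1 : ℝ) : ℂ)‖ := by
          congr 1; push_cast; ring
      _ ≤ ‖exp (t * I) - r‖ + ‖((r - 1 : ℝ) : ℂ)‖ := norm_add_le _ _
      _ = _ := by
        rw [Complex.norm_real, Real.norm_eq_abs, abs_of_nonpos (by linarith)]; ring
  have h4 : |t| ≤ Real.pi * ‖exp (t * I) - r‖ := by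
    have : |t| = Real.pi / 2 * (2 / Real.pi * |t|) := by field_simp
    rw [this]
    calc Real.pi / 2 * (2 / Real.pi * |t|) ≤ Real.pi / 2 * (2 * ‖exp (t * I) - r‖) := by
          gcongr Real.pi / 2 * ?_; linarith
      _ = _ := by ring
  have h5 : 1 - r ≤ Real.pi * ‖exp (t * I) - r‖ :=
    h1.trans (le_mul_of_one_le_left (norm_nonneg _) (by linarith [Real.pi_gt_three]))
  rw [inv_mul_le_iff₀ (by positivity)]
  linarith

/-- The negative exponent reverses the bound of `add_abs_le_norm_exp_sub`, and (1-r+|t|)^(β-2)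
integrates explicitly. Since β - 2 < -1, the value at the lower end dominates and gives (1-r)^(β-1).
-/
theorem integral_norm_exp_sub_rpow_le {β r : ℝ} (hβ1 : β < 1) (hr0 : 0 ≤ r) (hr1 : r < 1) :
    ∫ t in -Real.pi..Real.pi, ‖exp (t * I) - r‖ ^ (β - 2) ≤
      (2 * Real.pi)⁻¹ ^ (β - 2) * (2 / (1 - β)) * (1 - r) ^ (β - 1) := by
  have hp := Real.pi_pos
  have hpos : ∀ t : ℝ, 0 < (1 - r) + |t| := fun t => by
    have := abs_nonneg t
    linarith
  have hne : ∀ t : ℝ, 0 < ‖exp (t * I) - r‖ := fun t => by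
    rw [norm_pos_iff, sub_ne_zero]
    intro h
    have := congrArg norm h
    rw [Complex.norm_exp_ofReal_mul_I, Complex.norm_real, Real.norm_of_nonneg hr0] at this
    linarith
  have hc1 : Continuous fun t : ℝ => ‖exp (t * I) - r‖ ^ (β - 2) :=
    Continuous.rpow_const (by fun_prop) fun t => Or.inl (hne t).ne'
  have hc2 : Continuous fun t : ℝ => ((1 - r) + |t|) ^ (β - 2) :=
    Continuous.rpow_const (by fun_prop) fun t => Or.inl (hpos t).ne'
  have hhalf : ∫ t in (0 : ℝ)..Real.pi, ((1 - r) + |t|) ^ (β - 2) ≤ (1 - r) ^ (β - 1) / (1 - β) := by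
    have h1 : ∫ t in (0 : ℝ)..Real.pi, ((1 - r) + |t|) ^ (β - 2) =
        ∫ t in (0 : ℝ)..Real.pi, ((1 - r) + t) ^ (β - 2) := by
      apply intervalIntegral.integral_congr
      intro t ht
      rw [uIcc_of_le hp.le] at ht
      simp only [abs_of_nonneg ht.1]
    rw [h1, intervalIntegral.integral_comp_add_left (fun x : ℝ => x ^ (β - 2)), integral_rpow]
    · have h2 : β - 2 + 1 = β - 1 := by ring
      rw [h2, add_zero]
      have h3 : 0 ≤ (1 - r + Real.pi) ^ (β - 1) := Real.rpow_nonneg (by linarith) _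
      rw [show β - 1 = -(1 - β) by ring, div_neg, ← neg_div, neg_sub, ← show β - 1 = -(1 - β) by ring]
      gcongr
      linarith
    · right
      refine ⟨by linarith, fun h => ?_⟩
      rw [uIcc_of_le (by linarith)] at h
      linarith [h.1]
  have hneg : ∫ t in -Real.pi..0, ((1 - r) + |t|) ^ (β - 2) =
      ∫ t in (0 : ℝ)..Real.pi, ((1 - r) + |t|) ^ (β - 2) := by
    have := intervalIntegral.integral_comp_neg (a := 0) (b := Real.pi)
      (fun t : ℝ => ((1 - r) + |t|) ^ (β - 2))
    simp only [abs_neg, neg_zero] at this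
    exact this.symm
  calc ∫ t in -Real.pi..Real.pi, ‖exp (t * I) - r‖ ^ (β - 2)
      ≤ ∫ t in -Real.pi..Real.pi, (2 * Real.pi)⁻¹ ^ (β - 2) * ((1 - r) + |t|) ^ (β - 2) := by
        apply intervalIntegral.integral_mono_on (by linarith) (hc1.intervalIntegrable _ _)
          ((hc2.const_mul _).intervalIntegrable _ _)
        intro t ht
        rw [← Real.mul_rpow (by positivity) (hpos t).le]
        refine Real.rpow_le_rpow_of_nonpos (mul_pos (by positivity) (hpos t)) ?_ (by linarith)
        exact add_abs_le_norm_exp_sub hr0 hr1.le (abs_le.2 ht)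
    _ = (2 * Real.pi)⁻¹ ^ (β - 2) * (2 * ∫ t in (0 : ℝ)..Real.pi, ((1 - r) + |t|) ^ (β - 2)) := by
        rw [intervalIntegral.integral_const_mul, ← intervalIntegral.integral_add_adjacent_intervals
          (hc2.intervalIntegrable (-Real.pi) 0) (hc2.intervalIntegrable 0 Real.pi), hneg,
          two_mul (∫ t in (0 : ℝ)..Real.pi, ((1 - r) + |t|) ^ (β - 2))]
    _ ≤ (2 * Real.pi)⁻¹ ^ (β - 2) * (2 * ((1 - r) ^ (β - 1) / (1 - β))) := by gcongr
    _ = _ := by ring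

theorem norm_circleMap_sub_pos {z : ℂ} (hz : ‖z‖ < 1) (t : ℝ) : 0 < ‖circleMap 0 1 t - z‖ := by
  rw [norm_pos_iff, sub_ne_zero]
  intro h
  rw [← h] at hz
  simp at hz

theorem continuous_norm_circleMap_sub_rpow {z : ℂ} (hz : ‖z‖ < 1) (p : ℝ) :
    Continuous fun t : ℝ => ‖circleMap 0 1 t - z‖ ^ p :=
  Continuous.rpow_const (by fun_prop) fun t => Or.inl (norm_circleMap_sub_pos hz t).ne'

/-- The growth of the weakly singular integrals on the unit circle. -/
theorem exists_integral_norm_circleMap_sub_rpow_le {β : ℝ} (hβ1 : β < 1) :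
    ∃ K : ℝ, 0 ≤ K ∧ ∀ z : ℂ, ‖z‖ < 1 →
      ∫ t in (0 : ℝ)..2 * Real.pi, ‖circleMap 0 1 t - z‖ ^ (β - 2) ≤ K * (1 - ‖z‖) ^ (β - 1) := by
  have hp := Real.pi_pos
  refine ⟨(2 * Real.pi)⁻¹ ^ (β - 2) * (2 / (1 - β)),
    mul_nonneg (by positivity) (div_nonneg two_pos.le (by linarith)), fun z hz => ?_⟩
  refine le_of_eq_of_le ?_ (integral_norm_exp_sub_rpow_le hβ1 (norm_nonneg z) hz)
  -- Periodicity allows a rotation by the argument of z, which reduces the integral to the real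
  -- point ‖z‖.
  have hper : Function.Periodic (fun t : ℝ => ‖circleMap 0 1 t - z‖ ^ (β - 2)) (2 * Real.pi) :=
    fun t => by simp only [periodic_circleMap 0 1 t]
  have h1 := hper.intervalIntegral_add_eq 0 (z.arg - Real.pi)
  rw [zero_add] at h1
  rw [h1]
  have h2 := intervalIntegral.integral_comp_add_right (a := -Real.pi) (b := Real.pi)
    (fun t : ℝ => ‖circleMap 0 1 t - z‖ ^ (β - 2)) z.arg
  rw [show z.arg - Real.pi + 2 * Real.pi = Real.pi + z.arg by ring,
    show z.arg - Real.pi = -Real.pi + z.arg by ring, ← h2]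
  apply intervalIntegral.integral_congr
  intro t _
  have h3 : circleMap 0 1 (t + z.arg) - z = exp (z.arg * I) * (exp (t * I) - ‖z‖) := by
    nth_rewrite 2 [← Complex.norm_mul_exp_arg_mul_I z]
    rw [circleMap]
    push_cast
    rw [add_mul, Complex.exp_add]; ring
  simp only [h3, norm_mul, Complex.norm_exp_ofReal_mul_I, one_mul]

/-! ### Cauchy integrals and Privalov's theorem. -/

/-- The Cauchy integral of a function on the unit circle. -/
noncomputable def cauchyTransform (d : ℂ → ℂ) (w : ℂ) : ℂ :=
  (2 * Real.pi * I : ℂ)⁻¹ • ∮ z in C(0, 1), (z - w)⁻¹ • d z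

theorem cauchyTransform_eq {d : ℂ → ℂ} (w : ℂ) :
    cauchyTransform d w = (2 * Real.pi : ℂ)⁻¹ *
      ∫ t in (0 : ℝ)..2 * Real.pi, circleMap 0 1 t * (circleMap 0 1 t - w)⁻¹ * d (circleMap 0 1 t) := by
  rw [cauchyTransform, circleIntegral, mul_inv, smul_eq_mul, mul_assoc,
    ← intervalIntegral.integral_const_mul]
  congr 1
  apply intervalIntegral.integral_congr
  intro t _
  simp only [deriv_circleMap, smul_eq_mul]
  field_simp

theorem differentiableOn_cauchyTransform {d : ℂ → ℂ} (hd : ContinuousOn d (sphere 0 1)) :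
    DifferentiableOn ℂ (cauchyTransform d) (ball 0 1) := by
  have h := hasFPowerSeriesOn_cauchy_integral (f := d) (c := 0) (R := 1)
    (hd.circleIntegrable zero_le_one) one_pos
  have := h.differentiableOn
  rwa [show eball (0 : ℂ) ((1 : ℝ≥0) : ENNReal) = ball 0 1 by
    rw [eball_coe]; rfl] at this

theorem continuous_circleMap_sub_inv {z : ℂ} (hz : ‖z‖ < 1) :
    Continuous fun t : ℝ => (circleMap 0 1 t - z)⁻¹ :=
  Continuous.inv₀ (by fun_prop) fun t => norm_pos_iff.1 (norm_circleMap_sub_pos hz t)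

theorem continuous_comp_circleMap {d : ℂ → ℂ} (hd : ContinuousOn d (sphere 0 1)) :
    Continuous fun t : ℝ => d (circleMap 0 1 t) :=
  hd.comp_continuous (continuous_circleMap 0 1) fun t => circleMap_mem_sphere 0 zero_le_one t

/-- This normalization of the Cauchy kernel allows the boundary value of `d` nearest to z to be
subtracted under the integral. -/
theorem integral_circleMap_mul_inv {z : ℂ} (hz : ‖z‖ < 1) :
    ∫ t in (0 : ℝ)..2 * Real.pi, circleMap 0 1 t * (circleMap 0 1 t - z)⁻¹ = 2 * Real.pi := by
  have h1 := circleIntegral.integral_sub_inv_of_mem_ball (c := 0) (R := 1) (w := z) (by simpa)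
  have h2 := cauchyTransform_eq (d := fun _ => 1) z
  rw [cauchyTransform] at h2
  simp only [smul_eq_mul, mul_one] at h2
  rw [h1] at h2
  have hp : (2 * Real.pi : ℂ) ≠ 0 := by
    exact_mod_cast Real.two_pi_pos.ne'
  rw [inv_mul_cancel₀ (mul_ne_zero hp I_ne_zero)] at h2
  field_simp at h2
  exact h2.symm

/-- The distance of points of the circle to the radial projection of `z`. -/
theorem norm_circleMap_sub_exp_arg_le {z : ℂ} (hz : ‖z‖ < 1) (t : ℝ) :
    dist (circleMap 0 1 t) (exp (z.arg * I)) ≤ 2 * ‖circleMap 0 1 t - z‖ := by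
  have h1 : 1 - ‖z‖ ≤ ‖circleMap 0 1 t - z‖ := by
    have := norm_sub_norm_le (circleMap 0 1 t) z
    simpa using this
  have h2 : ‖z - exp (z.arg * I)‖ = 1 - ‖z‖ := by
    nth_rewrite 1 [← Complex.norm_mul_exp_arg_mul_I z]
    rw [← sub_one_mul, norm_mul, Complex.norm_exp_ofReal_mul_I, mul_one]
    rw [← ofReal_one, ← ofReal_sub, Complex.norm_real, Real.norm_eq_abs, abs_sub_comm,
      abs_of_pos (by linarith)]
  rw [dist_eq_norm]
  have := norm_add_le (circleMap 0 1 t - z) (z - exp (z.arg * I))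
  rw [sub_add_sub_cancel] at this
  linarith

theorem exp_arg_mem_sphere (z : ℂ) : exp (z.arg * I) ∈ sphere (0 : ℂ) 1 := by simp

/-- The Cauchy integral of a constant is constant, so `d` may be replaced by d - d₀, with d₀ its
value at the radial projection of z. Then |d(ζ) - d₀| ≤ C(2|ζ-z|)^β weakens the singularity
|ζ-z|^(-2) of the differentiated kernel to |ζ-z|^(β-2). -/
theorem exists_norm_deriv_cauchyTransform_le {β : ℝ} (hβ : 0 < β) (hβ1 : β < 1) {d : ℂ → ℂ}
    (hd : IsHolder β (sphere 0 1) d) :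
    ∃ C, 0 ≤ C ∧ ∀ z ∈ ball (0 : ℂ) 1,
      ‖deriv (cauchyTransform d) z‖ ≤ C * (1 - ‖z‖) ^ (β - 1) := by
  have hdc := hd.continuousOn hβ
  obtain ⟨C, hC, hd⟩ := hd
  obtain ⟨K, hK, hKz⟩ := exists_integral_norm_circleMap_sub_rpow_le hβ1
  have hp := Real.pi_pos
  refine ⟨(2 * Real.pi)⁻¹ * (2 * C * 2 ^ β) * K, by positivity, fun z hz => ?_⟩
  have hz1 : ‖z‖ < 1 := by simpa using hz
  have hs : 0 < 1 - ‖z‖ := by linarith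
  refine norm_deriv_le_of_lip' (by positivity) ?_
  -- The derivative is bounded through difference quotients. The radius (1-‖z‖)/2 ensures |ζ-w| ≥
  -- |ζ-z|/2 on the circle, which is the source of the factor 2 beside C.
  filter_upwards [ball_mem_nhds z (half_pos hs)] with w hw
  have hwz : ‖w - z‖ < (1 - ‖z‖) / 2 := by simpa [dist_eq_norm] using hw
  have hw1 : ‖w‖ < 1 := by
    have := norm_add_le (w - z) z
    rw [sub_add_cancel] at this
    linarith
  set d₀ := d (exp (z.arg * I)) with hd₀
  have hdcc := continuous_comp_circleMap hdc
  have hsub : cauchyTransform d w - cauchyTransform d z = (2 * Real.pi : ℂ)⁻¹ *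
      ∫ t in (0 : ℝ)..2 * Real.pi, circleMap 0 1 t *
        ((circleMap 0 1 t - w)⁻¹ - (circleMap 0 1 t - z)⁻¹) * (d (circleMap 0 1 t) - d₀) := by
    have hcm := continuous_circleMap 0 1
    have hiw := continuous_circleMap_sub_inv hw1
    have hiz := continuous_circleMap_sub_inv hz1
    have c₁ := (hcm.mul hiw).mul hdcc
    have c₂ := (hcm.mul hiz).mul hdcc
    have e1 : ∀ t : ℝ, circleMap 0 1 t *
        ((circleMap 0 1 t - w)⁻¹ - (circleMap 0 1 t - z)⁻¹) * (d (circleMap 0 1 t) - d₀) =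
        (circleMap 0 1 t * (circleMap 0 1 t - w)⁻¹ * d (circleMap 0 1 t) -
          circleMap 0 1 t * (circleMap 0 1 t - z)⁻¹ * d (circleMap 0 1 t)) -
        (circleMap 0 1 t * (circleMap 0 1 t - w)⁻¹ - circleMap 0 1 t * (circleMap 0 1 t - z)⁻¹) * d₀ :=
      fun t => by ring
    simp_rw [e1]
    rw [intervalIntegral.integral_sub, intervalIntegral.integral_sub,
      intervalIntegral.integral_mul_const, intervalIntegral.integral_sub,
      integral_circleMap_mul_inv hw1, integral_circleMap_mul_inv hz1, cauchyTransform_eq,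
      cauchyTransform_eq]
    · ring
    all_goals
      apply Continuous.intervalIntegrable
      first
        | exact c₁
        | exact c₂
        | exact c₁.sub c₂
        | fun_prop
  rw [hsub, norm_mul, norm_inv]
  have hn : ‖(2 * Real.pi : ℂ)‖ = 2 * Real.pi := by
    rw [show (2 * Real.pi : ℂ) = ((2 * Real.pi : ℝ) : ℂ) by push_cast; rfl, Complex.norm_real,
      Real.norm_of_nonneg (by positivity)]
  rw [hn]
  have hcont := continuous_norm_circleMap_sub_rpow hz1 (β - 2)
  have hbound : ‖∫ t in (0 : ℝ)..2 * Real.pi, circleMap 0 1 t *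
        ((circleMap 0 1 t - w)⁻¹ - (circleMap 0 1 t - z)⁻¹) * (d (circleMap 0 1 t) - d₀)‖ ≤
      ∫ t in (0 : ℝ)..2 * Real.pi, (2 * C * 2 ^ β * ‖w - z‖) * ‖circleMap 0 1 t - z‖ ^ (β - 2) := by
    refine intervalIntegral.norm_integral_le_of_norm_le (by positivity)
      (Eventually.of_forall fun t _ => ?_) ((hcont.const_mul _).intervalIntegrable _ _)
    have hpz := norm_circleMap_sub_pos hz1 t
    have hpw := norm_circleMap_sub_pos hw1 t
    have h1 : 1 - ‖z‖ ≤ ‖circleMap 0 1 t - z‖ := by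
      have := norm_sub_norm_le (circleMap 0 1 t) z
      simpa using this
    have h2 : ‖circleMap 0 1 t - z‖ / 2 ≤ ‖circleMap 0 1 t - w‖ := by
      have := norm_add_le (circleMap 0 1 t - w) (w - z)
      rw [sub_add_sub_cancel] at this
      linarith
    rw [norm_mul, norm_mul, norm_circleMap_zero, abs_one, one_mul,
      inv_sub_inv (norm_pos_iff.1 hpw) (norm_pos_iff.1 hpz), norm_div, norm_mul]
    rw [show circleMap 0 1 t - z - (circleMap 0 1 t - w) = w - z by ring]
    have h3 : ‖d (circleMap 0 1 t) - d₀‖ ≤ C * (2 * ‖circleMap 0 1 t - z‖) ^ β := by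
      rw [← dist_eq_norm]
      refine (hd _ (circleMap_mem_sphere 0 zero_le_one t) _ (exp_arg_mem_sphere z)).trans ?_
      gcongr
      exact norm_circleMap_sub_exp_arg_le hz1 t
    rw [Real.mul_rpow two_pos.le hpz.le] at h3
    set a := ‖circleMap 0 1 t - z‖
    have h4 : a ^ (β - 2) = a ^ β / (a * a) := by
      rw [Real.rpow_sub hpz, Real.rpow_two, sq]
    calc ‖w - z‖ / (‖circleMap 0 1 t - w‖ * a) * ‖d (circleMap 0 1 t) - d₀‖
        ≤ ‖w - z‖ / (a / 2 * a) * (C * (2 ^ β * a ^ β)) := by gcongr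
      _ = (2 * C * 2 ^ β * ‖w - z‖) * a ^ (β - 2) := by rw [h4]; field_simp
  rw [intervalIntegral.integral_const_mul] at hbound
  calc _ ≤ (2 * Real.pi)⁻¹ * ((2 * C * 2 ^ β * ‖w - z‖) * (K * (1 - ‖z‖) ^ (β - 1))) := by
        gcongr
        refine hbound.trans ?_
        gcongr
        exact hKz z hz1
    _ = _ := by ring

/-- The analogue of the Poisson integral: boundary behaviour of the sum of a Cauchy integral and
the conjugate of a Cauchy integral. -/
theorem exists_norm_poisson_sub_le {β : ℝ} (hβ : 0 < β) (hβ1 : β < 1) {d : ℂ → ℂ}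
    (hd : IsHolder β (sphere 0 1) d) :
    ∃ C, 0 ≤ C ∧ ∀ z ∈ ball (0 : ℂ) 1,
      ‖cauchyTransform d z + conj (z * cauchyTransform (fun ζ => conj (d ζ) * conj ζ) z) -
        d (exp (z.arg * I))‖ ≤ C * (1 - ‖z‖) ^ β := by
  have hdc := hd.continuousOn hβ
  obtain ⟨C, hC, hd⟩ := hd
  obtain ⟨K, hK, hKz⟩ := exists_integral_norm_circleMap_sub_rpow_le hβ1
  have hp := Real.pi_pos
  refine ⟨(2 * Real.pi)⁻¹ * (2 * C * 2 ^ β) * K, by positivity, fun z hz => ?_⟩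
  have hz1 : ‖z‖ < 1 := by simpa using hz
  have hs : 0 < 1 - ‖z‖ := by linarith
  set d₀ := d (exp (z.arg * I)) with hd₀
  have hdcc := continuous_comp_circleMap hdc
  have hcm := continuous_circleMap 0 1
  have hiz := continuous_circleMap_sub_inv hz1
  have hcc : ∀ t : ℝ, circleMap 0 1 t * conj (circleMap 0 1 t) = 1 := fun t => by
    rw [Complex.mul_conj, Complex.normSq_eq_norm_sq]; simp
  have hcz : Continuous fun t : ℝ => (conj (circleMap 0 1 t - z))⁻¹ := by
    have := continuous_conj.comp hiz
    simpa [Function.comp_def, map_inv₀] using this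
  have hR : conj (z * cauchyTransform (fun ζ => conj (d ζ) * conj ζ) z) = (2 * Real.pi : ℂ)⁻¹ *
      ∫ t in (0 : ℝ)..2 * Real.pi, conj z * (conj (circleMap 0 1 t - z))⁻¹ * d (circleMap 0 1 t) := by
    rw [cauchyTransform_eq, map_mul, map_mul, ← intervalIntegral.intervalIntegral_conj, ← mul_assoc,
      mul_comm (conj z), mul_assoc, ← intervalIntegral.integral_const_mul]
    have : conj ((2 * Real.pi : ℂ)⁻¹) = (2 * Real.pi : ℂ)⁻¹ := by
      rw [map_inv₀, map_mul, Complex.conj_ofReal, Complex.conj_ofNat]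
    rw [this]
    congr 1
    apply intervalIntegral.integral_congr
    intro t _
    simp only [map_mul, map_inv₀, Complex.conj_conj]
    linear_combination (conj z * (conj (circleMap 0 1 t - z))⁻¹ * d (circleMap 0 1 t)) * hcc t
  -- The conjugated kernel has mean zero and the Cauchy kernel has mean one, so d₀ can be subtracted
  -- from the sum.
  have hzero : ∫ t in (0 : ℝ)..2 * Real.pi, conj z * (conj (circleMap 0 1 t - z))⁻¹ = 0 := by
    have h1 : ∫ t in (0 : ℝ)..2 * Real.pi, z * (circleMap 0 1 t - z)⁻¹ = 0 := by
      have e1 : ∀ t : ℝ, z * (circleMap 0 1 t - z)⁻¹ =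
          circleMap 0 1 t * (circleMap 0 1 t - z)⁻¹ - 1 := fun t => by
        have := norm_pos_iff.1 (norm_circleMap_sub_pos hz1 t)
        field_simp
        ring
      simp_rw [e1]
      rw [intervalIntegral.integral_sub, integral_circleMap_mul_inv hz1,
        intervalIntegral.integral_const]
      · simp
      · apply Continuous.intervalIntegrable; fun_prop
      · apply Continuous.intervalIntegrable; fun_prop
    have h2 := congrArg conj h1
    rw [← intervalIntegral.intervalIntegral_conj] at h2
    simpa only [map_mul, map_inv₀, map_zero] using h2
  have hsum : cauchyTransform d z + conj (z * cauchyTransform (fun ζ => conj (d ζ) * conj ζ) z) -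
      d₀ = (2 * Real.pi : ℂ)⁻¹ * ∫ t in (0 : ℝ)..2 * Real.pi,
        (circleMap 0 1 t * (circleMap 0 1 t - z)⁻¹ + conj z * (conj (circleMap 0 1 t - z))⁻¹) *
          (d (circleMap 0 1 t) - d₀) := by
    have e1 : ∀ t : ℝ,
        (circleMap 0 1 t * (circleMap 0 1 t - z)⁻¹ + conj z * (conj (circleMap 0 1 t - z))⁻¹) *
          (d (circleMap 0 1 t) - d₀) =
        (circleMap 0 1 t * (circleMap 0 1 t - z)⁻¹ * d (circleMap 0 1 t) +
          conj z * (conj (circleMap 0 1 t - z))⁻¹ * d (circleMap 0 1 t)) -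
        (circleMap 0 1 t * (circleMap 0 1 t - z)⁻¹ + conj z * (conj (circleMap 0 1 t - z))⁻¹) * d₀ :=
      fun t => by ring
    simp_rw [e1]
    have c₁ := (hcm.mul hiz).mul hdcc
    have c₂ := (hcz.const_mul (conj z)).mul hdcc
    have hpi : (Real.pi : ℂ) ≠ 0 := by exact_mod_cast hp.ne'
    rw [intervalIntegral.integral_sub, intervalIntegral.integral_add,
      intervalIntegral.integral_mul_const, intervalIntegral.integral_add,
      integral_circleMap_mul_inv hz1, hzero, cauchyTransform_eq, hR]
    · field_simp
      ring
    all_goals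
      apply Continuous.intervalIntegrable
      first
        | exact c₁
        | exact c₂
        | exact c₁.add c₂
        | fun_prop
  rw [hsum, norm_mul, norm_inv]
  have hn : ‖(2 * Real.pi : ℂ)‖ = 2 * Real.pi := by
    rw [show (2 * Real.pi : ℂ) = ((2 * Real.pi : ℝ) : ℂ) by push_cast; rfl, Complex.norm_real,
      Real.norm_of_nonneg (by positivity)]
  rw [hn]
  have hcont := continuous_norm_circleMap_sub_rpow hz1 (β - 2)
  have hbound : ‖∫ t in (0 : ℝ)..2 * Real.pi,
        (circleMap 0 1 t * (circleMap 0 1 t - z)⁻¹ + conj z * (conj (circleMap 0 1 t - z))⁻¹) *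
          (d (circleMap 0 1 t) - d₀)‖ ≤
      ∫ t in (0 : ℝ)..2 * Real.pi,
        (2 * C * 2 ^ β * (1 - ‖z‖)) * ‖circleMap 0 1 t - z‖ ^ (β - 2) := by
    refine intervalIntegral.norm_integral_le_of_norm_le (by positivity)
      (Eventually.of_forall fun t _ => ?_) ((hcont.const_mul _).intervalIntegrable _ _)
    have hpz := norm_circleMap_sub_pos hz1 t
    have h3 : ‖d (circleMap 0 1 t) - d₀‖ ≤ C * (2 * ‖circleMap 0 1 t - z‖) ^ β := by
      rw [← dist_eq_norm]
      refine (hd _ (circleMap_mem_sphere 0 zero_le_one t) _ (exp_arg_mem_sphere z)).trans ?_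
      gcongr
      exact norm_circleMap_sub_exp_arg_le hz1 t
    rw [Real.mul_rpow two_pos.le hpz.le] at h3
    have hne : circleMap 0 1 t - z ≠ 0 := norm_pos_iff.1 hpz
    have hne' : conj (circleMap 0 1 t - z) ≠ 0 := (map_ne_zero _).2 hne
    -- The two kernels add up to the Poisson kernel (1-|z|²)/|ζ-z|²; its numerator, at most
    -- 2(1-|z|), raises the bound (1-|z|)^(β-1) to (1-|z|)^β.
    have hker : circleMap 0 1 t * (circleMap 0 1 t - z)⁻¹ + conj z * (conj (circleMap 0 1 t - z))⁻¹ =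
        ((1 - ‖z‖ ^ 2 : ℝ) : ℂ) / ((circleMap 0 1 t - z) * conj (circleMap 0 1 t - z)) := by
      have h5 : ((1 - ‖z‖ ^ 2 : ℝ) : ℂ) = 1 - z * conj z := by
        rw [Complex.mul_conj, Complex.normSq_eq_norm_sq]; push_cast; ring
      rw [h5]
      field_simp
      rw [map_sub]
      linear_combination hcc t
    rw [norm_mul, hker, norm_div, norm_mul, Complex.norm_conj, Complex.norm_real,
      Real.norm_of_nonneg (by nlinarith [norm_nonneg z])]
    set a := ‖circleMap 0 1 t - z‖
    have h4 : a ^ (β - 2) = a ^ β / (a * a) := by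
      rw [Real.rpow_sub hpz, Real.rpow_two, sq]
    calc (1 - ‖z‖ ^ 2) / (a * a) * ‖d (circleMap 0 1 t) - d₀‖
        ≤ (2 * (1 - ‖z‖)) / (a * a) * (C * (2 ^ β * a ^ β)) := by
          gcongr
          nlinarith [norm_nonneg z]
      _ = (2 * C * 2 ^ β * (1 - ‖z‖)) * a ^ (β - 2) := by rw [h4]; field_simp
  rw [intervalIntegral.integral_const_mul] at hbound
  have hpow : (1 - ‖z‖) * (1 - ‖z‖) ^ (β - 1) = (1 - ‖z‖) ^ β := by
    rw [Real.rpow_sub_one hs.ne']; field_simp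
  calc _ ≤ (2 * Real.pi)⁻¹ * ((2 * C * 2 ^ β * (1 - ‖z‖)) * (K * (1 - ‖z‖) ^ (β - 1))) := by
        gcongr
        refine hbound.trans ?_
        gcongr
        exact hKz z hz1
    _ = (2 * Real.pi)⁻¹ * (2 * C * 2 ^ β) * K * ((1 - ‖z‖) * (1 - ‖z‖) ^ (β - 1)) := by ring
    _ = _ := by rw [hpow]

/-- Privalov's theorem: a Hölder function on the unit circle is the sum of the boundary values of a
Hölder function holomorphic in the disc and the conjugate of another one, vanishing at `0`. -/
theorem exists_holderDisc_add_conj {β : ℝ} (hβ : 0 < β) (hβ1 : β < 1) {d : ℂ → ℂ}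
    (hd : IsHolder β (sphere 0 1) d) :
    ∃ P R, HolderDisc β P ∧ HolderDisc β R ∧
      ∀ ξ ∈ sphere (0 : ℂ) 1, d ξ = P ξ + conj (ξ * R ξ) := by
  have hid : IsHolder β (sphere (0 : ℂ) 1) (fun ζ => ζ) :=
    IsHolder.of_lipschitzOnWith (K := 1) isBounded_sphere hβ hβ1.le LipschitzWith.id.lipschitzOnWith
  have hd2 : IsHolder β (sphere 0 1) (fun ζ => conj (d ζ) * conj ζ) :=
    hd.conjugate.mul hβ.le isBounded_sphere hid.conjugate
  have ext : ∀ e : ℂ → ℂ, IsHolder β (sphere 0 1) e →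
      ∃ G, HolderDisc β G ∧ EqOn G (cauchyTransform e) (ball 0 1) := fun e he => by
    obtain ⟨C, hC, h⟩ := exists_norm_deriv_cauchyTransform_le hβ hβ1 he
    exact exists_holderDisc_of_norm_deriv_le hβ hβ1.le hC
      (differentiableOn_cauchyTransform (he.continuousOn hβ)) h
  obtain ⟨P, hP, hPe⟩ := ext _ hd
  obtain ⟨R, hR, hRe⟩ := ext _ hd2
  obtain ⟨C, hC, hlim⟩ := exists_norm_poisson_sub_le hβ hβ1 hd
  refine ⟨P, R, hP, hR, fun ξ hξ => ?_⟩
  have hξ1 : ‖ξ‖ = 1 := by simpa using hξ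
  -- Both sides are compared along the radius rξ with r → 1⁻: the extensions P and R are continuous
  -- up to ξ, and rξ has radial projection ξ, so the Poisson estimate forces the difference to 0.
  have hmaps : Tendsto (fun r : ℝ => (r : ℂ) * ξ) (𝓝[Ioo 0 1] 1) (𝓝[closedBall 0 1] ξ) := by
    apply tendsto_nhdsWithin_of_tendsto_nhds_of_eventually_within
    · have : Continuous fun r : ℝ => (r : ℂ) * ξ := by fun_prop
      have := this.tendsto 1
      rw [ofReal_one, one_mul] at this
      exact this.mono_left nhdsWithin_le_nhds
    · filter_upwards [self_mem_nhdsWithin] with r hr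
      rw [mem_closedBall_zero_iff, norm_mul, hξ1, mul_one, Complex.norm_real,
        Real.norm_of_nonneg hr.1.le]
      exact hr.2.le
  have hξc : ξ ∈ closedBall (0 : ℂ) 1 := sphere_subset_closedBall hξ
  have hPt := ((hP.isHolder.continuousOn hβ) ξ hξc).tendsto.comp hmaps
  have hRt := ((hR.isHolder.continuousOn hβ) ξ hξc).tendsto.comp hmaps
  have hidt : Tendsto (fun r : ℝ => (r : ℂ) * ξ) (𝓝[Ioo 0 1] 1) (𝓝 ξ) :=
    hmaps.mono_right nhdsWithin_le_nhds
  have h1 : Tendsto (fun r : ℝ => P (r * ξ) + conj ((r * ξ) * R (r * ξ)) - d ξ) (𝓝[Ioo 0 1] 1)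
      (𝓝 (P ξ + conj (ξ * R ξ) - d ξ)) :=
    (hPt.add ((continuous_conj.tendsto _).comp (hidt.mul hRt))).sub_const _
  have h2 : Tendsto (fun r : ℝ => P (r * ξ) + conj ((r * ξ) * R (r * ξ)) - d ξ) (𝓝[Ioo 0 1] 1)
      (𝓝 0) := by
    have h3 : Tendsto (fun r : ℝ => C * (1 - r) ^ β) (𝓝[Ioo 0 1] 1) (𝓝 0) := by
      have : Continuous fun r : ℝ => C * (1 - r) ^ β :=
        continuous_const.mul (Continuous.rpow_const (by fun_prop) fun _ => Or.inr hβ.le)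
      have := this.tendsto 1
      rw [sub_self, Real.zero_rpow hβ.ne', mul_zero] at this
      exact this.mono_left nhdsWithin_le_nhds
    refine squeeze_zero_norm' ?_ h3
    filter_upwards [self_mem_nhdsWithin] with r hr
    have hn : ‖(r : ℂ) * ξ‖ = r := by
      rw [norm_mul, hξ1, mul_one, Complex.norm_real, Real.norm_of_nonneg hr.1.le]
    have hb : (r : ℂ) * ξ ∈ ball (0 : ℂ) 1 := by rw [mem_ball_zero_iff, hn]; exact hr.2
    have harg : exp ((((r : ℂ) * ξ).arg : ℂ) * I) = ξ := by
      have h5 := Complex.norm_mul_exp_arg_mul_I ((r : ℂ) * ξ)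
      rw [hn] at h5
      exact mul_left_cancel₀ (by exact_mod_cast hr.1.ne') h5
    have h4 := hlim _ hb
    rw [harg, hn] at h4
    rwa [hPe hb, hRe hb]
  have : (𝓝[Ioo (0 : ℝ) 1] 1).NeBot := by
    rw [← mem_closure_iff_nhdsWithin_neBot, closure_Ioo zero_ne_one]
    exact right_mem_Icc.2 zero_le_one
  have := tendsto_nhds_unique h1 h2
  exact (sub_eq_zero.1 this).symm

/-! ### Closure properties of Hölder holomorphic functions. -/

namespace HolderDisc

variable {β : ℝ} {F G : ℂ → ℂ}

theorem const (c : ℂ) : HolderDisc β (fun _ => c) :=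
  ⟨differentiableOn_const c, IsHolder.const c⟩

theorem add (hF : HolderDisc β F) (hG : HolderDisc β G) : HolderDisc β (fun z => F z + G z) :=
  ⟨hF.1.add hG.1, hF.2.add hG.2⟩

theorem mul (hβ : 0 ≤ β) (hF : HolderDisc β F) (hG : HolderDisc β G) :
    HolderDisc β (fun z => F z * G z) :=
  ⟨hF.1.mul hG.1, hF.2.mul hβ isBounded_closedBall hG.2⟩

theorem exp_comp (hβ : 0 ≤ β) (hF : HolderDisc β F) : HolderDisc β (fun z => exp (F z)) :=
  ⟨hF.1.cexp, hF.2.exp_comp hβ isBounded_closedBall⟩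

theorem id (hβ : 0 < β) (hβ1 : β ≤ 1) : HolderDisc β (fun z => z) :=
  ⟨differentiableOn_id, IsHolder.of_lipschitzOnWith (K := 1) isBounded_closedBall hβ hβ1
    LipschitzWith.id.lipschitzOnWith⟩

theorem pow (hβ : 0 ≤ β) (hF : HolderDisc β F) (n : ℕ) : HolderDisc β (fun z => F z ^ n) := by
  induction n with
  | zero => simpa using const 1
  | succ n ih => simpa only [pow_succ] using ih.mul hβ hF

theorem sum {ι : Type*} (s : Finset ι) {f : ι → ℂ → ℂ} (h : ∀ i ∈ s, HolderDisc β (f i)) :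
    HolderDisc β (fun z => ∑ i ∈ s, f i z) := by
  classical
  induction s using Finset.induction_on with
  | empty => simpa using const 0
  | insert a s ha ih =>
    simp only [Finset.sum_insert ha]
    exact (h a (Finset.mem_insert_self a s)).add
      (ih fun i hi => h i (Finset.mem_insert_of_mem hi))

theorem continuousOn (hβ : 0 < β) (hF : HolderDisc β F) : ContinuousOn F (closedBall 0 1) :=
  hF.isHolder.continuousOn hβ

end HolderDisc

/-! ### The model homogeneous problem ξμ + ξ^n conj μ = 0. -/

/-- The coefficients of `selfReciprocal`. -/
noncomputable def selfReciprocalCoeff {n : ℕ} (t : Fin n → ℝ) (k : Fin n) : ℂ :=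
  -- An antisymmetric real part and a symmetric imaginary part encode conj a_k = -a_{n-1-k}. The
  -- single real vector `t` covers both parities of n: the middle coefficient for odd n is
  -- automatically imaginary.
  ((t k - t k.rev : ℝ) : ℂ) + ((t k + t k.rev : ℝ) : ℂ) * I

/-- The polynomials `p` of degree less than `n` with `z ^ (n - 1) * conj (p (1 / conj z)) = -p z`,
with `n` real parameters. -/
noncomputable def selfReciprocal {n : ℕ} (t : Fin n → ℝ) (z : ℂ) : ℂ :=
  ∑ k, selfReciprocalCoeff t k * z ^ (k : ℕ)

theorem conj_selfReciprocalCoeff {n : ℕ} (t : Fin n → ℝ) (k : Fin n) :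
    conj (selfReciprocalCoeff t k) = -selfReciprocalCoeff t k.rev := by
  simp only [selfReciprocalCoeff, map_add, map_mul, conj_ofReal, conj_I, Fin.rev_rev]
  push_cast
  ring

/-- On the circle ξ^n conj(ξ^k) = ξ^{(n-1-k)+1}, so reversing the summation index makes the second
sum the negative of the first. -/
theorem mul_selfReciprocal_add {n : ℕ} (t : Fin n → ℝ) {ξ : ℂ} (hξ : ξ ∈ sphere (0 : ℂ) 1) :
    ξ * selfReciprocal t ξ + ξ ^ n * conj (selfReciprocal t ξ) = 0 := by
  have hξ1 : ‖ξ‖ = 1 := by simpa using hξ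
  have hcc : ξ * conj ξ = 1 := by
    rw [Complex.mul_conj, Complex.normSq_eq_norm_sq, hξ1]; simp
  have h1 : ξ ^ n * conj (selfReciprocal t ξ) =
      ∑ k : Fin n, -(selfReciprocalCoeff t k.rev * ξ ^ ((k.rev : ℕ) + 1)) := by
    rw [selfReciprocal, map_sum, Finset.mul_sum]
    refine Finset.sum_congr rfl fun k _ => ?_
    rw [map_mul, map_pow, conj_selfReciprocalCoeff]
    have h2 : n = ((k.rev : ℕ) + 1) + k := by rw [Fin.val_rev]; omega
    have h3 : ξ ^ n = ξ ^ ((k.rev : ℕ) + 1) * ξ ^ (k : ℕ) := by rw [← pow_add, ← h2]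
    have h4 : ξ ^ (k : ℕ) * conj ξ ^ (k : ℕ) = 1 := by rw [← mul_pow, hcc, one_pow]
    rw [h3]
    linear_combination (-selfReciprocalCoeff t k.rev * ξ ^ ((k.rev : ℕ) + 1)) * h4
  have h5 : ∑ k : Fin n, -(selfReciprocalCoeff t k.rev * ξ ^ ((k.rev : ℕ) + 1)) =
      ∑ k : Fin n, -(selfReciprocalCoeff t k * ξ ^ ((k : ℕ) + 1)) :=
    Equiv.sum_comp Fin.revPerm fun k : Fin n => -(selfReciprocalCoeff t k * ξ ^ ((k : ℕ) + 1))
  rw [h1, h5, selfReciprocal, Finset.mul_sum, ← Finset.sum_add_distrib]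
  exact Finset.sum_eq_zero fun k _ => by ring

/-- A polynomial vanishing on the disc has zero coefficients, and t_k is half the sum of the real
and imaginary parts of a_k. -/
theorem selfReciprocal_injective {n : ℕ} {t : Fin n → ℝ}
    (h : ∀ z ∈ ball (0 : ℂ) 1, selfReciprocal t z = 0) : t = 0 := by
  set p : Polynomial ℂ := ∑ k : Fin n, Polynomial.monomial (k : ℕ) (selfReciprocalCoeff t k) with hp
  have hev : ∀ z, p.eval z = selfReciprocal t z := fun z => by
    simp [hp, Polynomial.eval_finsetSum, selfReciprocal]
  have hp0 : p = 0 := by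
    apply Polynomial.eq_zero_of_infinite_isRoot
    refine Set.Infinite.mono (s := ball (0 : ℂ) 1) (fun z hz => ?_) ?_
    · simp [Polynomial.IsRoot, hev, h z hz]
    · exact infinite_of_mem_nhds 0 (ball_mem_nhds 0 one_pos)
  funext k
  have hc : p.coeff k = selfReciprocalCoeff t k := by
    rw [hp, Polynomial.finsetSum_coeff, Finset.sum_eq_single k]
    · simp
    · intro j _ hj
      rw [Polynomial.coeff_monomial, if_neg]
      exact fun h => hj (Fin.ext h)
    · simp
  rw [hp0, Polynomial.coeff_zero] at hc
  have hre := congrArg re hc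
  have him := congrArg im hc
  simp [selfReciprocalCoeff] at hre him
  simp only [Pi.zero_apply]
  linarith

/-- Solutions of the model homogeneous Riemann–Hilbert problem. -/
theorem exists_eq_selfReciprocal {n : ℕ} {μ : ℂ → ℂ} (hμd : DifferentiableOn ℂ μ (ball 0 1))
    (hμc : ContinuousOn μ (closedBall 0 1))
    (h : ∀ ξ ∈ sphere (0 : ℂ) 1, ξ * μ ξ + ξ ^ n * conj (μ ξ) = 0) :
    ∃ t : Fin n → ℝ, ∀ z ∈ closedBall (0 : ℂ) 1, μ z = selfReciprocal t z := by
  have hdc : DiffContOnCl ℂ μ (ball 0 1) := by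
    refine ⟨hμd, ?_⟩
    rwa [closure_ball _ one_ne_zero]
  have hmem : ∀ t : ℝ, circleMap 0 1 t ∈ sphere (0 : ℂ) 1 := circleMap_mem_sphere 0 zero_le_one
  have hcc : ∀ t : ℝ, circleMap 0 1 t * conj (circleMap 0 1 t) = 1 := fun t => by
    rw [Complex.mul_conj, Complex.normSq_eq_norm_sq]; simp
  -- These Fourier coefficients are also the Taylor coefficients of μ (`hseries`); the boundary
  -- relation is read off from the former, the conclusion from the latter.
  set a : ℕ → ℂ := fun k => (2 * Real.pi : ℂ)⁻¹ *
    ∫ t in (0 : ℝ)..2 * Real.pi, μ (circleMap 0 1 t) * conj (circleMap 0 1 t) ^ k with ha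
  -- Fourier coefficients of negative index vanish by Cauchy's theorem.
  have hneg : ∀ k : ℕ,
      ∫ t in (0 : ℝ)..2 * Real.pi, μ (circleMap 0 1 t) * circleMap 0 1 t ^ (k + 1) = 0 := by
    intro k
    have h1 : DiffContOnCl ℂ (fun z => z ^ k * μ z) (ball 0 1) :=
      ⟨(differentiableOn_id.pow k).mul hμd, by
        rw [closure_ball _ one_ne_zero]; exact (continuousOn_id.pow k).mul hμc⟩
    have h2 := h1.circleIntegral_eq_zero zero_le_one
    rw [circleIntegral] at h2
    have h3 : ∀ t : ℝ, deriv (circleMap 0 1) t • (circleMap 0 1 t ^ k * μ (circleMap 0 1 t)) =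
        I * (μ (circleMap 0 1 t) * circleMap 0 1 t ^ (k + 1)) := fun t => by
      rw [deriv_circleMap, smul_eq_mul]; ring
    simp_rw [h3] at h2
    rw [intervalIntegral.integral_const_mul] at h2
    exact (mul_eq_zero.1 h2).resolve_left I_ne_zero
  have hconst : conj ((2 * Real.pi : ℂ)⁻¹) = (2 * Real.pi : ℂ)⁻¹ := by
    rw [map_inv₀, map_mul, Complex.conj_ofReal, Complex.conj_ofNat]
  have hrel : ∀ t : ℝ, μ (circleMap 0 1 t) =
      -(circleMap 0 1 t ^ n * conj (circleMap 0 1 t) * conj (μ (circleMap 0 1 t))) := fun t => by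
    linear_combination (conj (circleMap 0 1 t)) * h _ (hmem t) - (μ (circleMap 0 1 t)) * hcc t
  -- The relation μ = -ξ^{n-1} conj μ pairs the index k with n-1-k. For k ≥ n the partner is
  -- negative, whence `hhigh`.
  have hlow : ∀ k j : ℕ, k + j + 1 = n → a k = -conj (a j) := by
    intro k j hkj
    have h1 : ∀ t : ℝ, μ (circleMap 0 1 t) * conj (circleMap 0 1 t) ^ k =
        -conj (μ (circleMap 0 1 t) * conj (circleMap 0 1 t) ^ j) := fun t => by
      have h2 : circleMap 0 1 t ^ n * conj (circleMap 0 1 t) ^ (k + 1) = circleMap 0 1 t ^ j := by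
        rw [← hkj, show k + j + 1 = j + (k + 1) by ring, pow_add, mul_assoc, ← mul_pow, hcc,
          one_pow, mul_one]
      simp only [map_mul, map_pow, Complex.conj_conj]
      linear_combination conj (circleMap 0 1 t) ^ k * hrel t - conj (μ (circleMap 0 1 t)) * h2
    simp only [ha, map_mul, hconst, ← intervalIntegral.intervalIntegral_conj]
    rw [← mul_neg, ← intervalIntegral.integral_neg]
    congr 1
    apply intervalIntegral.integral_congr
    intro t _
    simp only [h1, map_mul]
  have hhigh : ∀ k : ℕ, n ≤ k → a k = 0 := by
    intro k hk
    obtain ⟨j, rfl⟩ := Nat.exists_eq_add_of_le hk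
    have h1 : ∀ t : ℝ, μ (circleMap 0 1 t) * conj (circleMap 0 1 t) ^ (n + j) =
        -conj (μ (circleMap 0 1 t) * circleMap 0 1 t ^ (j + 1)) := fun t => by
      have h2 : circleMap 0 1 t ^ n * conj (circleMap 0 1 t) ^ n = 1 := by
        rw [← mul_pow, hcc, one_pow]
      simp only [map_mul, map_pow]
      linear_combination conj (circleMap 0 1 t) ^ (n + j) * hrel t -
        conj (μ (circleMap 0 1 t)) * conj (circleMap 0 1 t) ^ (j + 1) * h2
    have h3 := congrArg conj (hneg j)
    rw [← intervalIntegral.intervalIntegral_conj, map_zero] at h3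
    simp only [ha]
    simp_rw [h1]
    rw [intervalIntegral.integral_neg, h3, neg_zero, mul_zero]
  have hseries : ∀ z ∈ ball (0 : ℂ) 1, HasSum (fun k => a k * z ^ k) (μ z) := by
    intro z hz
    have h1 := hdc.hasFPowerSeriesOnBall (R := 1) one_pos
    have h2 := h1.hasSum (y := z) (by
      rw [eball_coe]; exact hz)
    rw [zero_add] at h2
    have h3 : ∀ k, cauchyPowerSeries μ 0 ((1 : ℝ≥0) : ℝ) k (fun _ => z) = a k * z ^ k := by
      intro k
      have h4 : ∀ t : ℝ, deriv (circleMap 0 1) t • (z / (circleMap 0 1 t - 0)) ^ k •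
          (circleMap 0 1 t - 0)⁻¹ • μ (circleMap 0 1 t) =
          I * z ^ k * (μ (circleMap 0 1 t) * conj (circleMap 0 1 t) ^ k) := fun t => by
        have hne : circleMap 0 1 t ≠ 0 := by
          intro h0
          have := hcc t
          rw [h0, zero_mul] at this
          exact zero_ne_one this
        have hinv : conj (circleMap 0 1 t) = (circleMap 0 1 t)⁻¹ :=
          eq_inv_of_mul_eq_one_right (hcc t)
        simp only [deriv_circleMap, smul_eq_mul, sub_zero, hinv, div_eq_mul_inv, mul_pow]
        field_simp
      rw [cauchyPowerSeries_apply, circleIntegral, NNReal.coe_one]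
      simp_rw [h4]
      rw [intervalIntegral.integral_const_mul, mul_inv, smul_eq_mul]
      simp only [ha]
      field_simp
    simpa only [h3] using h2
  refine ⟨fun k => ((a k).re + (a k).im) / 2, ?_⟩
  have hcoef : ∀ k : Fin n,
      selfReciprocalCoeff (fun k : Fin n => ((a k).re + (a k).im) / 2) k = a k := by
    intro k
    have h1 := hlow k.rev k (by rw [Fin.val_rev]; omega)
    have hre := congrArg re h1
    have him := congrArg im h1
    simp only [neg_re, neg_im, conj_re, conj_im, neg_neg] at hre him
    apply Complex.ext
    · simp only [selfReciprocalCoeff, add_re, mul_re, ofReal_re, ofReal_im, I_re, I_im, hre, him]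
      ring
    · simp only [selfReciprocalCoeff, add_im, mul_im, ofReal_re, ofReal_im, I_re, I_im, hre, him]
      ring
  refine eqOn_closedBall_of_eqOn_ball hμc ?_ fun z hz => ?_
  · unfold selfReciprocal
    fun_prop
  · refine (hseries z hz).unique ?_
    have h1 : HasSum (fun k => a k * z ^ k) (∑ k ∈ Finset.range n, a k * z ^ k) :=
      hasSum_sum_of_ne_finset_zero fun k hk => by
        rw [hhigh k (by simpa using hk), zero_mul]
    rw [← Fin.sum_univ_eq_sum_range (fun k => a k * z ^ k)] at h1
    convert h1 using 1
    exact Finset.sum_congr rfl fun k _ => by rw [hcoef]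

/-! ### The Riemann–Hilbert problem on the circle. -/

/-- The function on the unit circle with pull-back `Φ` on `[0, 2π)`. -/
noncomputable def circleLift {E : Type*} (Φ : ℝ → E) (ξ : ℂ) : E :=
  Φ (toIcoMod Real.two_pi_pos 0 ξ.arg)

theorem circleLift_exp {E : Type*} {Φ : ℝ → E} (h : Φ 0 = Φ (2 * Real.pi)) {θ : ℝ}
    (hθ : θ ∈ Icc 0 (2 * Real.pi)) : circleLift Φ (exp (θ * I)) = Φ θ := by
  have key : ∀ θ ∈ Ico 0 (2 * Real.pi), circleLift Φ (exp (θ * I)) = Φ θ := fun θ hθ => by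
    rw [circleLift, Complex.arg_exp_mul_I, toIcoMod_toIocMod]
    rw [(toIcoMod_eq_self Real.two_pi_pos).2 (by simpa using hθ)]
  rcases eq_or_lt_of_le hθ.2 with h1 | h1
  · have h2 : exp (θ * I) = exp ((0 : ℝ) * I) := by
      rw [h1]; push_cast; rw [Complex.exp_two_pi_mul_I]; simp
    rw [h2, key 0 ⟨le_rfl, Real.two_pi_pos⟩, h, h1]
  · exact key θ ⟨hθ.1, h1⟩

theorem isHolder_circleLift {E : Type*} [PseudoMetricSpace E] {β : ℝ} (hβ : 0 ≤ β) {Φ : ℝ → E}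
    (h : Φ 0 = Φ (2 * Real.pi)) (hΦ : IsHolder β (Icc 0 (2 * Real.pi)) Φ) :
    IsHolder β (sphere 0 1) (circleLift Φ) :=
  IsHolder.sphere_of_exp hβ (hΦ.congr fun _ hθ => circleLift_exp h hθ)

theorem isHolder_linear {β : ℝ} (hβ : 0 < β) (hβ1 : β ≤ 1) (c : ℝ) (a b : ℝ) :
    IsHolder β (Icc a b) (fun θ : ℝ => c * θ) := by
  refine IsHolder.of_lipschitzOnWith (K := ‖c‖₊) (isBounded_Icc a b) hβ hβ1
    (LipschitzWith.lipschitzOnWith ?_)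
  refine LipschitzWith.of_dist_le_mul fun x y => ?_
  rw [dist_eq_norm, dist_eq_norm, ← mul_sub, norm_mul, coe_nnnorm]

/-- The Riemann–Hilbert problem `Re (e^{-iφ} κ) = c` on the unit circle, for an argument `φ` whose
total change is `(n - 1) π`. -/
theorem exists_riemannHilbert {β : ℝ} (hβ : 0 < β) (hβ1 : β < 1) {φ : ℝ → ℝ} {n : ℕ}
    (hφ : IsHolder β (Icc 0 (2 * Real.pi)) φ)
    (hn : φ (2 * Real.pi) - φ 0 = Real.pi * ((n : ℝ) - 1)) :
    ∃ h : ℂ → ℂ, HolderDisc β h ∧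
      (∀ c : ℝ → ℝ, IsHolder β (Icc 0 (2 * Real.pi)) c → c 0 = 0 → c (2 * Real.pi) = 0 →
        ∃ κ, HolderDisc β κ ∧
          ∀ θ ∈ Icc 0 (2 * Real.pi), (exp (-(φ θ * I)) * κ (exp (θ * I))).re = c θ) ∧
      ∀ κ, HolderDisc β κ →
        ((∀ θ ∈ Icc 0 (2 * Real.pi), (exp (-(φ θ * I)) * κ (exp (θ * I))).re = 0) ↔
          ∃ t : Fin n → ℝ, ∀ z ∈ closedBall (0 : ℂ) 1, κ z = exp (h z * I) * selfReciprocal t z) := by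
  have hsph : ∀ θ : ℝ, exp (θ * I) ∈ sphere (0 : ℂ) 1 := fun θ => by simp
  -- The slope for which φ(θ) - mθ takes equal values at 0 and 2π. It is a half-integer when n is
  -- even, so e^{imθ} need not be a function on the circle.
  set m : ℝ := ((n : ℝ) - 1) / 2 with hm
  set ψ : ℝ → ℝ := fun θ => φ θ + (-m) * θ with hψ
  have hψ0 : ψ 0 = ψ (2 * Real.pi) := by
    simp only [hψ, hm]; linarith
  have hψH : IsHolder β (Icc 0 (2 * Real.pi)) ψ := hφ.add (isHolder_linear hβ hβ1.le _ _ _)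
  obtain ⟨P₀, R₀, hP₀, hR₀, hPR₀⟩ := exists_holderDisc_add_conj hβ hβ1
    (isHolder_circleLift hβ.le hψ0 hψH).ofReal
  obtain ⟨h, hH, hre⟩ : ∃ h, HolderDisc β h ∧
      ∀ θ ∈ Icc 0 (2 * Real.pi), (h (exp (θ * I))).re = φ θ - m * θ := by
    -- Replacing conj(ξR₀) by ξR₀ makes the sum holomorphic and leaves its real part unchanged.
    refine ⟨fun z => P₀ z + z * R₀ z, hP₀.add ((HolderDisc.id hβ hβ1.le).mul hβ.le hR₀),
      fun θ hθ => ?_⟩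
    have h1 := congrArg re (hPR₀ _ (hsph θ))
    rw [circleLift_exp hψ0 hθ, ofReal_re, add_re, conj_re] at h1
    rw [add_re, ← h1, hψ]; ring
  -- Multiplication by e^{ih} replaces the phase φ(θ) by mθ at the price of the positive factor
  -- e^{-Im h}.
  have hkey : ∀ μ : ℂ, ∀ θ ∈ Icc 0 (2 * Real.pi),
      (exp (-(φ θ * I)) * (exp (h (exp (θ * I)) * I) * μ)).re =
        Real.exp (-(h (exp (θ * I))).im) * (exp (-((m * θ : ℝ) * I)) * μ).re := by
    intro μ θ hθ
    have h1 : exp (-(φ θ * I)) * (exp (h (exp (θ * I)) * I) * μ) =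
        (Real.exp (-(h (exp (θ * I))).im) : ℂ) * (exp (-((m * θ : ℝ) * I)) * μ) := by
      have h2 : φ θ = (h (exp (θ * I))).re + m * θ := by rw [hre θ hθ]; ring
      rw [← mul_assoc, ← mul_assoc, ← Complex.exp_add, ofReal_exp, ← Complex.exp_add]
      congr 2
      rw [h2]
      push_cast
      linear_combination ((h (exp (θ * I))).im : ℂ) * I_mul_I -
        I * Complex.re_add_im (h (exp (θ * I)))
    rw [h1, re_ofReal_mul]
  have hconjexp : ∀ x : ℝ, conj (exp (x * I)) = exp (-(x * I)) := fun x => by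
    rw [← Complex.exp_conj, map_mul, conj_ofReal, conj_I, mul_neg]
  have hunit : ∀ x : ℝ, exp (x * I) * exp (-(x * I)) = 1 := fun x => by
    rw [← Complex.exp_add, add_neg_cancel, Complex.exp_zero]
  have hsq : ∀ θ : ℝ, exp ((m * θ : ℝ) * I) * exp ((m * θ : ℝ) * I) * exp (θ * I) =
      exp (θ * I) ^ n := fun θ => by
    rw [← Complex.exp_add, ← Complex.exp_add, ← Complex.exp_nat_mul]
    congr 1
    simp only [hm]
    push_cast
    ring
  refine ⟨h, hH, ?_, fun κ hκ => ⟨fun hκ0 => ?_, ?_⟩⟩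
  · intro c hc hc0 hc1
    have hIH : IsHolder β (Icc 0 (2 * Real.pi)) (fun θ : ℝ => h (exp (θ * I))) := by
      have hlip : LipschitzOnWith 1 (fun θ : ℝ => exp (θ * I)) (Icc 0 (2 * Real.pi)) := by
        refine (LipschitzWith.of_dist_le_mul fun x y => ?_).lipschitzOnWith
        have h1 := (lipschitzWith_circleMap 0 1).dist_le_mul x y
        simpa [circleMap] using h1
      exact hH.isHolder.comp_lipschitz hβ.le hlip fun θ _ => sphere_subset_closedBall (hsph θ)
    have him : IsHolder β (Icc 0 (2 * Real.pi)) (fun θ : ℝ => (((h (exp (θ * I))).im : ℝ) : ℂ)) := by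
      obtain ⟨C, hC, hh⟩ := hIH
      refine IsHolder.ofReal ⟨C, hC, fun x hx y hy => (hh x hx y hy).trans' ?_⟩
      rw [Real.dist_eq, Complex.dist_eq, ← sub_im]
      exact abs_im_le_norm _
    -- The factor e^{Im h} compensates `hkey`. For half-integer m the last factor changes sign over
    -- a full turn, so D closes up to a Hölder function on the circle because c vanishes at both
    -- ends.
    set D : ℝ → ℂ := fun θ => ((c θ : ℂ) * exp (((h (exp (θ * I))).im : ℝ) : ℂ)) *
      exp ((m * θ : ℝ) * I) with hD
    have hDH : IsHolder β (Icc 0 (2 * Real.pi)) D := by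
      refine IsHolder.mul hβ.le (isBounded_Icc _ _) (IsHolder.mul hβ.le (isBounded_Icc _ _) hc.ofReal
        (him.exp_comp hβ.le (isBounded_Icc _ _))) ?_
      refine IsHolder.exp_comp hβ.le (isBounded_Icc _ _) ?_
      exact IsHolder.mul hβ.le (isBounded_Icc _ _) (isHolder_linear hβ hβ1.le m _ _).ofReal
        (IsHolder.const I)
    have hD0 : D 0 = D (2 * Real.pi) := by simp [hD, hc0, hc1]
    obtain ⟨P, R, hP, hR, hPR⟩ := exists_holderDisc_add_conj hβ hβ1 (isHolder_circleLift hβ.le hD0 hDH)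
    -- On the circle e^{-imθ}ξ^n R is the conjugate of e^{-imθ}conj(ξR), since n = 2m + 1. So the
    -- real part is that of e^{-imθ}D, while P + z^n R is holomorphic because n ≥ 0.
    refine ⟨fun z => exp (h z * I) * (P z + z ^ n * R z), ?_, fun θ hθ => ?_⟩
    · exact ((hH.mul hβ.le (HolderDisc.const I)).exp_comp hβ.le).mul hβ.le
        (hP.add (((HolderDisc.id hβ hβ1.le).pow hβ.le n).mul hβ.le hR))
    · rw [hkey _ θ hθ]
      have h1 := hPR _ (hsph θ)
      rw [circleLift_exp hD0 hθ] at h1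
      set ξ := exp (θ * I) with hξ
      have h2 : (exp (-((m * θ : ℝ) * I)) * (P ξ + ξ ^ n * R ξ)).re =
          (exp (-((m * θ : ℝ) * I)) * (P ξ + conj (ξ * R ξ))).re := by
        have h3 : exp (-((m * θ : ℝ) * I)) * (ξ ^ n * R ξ) =
            conj (exp (-((m * θ : ℝ) * I)) * conj (ξ * R ξ)) := by
          rw [map_mul, Complex.conj_conj, ← hconjexp, Complex.conj_conj, ← hsq θ]
          linear_combination (exp ((m * θ : ℝ) * I) * ξ * R ξ) * (hunit (m * θ)) +
            (exp ((m * θ : ℝ) * I) * exp ((m * θ : ℝ) * I) * ξ * R ξ) * (hconjexp (m * θ))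
        rw [mul_add, mul_add, add_re, add_re, h3, conj_re]
      rw [h2, ← h1, hD]
      have h4 : exp (-((m * θ : ℝ) * I)) * (((c θ : ℂ) * exp (((h ξ).im : ℝ) : ℂ)) *
          exp ((m * θ : ℝ) * I)) = ((c θ * Real.exp (h ξ).im : ℝ) : ℂ) := by
        push_cast
        have := hunit (m * θ)
        push_cast at this
        linear_combination ((c θ : ℂ) * exp (((h ξ).im : ℝ) : ℂ)) * this
      rw [h4, ofReal_re, Real.exp_neg]
      field_simp
  · have hμ : HolderDisc β (fun z => exp (-(h z * I)) * κ z) := by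
      have h1 : HolderDisc β (fun z => exp (h z * (-I))) :=
        (hH.mul hβ.le (HolderDisc.const (-I))).exp_comp hβ.le
      have := h1.mul hβ.le hκ
      simpa only [mul_neg] using this
    have hcancel : ∀ z, κ z = exp (h z * I) * (exp (-(h z * I)) * κ z) := fun z => by
      rw [← mul_assoc, ← Complex.exp_add, add_neg_cancel, Complex.exp_zero, one_mul]
    obtain ⟨t, ht⟩ := exists_eq_selfReciprocal (n := n) hμ.differentiableOn (hμ.continuousOn hβ) (by
      intro ξ hξ
      obtain ⟨θ, hθ, rfl⟩ : ∃ θ ∈ Icc 0 (2 * Real.pi), exp (θ * I) = ξ := by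
        have h0 : ‖ξ‖ = 1 := by simpa using hξ
        refine ⟨toIcoMod Real.two_pi_pos 0 ξ.arg, ?_, ?_⟩
        · have := toIcoMod_mem_Ico Real.two_pi_pos 0 ξ.arg
          rw [zero_add] at this
          exact ⟨this.1, this.2.le⟩
        · have h1 : exp (ξ.arg * I) = ξ := by
            have := Complex.norm_mul_exp_arg_mul_I ξ
            rwa [h0, ofReal_one, one_mul] at this
          have h2 := toIcoMod_add_toIcoDiv_zsmul Real.two_pi_pos 0 ξ.arg
          rw [← h1]
          nth_rewrite 2 [← h2]
          push_cast
          rw [add_mul, Complex.exp_add, zsmul_eq_mul]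
          have h3 := Complex.exp_int_mul_two_pi_mul_I (toIcoDiv Real.two_pi_pos 0 ξ.arg)
          rw [← mul_assoc, ← mul_assoc] at h3
          rw [← mul_assoc, h3, mul_one, h1]
      have h1 := hκ0 θ hθ
      rw [hcancel (exp (θ * I)), hkey _ θ hθ] at h1
      have h2 := (mul_eq_zero.1 h1).resolve_left (Real.exp_pos _).ne'
      set ξ := exp (θ * I)
      set μ := exp (-(h ξ * I)) * κ ξ
      have h3 : exp (-((m * θ : ℝ) * I)) * μ + exp ((m * θ : ℝ) * I) * conj μ = 0 := by
        have h4 := Complex.add_conj (exp (-((m * θ : ℝ) * I)) * μ)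
        rw [h2, map_mul, ← hconjexp, Complex.conj_conj] at h4
        rw [hconjexp] at h4
        simpa using h4
      linear_combination (exp ((m * θ : ℝ) * I) * ξ) * h3 - ξ * μ * hunit (m * θ) -
        conj μ * hsq θ)
    exact ⟨t, fun z hz => by rw [hcancel z, ht z hz]⟩
  · rintro ⟨t, ht⟩ θ hθ
    rw [ht _ (sphere_subset_closedBall (hsph θ)), hkey _ θ hθ]
    have h1 := mul_selfReciprocal_add t (hsph θ)
    set ξ := exp (θ * I) with hξ
    set μ := selfReciprocal t ξ
    have hξ0 : ξ ≠ 0 := Complex.exp_ne_zero _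
    have h3 : exp (-((m * θ : ℝ) * I)) * μ + exp ((m * θ : ℝ) * I) * conj μ = 0 := by
      have h5 : exp ((m * θ : ℝ) * I) * ξ ≠ 0 := mul_ne_zero (Complex.exp_ne_zero _) hξ0
      apply mul_left_cancel₀ h5
      linear_combination h1 + ξ * μ * hunit (m * θ) + conj μ * hsq θ
    have h4 := Complex.add_conj (exp (-((m * θ : ℝ) * I)) * μ)
    rw [map_mul, ← hconjexp, Complex.conj_conj, hconjexp, h3] at h4
    have h6 : (exp (-((m * θ : ℝ) * I)) * μ).re = 0 := by
      have := congrArg re h4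
      simp only [zero_re, ofReal_re] at this
      linarith
    rw [h6, mul_zero]

/-! ### Passage between functions on the plane and functions on the closed disc. -/

theorem HolderDisc.mem_holderDiscAlgebra {β : ℝ≥0} (hβ : 0 < β) {F : ℂ → ℂ}
    (hF : HolderDisc β F) : (fun z : ClosedDisc => F z) ∈ holderDiscAlgebra β := by
  have hH : IsHolder (β : ℝ) (univ : Set ClosedDisc) (fun z : ClosedDisc => F z) := by
    obtain ⟨C, hC, h⟩ := hF.isHolder
    exact ⟨C, hC, fun x _ y _ => h x x.2 y y.2⟩
  obtain ⟨C, hC⟩ := isHolder_iff_holderOnWith.1 hH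
  rw [holderOnWith_univ] at hC
  exact ⟨⟨hC.continuous hβ, F, hF.differentiableOn, fun _ _ => rfl⟩, C, hC⟩

theorem exists_holderDisc_of_mem {β : ℝ≥0} {κ : ClosedDisc → ℂ}
    (hκ : κ ∈ holderDiscAlgebra β) : ∃ F, HolderDisc β F ∧ ∀ z : ClosedDisc, κ z = F z := by
  classical
  obtain ⟨⟨-, G, hG, hκG⟩, C, hC⟩ := hκ
  have hF : ∀ z (hz : z ∈ closedBall (0 : ℂ) 1),
      (if h : z ∈ closedBall (0 : ℂ) 1 then κ ⟨z, h⟩ else 0) = κ ⟨z, hz⟩ := fun z hz => dif_pos hz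
  refine ⟨fun z => if h : z ∈ closedBall (0 : ℂ) 1 then κ ⟨z, h⟩ else 0, ⟨?_, ?_⟩,
    fun z => (hF z z.2).symm⟩
  · refine hG.congr fun z hz => ?_
    simp only [hF z (ball_subset_closedBall hz)]
    exact hκG ⟨z, ball_subset_closedBall hz⟩ hz
  · refine ⟨C, C.coe_nonneg, fun x hx y hy => ?_⟩
    simp only [hF x hx, hF y hy]
    exact hC.dist_le ⟨x, hx⟩ ⟨y, hy⟩

theorem deltaOf_mem_Ioo {b : ℝ} (hb : b ∈ Ioo (-1 : ℝ) 1) (hb0 : b ≠ 0) : deltaOf b ∈ Ioo 0 1 := by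
  rw [deltaOf]
  split_ifs with h
  · exact ⟨by linarith [hb.2], by linarith⟩
  · exact ⟨abs_pos.2 hb0, abs_lt.2 hb⟩

/-! ### Branches of the powers and the weight. -/

section Powers

variable {δ : ℝ}

/-- The radius r = 0 is allowed, since both sides vanish for δ ≠ 0; thus the boundary formulas for
the weight hold also at ±1. -/
theorem cpow_polar (hδ : δ ≠ 0) {r a : ℝ} (hr : 0 ≤ r) (ha : a ∈ Ioc (-Real.pi) Real.pi) :
    ((r : ℂ) * exp (a * I)) ^ (δ : ℂ) = ((r ^ δ : ℝ) : ℂ) * exp ((δ * a : ℝ) * I) := by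
  rcases eq_or_lt_of_le hr with rfl | hr
  · rw [Real.zero_rpow hδ, ofReal_zero, zero_mul, zero_mul, Complex.zero_cpow (by exact_mod_cast hδ)]
  have h1 : (r : ℂ) * exp (a * I) = exp ((Real.log r : ℂ) + a * I) := by
    rw [Complex.exp_add, ← ofReal_exp, Real.exp_log hr]
  have h2 : log ((r : ℂ) * exp (a * I)) = (Real.log r : ℂ) + a * I := by
    rw [h1, Complex.log_exp] <;> simp [ha.1, ha.2]
  rw [Complex.cpow_def_of_ne_zero (by rw [h1]; exact Complex.exp_ne_zero _), h2,
    Real.rpow_def_of_pos hr, ofReal_exp, ← Complex.exp_add]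
  congr 1
  push_cast
  ring

theorem powPosCut_polar (hδ : δ ≠ 0) {r a : ℝ} (hr : 0 ≤ r) (ha : a ∈ Ioc 0 (2 * Real.pi)) :
    powPosCut ((r : ℂ) * exp (a * I)) δ = ((r ^ δ : ℝ) : ℂ) * exp ((δ * a : ℝ) * I) := by
  have h1 : -((r : ℂ) * exp (a * I)) = (r : ℂ) * exp ((a - Real.pi : ℝ) * I) := by
    push_cast
    rw [sub_mul, Complex.exp_sub, Complex.exp_pi_mul_I]; ring
  rw [powPosCut, h1, cpow_polar hδ hr ⟨by linarith [ha.1], by linarith [ha.2]⟩, mul_left_comm,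
    ← Complex.exp_add]
  congr 2
  push_cast
  ring

theorem exp_sub_one_eq (θ : ℝ) :
    exp (θ * I) - 1 = ((2 * Real.sin (θ / 2) : ℝ) : ℂ) * exp ((θ / 2 + Real.pi / 2 : ℝ) * I) := by
  have h1 : exp ((θ / 2 + Real.pi / 2 : ℝ) * I) = exp ((θ / 2 : ℝ) * I) * I := by
    push_cast
    rw [add_mul, Complex.exp_add, Complex.exp_pi_div_two_mul_I]
  have h2 : ((2 * Real.sin (θ / 2) : ℝ) : ℂ) * I =
      exp ((θ / 2 : ℝ) * I) - exp (-((θ / 2 : ℝ) * I)) := by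
    push_cast
    rw [Complex.two_sin]
    have h4 : exp (-((θ : ℂ) / 2) * I) = exp (-((θ : ℂ) / 2 * I)) := by rw [neg_mul]
    rw [h4]
    linear_combination (exp (-((θ : ℂ) / 2 * I)) - exp ((θ : ℂ) / 2 * I)) * I_mul_I
  have h3 : exp (θ * I) = exp ((θ / 2 : ℝ) * I) * exp ((θ / 2 : ℝ) * I) := by
    rw [← Complex.exp_add]; congr 1; push_cast; ring
  have h4 : exp ((θ / 2 : ℝ) * I) * exp (-((θ / 2 : ℝ) * I)) = 1 := by
    rw [← Complex.exp_add, add_neg_cancel, Complex.exp_zero]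
  rw [h1, h3]
  linear_combination -exp ((θ / 2 : ℝ) * I) * h2 + h4

theorem exp_add_one_eq (θ : ℝ) :
    exp (θ * I) + 1 = ((2 * Real.cos (θ / 2) : ℝ) : ℂ) * exp ((θ / 2 : ℝ) * I) := by
  have h2 : ((2 * Real.cos (θ / 2) : ℝ) : ℂ) =
      exp ((θ / 2 : ℝ) * I) + exp (-((θ / 2 : ℝ) * I)) := by
    push_cast
    rw [Complex.two_cos, neg_mul]
  have h3 : exp (θ * I) = exp ((θ / 2 : ℝ) * I) * exp ((θ / 2 : ℝ) * I) := by
    rw [← Complex.exp_add]; congr 1; push_cast; ring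
  have h4 : exp ((θ / 2 : ℝ) * I) * exp (-((θ / 2 : ℝ) * I)) = 1 := by
    rw [← Complex.exp_add, add_neg_cancel, Complex.exp_zero]
  rw [h3, h2]
  linear_combination -h4

/-- On the lower semicircle cos(θ/2) ≤ 0; moving the sign into the angle gives a nonnegative radius
and an argument θ/2 - π in [-π/2, 0], where the principal branch applies. -/
theorem exp_add_one_eq' (θ : ℝ) :
    exp (θ * I) + 1 = ((-(2 * Real.cos (θ / 2)) : ℝ) : ℂ) * exp ((θ / 2 - Real.pi : ℝ) * I) := by
  rw [exp_add_one_eq]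
  push_cast
  rw [sub_mul, Complex.exp_sub, Complex.exp_pi_mul_I]; ring

theorem norm_ofReal_mul_exp {r a : ℝ} (hr : 0 ≤ r) : ‖(r : ℂ) * exp (a * I)‖ = r := by
  rw [norm_mul, Complex.norm_exp_ofReal_mul_I, mul_one, Complex.norm_real, Real.norm_of_nonneg hr]

theorem powPosCut_circle (hδ : δ ≠ 0) {θ : ℝ} (hθ : θ ∈ Icc 0 (2 * Real.pi)) :
    powPosCut (exp (θ * I) - 1) δ =
      ((‖exp (θ * I) - 1‖ ^ δ : ℝ) : ℂ) * exp ((δ * (θ / 2 + Real.pi / 2) : ℝ) * I) := by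
  have hp := Real.pi_pos
  have hs : 0 ≤ 2 * Real.sin (θ / 2) := by
    have := Real.sin_nonneg_of_nonneg_of_le_pi (x := θ / 2) (by linarith [hθ.1]) (by linarith [hθ.2])
    linarith
  rw [exp_sub_one_eq, norm_ofReal_mul_exp hs,
    powPosCut_polar hδ hs ⟨by linarith [hθ.1], by linarith [hθ.2]⟩]

theorem cpow_upper (hδ : δ ≠ 0) {θ : ℝ} (hθ : θ ∈ Icc 0 Real.pi) :
    (exp (θ * I) + 1) ^ (δ : ℂ) =
      ((‖exp (θ * I) + 1‖ ^ δ : ℝ) : ℂ) * exp ((δ * (θ / 2) : ℝ) * I) := by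
  have hp := Real.pi_pos
  have hs : 0 ≤ 2 * Real.cos (θ / 2) := by
    have := Real.cos_nonneg_of_mem_Icc (x := θ / 2) ⟨by linarith [hθ.1], by linarith [hθ.2]⟩
    linarith
  rw [exp_add_one_eq, norm_ofReal_mul_exp hs,
    cpow_polar hδ hs ⟨by linarith [hθ.1], by linarith [hθ.2]⟩]

theorem cpow_lower (hδ : δ ≠ 0) {θ : ℝ} (hθ : θ ∈ Icc Real.pi (2 * Real.pi)) :
    (exp (θ * I) + 1) ^ (δ : ℂ) =
      ((‖exp (θ * I) + 1‖ ^ δ : ℝ) : ℂ) * exp ((δ * (θ / 2 - Real.pi) : ℝ) * I) := by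
  have hp := Real.pi_pos
  have hs : 0 ≤ -(2 * Real.cos (θ / 2)) := by
    have := Real.cos_nonpos_of_pi_div_two_le_of_le (x := θ / 2) (by linarith [hθ.1])
      (by linarith [hθ.2])
    linarith
  rw [exp_add_one_eq', norm_ofReal_mul_exp hs,
    cpow_polar hδ hs ⟨by linarith [hθ.1], by linarith [hθ.2]⟩]

theorem powPosCut_normalized {w : ℂ} (hw : w ≠ 0) {a : ℝ}
    (h : powPosCut w δ = ((‖w‖ ^ δ : ℝ) : ℂ) * exp (a * I)) :
    powPosCut (w / ‖w‖) δ = exp (a * I) := by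
  have hn : 0 < ‖w‖ := norm_pos_iff.2 hw
  have h1 : (-w) ^ (δ : ℂ) = ((‖w‖ ^ δ : ℝ) : ℂ) * (-(w / ‖w‖)) ^ (δ : ℂ) := by
    have h2 : -w = (‖w‖ : ℂ) * (-(w / ‖w‖)) := by
      have : (‖w‖ : ℂ) ≠ 0 := by exact_mod_cast hn.ne'
      field_simp
    have h3 : -(w / ‖w‖) ≠ 0 := neg_ne_zero.2 (div_ne_zero hw (by exact_mod_cast hn.ne'))
    nth_rewrite 1 [h2]
    rw [Complex.cpow_def_of_ne_zero (mul_ne_zero (by exact_mod_cast hn.ne') h3),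
      Complex.cpow_def_of_ne_zero h3, Complex.log_ofReal_mul hn h3, add_mul, Complex.exp_add,
      Real.rpow_def_of_pos hn]
    push_cast
    rfl
  have hr : ((‖w‖ ^ δ : ℝ) : ℂ) ≠ 0 := by exact_mod_cast (Real.rpow_pos_of_pos hn δ).ne'
  rw [powPosCut, h1, mul_left_comm] at h
  rw [powPosCut]
  exact mul_left_cancel₀ hr h

theorem cpow_normalized {w : ℂ} (hw : w ≠ 0) {a : ℝ}
    (h : w ^ (δ : ℂ) = ((‖w‖ ^ δ : ℝ) : ℂ) * exp (a * I)) :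
    (w / ‖w‖) ^ (δ : ℂ) = exp (a * I) := by
  have hn : 0 < ‖w‖ := norm_pos_iff.2 hw
  have hw' : powPosCut (-w) δ = ((‖-w‖ ^ δ : ℝ) : ℂ) * exp ((Real.pi * δ + a : ℝ) * I) := by
    rw [powPosCut, neg_neg, h, norm_neg, mul_left_comm, ← Complex.exp_add]
    congr 2; push_cast; ring
  have h1 := powPosCut_normalized (neg_ne_zero.2 hw) hw'
  rw [powPosCut, norm_neg, neg_div, neg_neg] at h1
  apply mul_left_cancel₀ (Complex.exp_ne_zero (Real.pi * δ * I))
  rw [h1, ← Complex.exp_add]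
  congr 1; push_cast; ring

theorem continuousOn_cpow_re_nonneg (hδ : 0 < δ) :
    ContinuousOn (fun z : ℂ => z ^ (δ : ℂ)) {z | 0 ≤ z.re} := fun z hz =>
  (Complex.continuousAt_cpow_const_of_re_pos (Or.inl hz) (by simpa using hδ)).continuousWithinAt

theorem re_one_add_mul_pos {σ : ℂ} (hσ : ‖σ‖ = 1) {z : ℂ} (hz : z ∈ ball (0 : ℂ) 1) :
    0 < (1 + σ * z).re := by
  have h1 := abs_le.1 (Complex.abs_re_le_norm (σ * z))
  have h2 : ‖σ * z‖ < 1 := by rw [norm_mul, hσ, one_mul]; simpa using hz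
  rw [add_re, one_re]
  linarith [h1.1]

theorem re_one_add_mul_nonneg {σ : ℂ} (hσ : ‖σ‖ = 1) {z : ℂ} (hz : z ∈ closedBall (0 : ℂ) 1) :
    0 ≤ (1 + σ * z).re := by
  have h1 := abs_le.1 (Complex.abs_re_le_norm (σ * z))
  have h2 : ‖σ * z‖ ≤ 1 := by rw [norm_mul, hσ, one_mul]; simpa using hz
  rw [add_re, one_re]
  linarith [h1.1]

theorem continuousOn_one_add_mul_cpow {σ : ℂ} (hσ : ‖σ‖ = 1) (hδ : 0 < δ) :
    ContinuousOn (fun z : ℂ => (1 + σ * z) ^ (δ : ℂ)) (closedBall 0 1) :=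
  (continuousOn_cpow_re_nonneg hδ).comp (by fun_prop) fun _ hz => re_one_add_mul_nonneg hσ hz

theorem hasDerivAt_one_add_mul_cpow {σ : ℂ} (hσ : ‖σ‖ = 1) {z : ℂ} (hz : z ∈ ball (0 : ℂ) 1) :
    HasDerivAt (fun z : ℂ => (1 + σ * z) ^ (δ : ℂ)) (δ * (1 + σ * z) ^ ((δ : ℂ) - 1) * σ) z := by
  have h1 : HasDerivAt (fun z : ℂ => 1 + σ * z) σ z := by
    simpa using ((hasDerivAt_id z).const_mul σ).const_add 1
  exact h1.cpow_const (Or.inl (re_one_add_mul_pos hσ hz))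

theorem differentiableOn_one_add_mul_cpow {σ : ℂ} (hσ : ‖σ‖ = 1) :
    DifferentiableOn ℂ (fun z : ℂ => (1 + σ * z) ^ (δ : ℂ)) (ball 0 1) := fun _ hz =>
  (hasDerivAt_one_add_mul_cpow hσ hz).differentiableAt.differentiableWithinAt

/-- The derivative is at most δ|1+σz|^(δ-1) ≤ δ(1-|z|)^(δ-1) ≤ δ(1-|z|)^(β-1), so the
Hardy–Littlewood theorem applies. -/
theorem holderDisc_one_add_mul_cpow {β : ℝ} (hβ : 0 < β) (hβδ : β ≤ δ) (hδ1 : δ ≤ 1) {σ : ℂ}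
    (hσ : ‖σ‖ = 1) : HolderDisc β (fun z : ℂ => (1 + σ * z) ^ (δ : ℂ)) := by
  have hδ : 0 < δ := hβ.trans_le hβδ
  have hdiff := differentiableOn_one_add_mul_cpow (δ := δ) hσ
  obtain ⟨G, hG, hGe⟩ := exists_holderDisc_of_norm_deriv_le hβ (hβδ.trans hδ1) hδ.le hdiff (by
    intro z hz
    have hz1 : ‖z‖ < 1 := by simpa using hz
    have hpos := re_one_add_mul_pos hσ hz
    have hne : 1 + σ * z ≠ 0 := fun h => by rw [h] at hpos; simp at hpos
    rw [(hasDerivAt_one_add_mul_cpow hσ hz).deriv, norm_mul, norm_mul, hσ, mul_one,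
      Complex.norm_real, Real.norm_of_nonneg hδ.le]
    gcongr
    have h1 : ((δ : ℂ) - 1) = ((δ - 1 : ℝ) : ℂ) := by push_cast; rfl
    rw [h1, Complex.norm_cpow_real]
    have h2 : 1 - ‖z‖ ≤ ‖1 + σ * z‖ := by
      have := norm_sub_le (1 + σ * z) (σ * z)
      rw [add_sub_cancel_right, norm_one, norm_mul, hσ, one_mul] at this
      linarith
    exact (Real.rpow_le_rpow_of_nonpos (by linarith) h2 (by linarith)).trans
      (Real.rpow_le_rpow_of_exponent_ge (by linarith) (by linarith [norm_nonneg z]) (by linarith)))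
  refine ⟨hdiff, hG.isHolder.congr ?_⟩
  exact eqOn_closedBall_of_eqOn_ball (continuousOn_one_add_mul_cpow hσ hδ) (hG.continuousOn hβ)
    hGe.symm

end Powers

section Weight

variable {δ₁ δm₁ : ℝ}

/-- Both factors become principal powers of 1 + σz with σ = ∓1, whose base has positive real part in
the open disc. -/
theorem weight_eq (z : ℂ) : weight δ₁ δm₁ z =
    exp (Real.pi * δ₁ * I) * (1 + (-1) * z) ^ (δ₁ : ℂ) * (1 + 1 * z) ^ (δm₁ : ℂ) := by
  rw [weight, powPosCut, show -(z - 1) = 1 + (-1) * z by ring, show z + 1 = 1 + 1 * z by ring]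

theorem continuousOn_weight (h₁ : 0 < δ₁) (hm₁ : 0 < δm₁) :
    ContinuousOn (weight δ₁ δm₁) (closedBall 0 1) := by
  rw [funext (weight_eq (δ₁ := δ₁) (δm₁ := δm₁))]
  exact (continuousOn_const.mul (continuousOn_one_add_mul_cpow (by simp) h₁)).mul
    (continuousOn_one_add_mul_cpow (by simp) hm₁)

theorem differentiableOn_weight : DifferentiableOn ℂ (weight δ₁ δm₁) (ball 0 1) := by
  rw [funext (weight_eq (δ₁ := δ₁) (δm₁ := δm₁))]
  exact ((differentiableOn_const _).mul (differentiableOn_one_add_mul_cpow (by simp))).mul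
    (differentiableOn_one_add_mul_cpow (by simp))

theorem holderDisc_weight {β : ℝ} (hβ : 0 < β) (hβ₁ : β ≤ δ₁) (h₁ : δ₁ ≤ 1) (hβm₁ : β ≤ δm₁)
    (hm₁ : δm₁ ≤ 1) : HolderDisc β (weight δ₁ δm₁) := by
  rw [funext (weight_eq (δ₁ := δ₁) (δm₁ := δm₁))]
  exact ((HolderDisc.const _).mul hβ.le (holderDisc_one_add_mul_cpow hβ hβ₁ h₁ (by simp))).mul hβ.le
    (holderDisc_one_add_mul_cpow hβ hβm₁ hm₁ (by simp))

theorem weight_ne_zero {z : ℂ} (hz : z ∈ ball (0 : ℂ) 1) : weight δ₁ δm₁ z ≠ 0 := by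
  have h1 : ∀ σ : ℂ, ‖σ‖ = 1 → 1 + σ * z ≠ 0 := fun σ hσ h => by
    have := re_one_add_mul_pos hσ hz
    rw [h] at this
    simp at this
  rw [weight_eq]
  refine mul_ne_zero (mul_ne_zero (Complex.exp_ne_zero _) ?_) ?_
  · rw [Complex.cpow_def_of_ne_zero (h1 _ (by simp))]; exact Complex.exp_ne_zero _
  · rw [Complex.cpow_def_of_ne_zero (h1 _ (by simp))]; exact Complex.exp_ne_zero _

theorem weight_mul_mem_discAlgebra (h₁ : 0 < δ₁) (hm₁ : 0 < δm₁) {F : ℂ → ℂ}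
    (hF : DifferentiableOn ℂ F (ball 0 1)) (hFc : ContinuousOn F (closedBall 0 1)) :
    (fun z : ClosedDisc => weight δ₁ δm₁ z * F z) ∈ discAlgebra := by
  refine ⟨?_, fun z => weight δ₁ δm₁ z * F z, differentiableOn_weight.mul hF, fun _ _ => rfl⟩
  exact continuousOn_iff_continuous_domRestrict.1 ((continuousOn_weight h₁ hm₁).mul hFc)

theorem weight_upper (h₁ : δ₁ ≠ 0) (hm₁ : δm₁ ≠ 0) {θ : ℝ} (hθ : θ ∈ Icc 0 Real.pi) :
    weight δ₁ δm₁ (exp (θ * I)) =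
      ((‖exp (θ * I) - 1‖ ^ δ₁ * ‖exp (θ * I) + 1‖ ^ δm₁ : ℝ) : ℂ) *
        exp ((δ₁ * (θ / 2 + Real.pi / 2) + δm₁ * (θ / 2) : ℝ) * I) := by
  rw [weight, powPosCut_circle h₁ ⟨hθ.1, by linarith [hθ.2, Real.pi_pos]⟩, cpow_upper hm₁ hθ]
  push_cast
  rw [add_mul, Complex.exp_add]
  ring

theorem weight_lower (h₁ : δ₁ ≠ 0) (hm₁ : δm₁ ≠ 0) {θ : ℝ} (hθ : θ ∈ Icc Real.pi (2 * Real.pi)) :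
    weight δ₁ δm₁ (exp (θ * I)) =
      ((‖exp (θ * I) - 1‖ ^ δ₁ * ‖exp (θ * I) + 1‖ ^ δm₁ : ℝ) : ℂ) *
        exp ((δ₁ * (θ / 2 + Real.pi / 2) + δm₁ * (θ / 2 - Real.pi) : ℝ) * I) := by
  rw [weight, powPosCut_circle h₁ ⟨by linarith [hθ.1, Real.pi_pos], hθ.2⟩, cpow_lower hm₁ hθ]
  push_cast
  rw [add_mul, Complex.exp_add]
  ring

end Weight

/-! ### The continuous argument of B̃ and its total change. -/

theorem exp_mul_I_im (θ : ℝ) : (exp (θ * I)).im = Real.sin θ := Complex.exp_ofReal_mul_I_im θ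

theorem exp_mul_I_sub_one_ne_zero {θ : ℝ} (hθ : θ ∈ Ioo 0 (2 * Real.pi)) : exp (θ * I) - 1 ≠ 0 := by
  rw [exp_sub_one_eq]
  refine mul_ne_zero ?_ (Complex.exp_ne_zero _)
  have := Real.sin_pos_of_pos_of_lt_pi (x := θ / 2) (by linarith [hθ.1]) (by linarith [hθ.2])
  exact_mod_cast (mul_pos two_pos this).ne'

theorem exp_mul_I_add_one_ne_zero_of_lt {θ : ℝ} (hθ : θ ∈ Ioo 0 Real.pi) : exp (θ * I) + 1 ≠ 0 := by
  intro h
  have h1 := congrArg im h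
  rw [add_im, exp_mul_I_im, one_im, add_zero, zero_im] at h1
  exact (Real.sin_pos_of_mem_Ioo hθ).ne' h1

theorem exp_mul_I_add_one_ne_zero_of_gt {θ : ℝ} (hθ : θ ∈ Ioo Real.pi (2 * Real.pi)) :
    exp (θ * I) + 1 ≠ 0 := by
  intro h
  have h1 := congrArg im h
  rw [add_im, exp_mul_I_im, one_im, add_zero, zero_im] at h1
  have := Real.sin_pos_of_mem_Ioo (x := θ - Real.pi) ⟨by linarith [hθ.1], by linarith [hθ.2]⟩
  rw [Real.sin_sub_pi] at this
  linarith

/-- The sign on the lower semicircle. -/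
noncomputable def lowerSign (βm₁ : ℝ) : ℝ := if βm₁ < 0 then 1 else -1

theorem conjBTilde_upper {B : ℂ → ℂ} {β₁ βm₁ : ℝ} (h₁ : deltaOf β₁ ≠ 0) (hm₁ : deltaOf βm₁ ≠ 0)
    {θ : ℝ} (hθ : θ ∈ Ioo 0 Real.pi) :
    conjBTilde B β₁ βm₁ (exp (θ * I)) = conj (B (exp (θ * I))) *
      exp ((deltaOf β₁ * (θ / 2 + Real.pi / 2) + deltaOf βm₁ * (θ / 2) : ℝ) * I) := by
  have hθ' : θ ∈ Ioo 0 (2 * Real.pi) := ⟨hθ.1, by linarith [hθ.2, Real.pi_pos]⟩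
  have him : 0 < (exp (θ * I)).im := by
    rw [exp_mul_I_im]; exact Real.sin_pos_of_mem_Ioo hθ
  simp only [conjBTilde]
  rw [if_pos him, powPosCut_normalized (exp_mul_I_sub_one_ne_zero hθ')
    (powPosCut_circle h₁ (Ioo_subset_Icc_self hθ')),
    cpow_normalized (exp_mul_I_add_one_ne_zero_of_lt hθ) (cpow_upper hm₁ (Ioo_subset_Icc_self hθ))]
  rw [← Complex.exp_add]
  congr 2
  push_cast
  ring

theorem conjBTilde_lower {B : ℂ → ℂ} {β₁ βm₁ : ℝ} (h₁ : deltaOf β₁ ≠ 0) (hm₁ : deltaOf βm₁ ≠ 0)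
    {θ : ℝ} (hθ : θ ∈ Ioo Real.pi (2 * Real.pi)) :
    conjBTilde B β₁ βm₁ (exp (θ * I)) = lowerSign βm₁ * I *
      exp ((deltaOf β₁ * (θ / 2 + Real.pi / 2) + deltaOf βm₁ * (θ / 2 - Real.pi) : ℝ) * I) := by
  have hθ' : θ ∈ Ioo 0 (2 * Real.pi) := ⟨by linarith [hθ.1, Real.pi_pos], hθ.2⟩
  have him : ¬ 0 < (exp (θ * I)).im := by
    have := Real.sin_pos_of_mem_Ioo (x := θ - Real.pi) ⟨by linarith [hθ.1], by linarith [hθ.2]⟩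
    rw [Real.sin_sub_pi] at this
    rw [exp_mul_I_im]; linarith
  have hphase : powPosCut ((exp (θ * I) - 1) / ‖exp (θ * I) - 1‖) (deltaOf β₁) *
      ((exp (θ * I) + 1) / ‖exp (θ * I) + 1‖) ^ ((deltaOf βm₁ : ℝ) : ℂ) =
      exp ((deltaOf β₁ * (θ / 2 + Real.pi / 2) + deltaOf βm₁ * (θ / 2 - Real.pi) : ℝ) * I) := by
    rw [powPosCut_normalized (exp_mul_I_sub_one_ne_zero hθ')
      (powPosCut_circle h₁ (Ioo_subset_Icc_self hθ')),
      cpow_normalized (exp_mul_I_add_one_ne_zero_of_gt hθ) (cpow_lower hm₁ (Ioo_subset_Icc_self hθ)),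
      ← Complex.exp_add]
    congr 1
    push_cast
    ring
  simp only [conjBTilde, lowerSign]
  rw [if_neg him, hphase]
  split_ifs <;> push_cast <;> ring

theorem lowerSign_sq (βm₁ : ℝ) : lowerSign βm₁ * lowerSign βm₁ = 1 := by
  unfold lowerSign; split_ifs <;> norm_num

/-- A continuous nowhere vanishing function on an interval has a continuous argument. -/
theorem exists_continuous_argument {g : ℝ → ℂ} {a b : ℝ} (hab : a ≤ b)
    (hg : ContinuousOn g (Icc a b)) (hg0 : ∀ θ ∈ Icc a b, g θ ≠ 0) :
    ∃ ψ : ℝ → ℝ, Continuous ψ ∧ ∀ θ ∈ Icc a b, g θ = ‖g θ‖ * exp (ψ θ * I) := by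
  -- Extending g by its end values makes the domain all of ℝ, where paths lift through the covering
  -- exp.
  have hc : Continuous fun θ : ℝ => g (projIcc a b hab θ) :=
    hg.comp_continuous (by fun_prop) fun θ => (projIcc a b hab θ).2
  have hne : ∀ θ : ℝ, g (projIcc a b hab θ) ≠ 0 := fun θ => hg0 _ (projIcc a b hab θ).2
  obtain ⟨F, ⟨-, hF⟩, -⟩ := Complex.isCoveringMapOn_exp.existsUnique_continuousMap_lifts
    (A := ℝ) ⟨_, hc⟩ (a₀ := a) (e₀ := log (g (projIcc a b hab a))) (Complex.exp_log (hne a))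
    (fun θ => hne θ)
  refine ⟨fun θ => (F θ).im, by fun_prop, fun θ hθ => ?_⟩
  have h1 : exp (F θ) = g θ := by
    have := congrFun hF θ
    simpa [projIcc_of_mem hab hθ] using this
  rw [← h1, Complex.norm_exp, ofReal_exp, ← Complex.exp_add, Complex.re_add_im]

/-- The argument of `(ξ - 1) ^ δ₁ * (ξ + 1) ^ δm₁` at `ξ = e^{iθ}` on the upper semicircle. -/
noncomputable def upperAngle (δ₁ δm₁ θ : ℝ) : ℝ := δ₁ * (θ / 2 + Real.pi / 2) + δm₁ * (θ / 2)

/-- The argument of `(ξ - 1) ^ δ₁ * (ξ + 1) ^ δm₁` at `ξ = e^{iθ}` on the lower semicircle. -/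
noncomputable def lowerAngle (δ₁ δm₁ θ : ℝ) : ℝ :=
  δ₁ * (θ / 2 + Real.pi / 2) + δm₁ * (θ / 2 - Real.pi)

theorem continuous_upperAngle (δ₁ δm₁ : ℝ) : Continuous (upperAngle δ₁ δm₁) := by
  unfold upperAngle; fun_prop

theorem continuous_lowerAngle (δ₁ δm₁ : ℝ) : Continuous (lowerAngle δ₁ δm₁) := by
  unfold lowerAngle; fun_prop

theorem conj_exp_mul_I (x : ℝ) : conj (exp (x * I)) = exp (-(x * I)) := by
  rw [← Complex.exp_conj, map_mul, conj_ofReal, conj_I, mul_neg]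

/-- `φ` is a continuous argument of the function `B̃` along the unit circle. -/
structure IsArgument (B : ℂ → ℂ) (β₁ βm₁ : ℝ) (φ : ℝ → ℝ) : Prop where
  continuousOn : ContinuousOn φ (Icc 0 (2 * Real.pi))
  -- The relations are written with B and the explicit angles, so that they make sense on the closed
  -- semicircles, although B̃ is meaningless at ±1.
  upper : ∀ θ ∈ Icc 0 Real.pi, (‖B (exp (θ * I))‖ : ℂ) * exp (φ θ * I) =
    B (exp (θ * I)) * exp (-(upperAngle (deltaOf β₁) (deltaOf βm₁) θ * I))
  lower : ∀ θ ∈ Icc Real.pi (2 * Real.pi), exp (φ θ * I) =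
    -(lowerSign βm₁ * I) * exp (-(lowerAngle (deltaOf β₁) (deltaOf βm₁) θ * I))

theorem exp_mem_upperArc {θ : ℝ} (hθ : θ ∈ Icc 0 Real.pi) : exp (θ * I) ∈ upperArc :=
  ⟨Complex.norm_exp_ofReal_mul_I θ, by
    rw [exp_mul_I_im]; exact Real.sin_nonneg_of_nonneg_of_le_pi hθ.1 hθ.2⟩

theorem exp_mem_lowerArc {θ : ℝ} (hθ : θ ∈ Icc Real.pi (2 * Real.pi)) :
    exp (θ * I) ∈ lowerArc :=
  ⟨Complex.norm_exp_ofReal_mul_I θ, by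
    rw [exp_mul_I_im]
    have := Real.sin_nonneg_of_nonneg_of_le_pi (x := θ - Real.pi) (by linarith [hθ.1])
      (by linarith [hθ.2])
    rw [Real.sin_sub_pi] at this
    linarith⟩

section Argument

variable {B : ℂ → ℂ} {β₁ βm₁ : ℝ}

theorem norm_lowerSign_mul_I (βm₁ : ℝ) : ‖(lowerSign βm₁ : ℂ) * I‖ = 1 := by
  unfold lowerSign; split_ifs <;> simp

theorem norm_conjBTilde_upper (h₁ : deltaOf β₁ ≠ 0) (hm₁ : deltaOf βm₁ ≠ 0) {θ : ℝ}
    (hθ : θ ∈ Ioo 0 Real.pi) :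
    ‖conj (conjBTilde B β₁ βm₁ (exp (θ * I)))‖ = ‖B (exp (θ * I))‖ := by
  rw [Complex.norm_conj, conjBTilde_upper h₁ hm₁ hθ, norm_mul, Complex.norm_exp_ofReal_mul_I,
    Complex.norm_conj, mul_one]

theorem norm_conjBTilde_lower (h₁ : deltaOf β₁ ≠ 0) (hm₁ : deltaOf βm₁ ≠ 0) {θ : ℝ}
    (hθ : θ ∈ Ioo Real.pi (2 * Real.pi)) :
    ‖conj (conjBTilde B β₁ βm₁ (exp (θ * I)))‖ = 1 := by
  rw [Complex.norm_conj, conjBTilde_lower h₁ hm₁ hθ, norm_mul, Complex.norm_exp_ofReal_mul_I,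
    norm_lowerSign_mul_I, mul_one]

theorem continuousOn_comp_exp {s : Set ℝ} {t : Set ℂ} {g : ℂ → ℂ} (hg : ContinuousOn g t)
    (h : MapsTo (fun θ : ℝ => exp (θ * I)) s t) : ContinuousOn (fun θ : ℝ => g (exp (θ * I))) s :=
  hg.comp (by fun_prop) h

/-- The identities on the open semicircles extend to the closed ones by continuity. It applies to
every admissible w, so the choice made in `windingNumber` does no harm. -/
theorem HasWindingNumber.exists_isArgument (h₁ : deltaOf β₁ ≠ 0) (hm₁ : deltaOf βm₁ ≠ 0)
    (hB : ContinuousOn B upperArc) {w : ℝ}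
    (hw : HasWindingNumber (fun ξ => conj (conjBTilde B β₁ βm₁ ξ)) w) :
    ∃ φ, IsArgument B β₁ βm₁ φ ∧ w = (φ (2 * Real.pi) - φ 0) / (2 * Real.pi) := by
  have hp := Real.pi_pos
  obtain ⟨φ, hφ, hφe, hw⟩ := hw
  have hφc : ∀ s ⊆ Icc 0 (2 * Real.pi), ContinuousOn (fun θ : ℝ => exp (φ θ * I)) s := fun s hs => by
    have := hφ.mono hs
    fun_prop
  refine ⟨φ, ⟨hφ, ?_, ?_⟩, hw⟩
  · have hBc : ContinuousOn (fun θ : ℝ => B (exp (θ * I))) (Icc 0 Real.pi) :=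
      continuousOn_comp_exp hB fun θ hθ => exp_mem_upperArc hθ
    have ha := continuous_upperAngle (deltaOf β₁) (deltaOf βm₁)
    have h2 := hφc (Icc 0 Real.pi) (Icc_subset_Icc le_rfl (by linarith))
    refine EqOn.of_subset_closure (s := Ioo 0 Real.pi) (fun θ hθ => ?_) ?_ ?_ Ioo_subset_Icc_self
      (by rw [closure_Ioo hp.ne])
    · obtain ⟨-, h4⟩ := hφe θ ⟨hθ.1, by linarith [hθ.2]⟩ hθ.2.ne
      simp only at h4
      rw [norm_conjBTilde_upper h₁ hm₁ hθ, conjBTilde_upper h₁ hm₁ hθ, map_mul, Complex.conj_conj,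
        conj_exp_mul_I] at h4
      exact h4.symm
    · exact (Complex.continuous_ofReal.comp_continuousOn hBc.norm).mul h2
    · exact hBc.mul (by fun_prop)
  · have ha := continuous_lowerAngle (deltaOf β₁) (deltaOf βm₁)
    have h2 := hφc (Icc Real.pi (2 * Real.pi)) (Icc_subset_Icc hp.le le_rfl)
    refine EqOn.of_subset_closure (s := Ioo Real.pi (2 * Real.pi)) (fun θ hθ => ?_) h2
      (by fun_prop) Ioo_subset_Icc_self (by rw [closure_Ioo (by linarith)])
    obtain ⟨-, h4⟩ := hφe θ ⟨by linarith [hθ.1], hθ.2⟩ hθ.1.ne'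
    simp only at h4
    rw [norm_conjBTilde_lower h₁ hm₁ hθ, conjBTilde_lower h₁ hm₁ hθ, map_mul, map_mul,
      conj_ofReal, conj_I, conj_exp_mul_I, ofReal_one, one_mul] at h4
    rw [← h4, lowerAngle]
    ring

/-- Each semicircle has an evident argument: a lift of B minus `upperAngle`, respectively an affine
function. The exponent δ₋₁ and the sign on L make them agree at -1 modulo 2π, so an integer shift
glues them. -/
theorem exists_hasWindingNumber (hβ₁ : deltaOf β₁ ≠ 0) (hβm₁ : βm₁ ∈ Ioo (-1 : ℝ) 1)
    (hβm₁0 : βm₁ ≠ 0) (hB : ContinuousOn B upperArc) (hB0 : ∀ ξ ∈ upperArc, B ξ ≠ 0)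
    (hBm₁ : B (-1) = ‖B (-1)‖ * (-I * exp (-(Real.pi * βm₁ * I)))) :
    ∃ w, HasWindingNumber (fun ξ => conj (conjBTilde B β₁ βm₁ ξ)) w := by
  have hp := Real.pi_pos
  have hm₁ : deltaOf βm₁ ≠ 0 := (deltaOf_mem_Ioo hβm₁ hβm₁0).1.ne'
  have hBc : ContinuousOn (fun θ : ℝ => B (exp (θ * I))) (Icc 0 Real.pi) :=
    continuousOn_comp_exp hB fun θ hθ => exp_mem_upperArc hθ
  obtain ⟨ψ, hψ, hψe⟩ := exists_continuous_argument hp.le hBc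
    fun θ hθ => hB0 _ (exp_mem_upperArc hθ)
  set s := lowerSign βm₁ with hs
  have hsI : -((s : ℂ) * I) = exp ((-(s * (Real.pi / 2)) : ℝ) * I) := by
    have h1 : exp ((Real.pi / 2 : ℝ) * I) = I := by
      push_cast; exact Complex.exp_pi_div_two_mul_I
    simp only [hs, lowerSign]
    split_ifs
    · rw [one_mul, ofReal_one, one_mul, ofReal_neg, neg_mul, Complex.exp_neg, h1, Complex.inv_I]
    · rw [neg_one_mul, neg_neg, h1]; simp
  -- the two branches of the argument differ by a multiple of `2π` at `-1`
  obtain ⟨k, hk⟩ : ∃ k : ℤ, ψ Real.pi - upperAngle (deltaOf β₁) (deltaOf βm₁) Real.pi =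
      -(s * (Real.pi / 2)) - lowerAngle (deltaOf β₁) (deltaOf βm₁) Real.pi + k * (2 * Real.pi) := by
    have h1 := hψe Real.pi ⟨hp.le, le_rfl⟩
    rw [Complex.exp_pi_mul_I] at h1
    have hn : ((‖B (-1)‖ : ℝ) : ℂ) ≠ 0 := by
      have := hB0 _ (exp_mem_upperArc (θ := Real.pi) ⟨hp.le, le_rfl⟩)
      rw [Complex.exp_pi_mul_I] at this
      exact_mod_cast norm_ne_zero_iff.2 this
    have h2 : exp (ψ Real.pi * I) = -I * exp (-(Real.pi * βm₁ * I)) :=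
      mul_left_cancel₀ hn (h1.symm.trans hBm₁)
    have h3 : exp (ψ Real.pi * I) = exp ((-(Real.pi / 2) - Real.pi * βm₁ : ℝ) * I) := by
      rw [h2]
      push_cast
      have h4 : exp (-(Real.pi / 2 : ℂ) * I) = -I := by
        rw [neg_mul, Complex.exp_neg, Complex.exp_pi_div_two_mul_I, Complex.inv_I]
      rw [sub_mul, Complex.exp_sub, h4, Complex.exp_neg, div_eq_mul_inv]
    obtain ⟨k, hk⟩ := Complex.exp_eq_exp_iff_exists_int.1 h3
    have h4 : ψ Real.pi = -(Real.pi / 2) - Real.pi * βm₁ + k * (2 * Real.pi) := by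
      have h5 := congrArg im hk
      simpa using h5
    simp only [h4, upperAngle, lowerAngle, hs, lowerSign, deltaOf]
    -- At θ = π the two angles differ by πδ₋₁, so -π/2 - π(β₋₁ + δ₋₁) must equal -sπ/2 modulo 2π.
    -- The sum β₋₁ + δ₋₁ is 0 or 1; in the second case -3π/2 = π/2 - 2π accounts for k - 1.
    rcases lt_or_gt_of_ne hβm₁0 with h | h
    · refine ⟨k, ?_⟩
      rw [if_pos h, if_neg (not_lt.2 h.le), abs_of_neg h]
      ring
    · refine ⟨k - 1, ?_⟩
      rw [if_neg (not_lt.2 h.le), if_pos h]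
      push_cast
      ring
  refine ⟨_, fun θ => if θ ≤ Real.pi then ψ θ - upperAngle (deltaOf β₁) (deltaOf βm₁) θ else
    -(s * (Real.pi / 2)) - lowerAngle (deltaOf β₁) (deltaOf βm₁) θ + k * (2 * Real.pi), ?_, ?_, rfl⟩
  · have ha := continuous_upperAngle (deltaOf β₁) (deltaOf βm₁)
    have hb := continuous_lowerAngle (deltaOf β₁) (deltaOf βm₁)
    refine (Continuous.if_le (by fun_prop) (by fun_prop) continuous_id continuous_const
      fun θ hθ => ?_).continuousOn
    simp only [id] at hθ
    rw [hθ, hk]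
  · intro θ hθ hθp
    rcases lt_or_gt_of_ne hθp with h | h
    · have hθ' : θ ∈ Ioo 0 Real.pi := ⟨hθ.1, h⟩
      have hB1 := hB0 _ (exp_mem_upperArc (Ioo_subset_Icc_self hθ'))
      have hnorm := norm_conjBTilde_upper (B := B) hβ₁ hm₁ hθ'
      refine ⟨fun h0 => ?_, ?_⟩
      · simp only at h0
        rw [h0, norm_zero] at hnorm
        exact hB1 (norm_eq_zero.1 hnorm.symm)
      · simp only
        rw [hnorm, if_pos h.le, conjBTilde_upper hβ₁ hm₁ hθ', map_mul, Complex.conj_conj,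
          conj_exp_mul_I]
        nth_rewrite 1 [hψe θ (Ioo_subset_Icc_self hθ')]
        rw [mul_assoc, ← Complex.exp_add]
        congr 2
        rw [upperAngle]
        push_cast
        ring
    · have hθ' : θ ∈ Ioo Real.pi (2 * Real.pi) := ⟨h, hθ.2⟩
      have hnorm := norm_conjBTilde_lower (B := B) hβ₁ hm₁ hθ'
      refine ⟨fun h0 => ?_, ?_⟩
      · simp only at h0
        rw [h0, norm_zero] at hnorm
        exact zero_ne_one hnorm
      · simp only
        rw [hnorm, if_neg (not_le.2 h), conjBTilde_lower hβ₁ hm₁ hθ', map_mul, map_mul,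
          conj_ofReal, conj_I, conj_exp_mul_I, ofReal_one, one_mul, mul_neg, hsI, ← Complex.exp_add]
        have h5 := Complex.exp_int_mul_two_pi_mul_I k
        rw [← mul_one (exp _), ← h5, ← Complex.exp_add]
        congr 1
        rw [lowerAngle]
        push_cast
        ring

theorem exists_isArgument_windingNumber (hβ₁ : deltaOf β₁ ≠ 0) (hβm₁ : βm₁ ∈ Ioo (-1 : ℝ) 1)
    (hβm₁0 : βm₁ ≠ 0) (hB : ContinuousOn B upperArc) (hB0 : ∀ ξ ∈ upperArc, B ξ ≠ 0)
    (hBm₁ : B (-1) = ‖B (-1)‖ * (-I * exp (-(Real.pi * βm₁ * I)))) :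
    ∃ φ, IsArgument B β₁ βm₁ φ ∧
      windingNumber B β₁ βm₁ = (φ (2 * Real.pi) - φ 0) / (2 * Real.pi) := by
  have h := exists_hasWindingNumber hβ₁ hβm₁ hβm₁0 hB hB0 hBm₁
  rw [windingNumber, dif_pos h]
  exact h.choose_spec.exists_isArgument hβ₁ (deltaOf_mem_Ioo hβm₁ hβm₁0).1.ne' hB

/-- Twice the winding number is an integer. -/
theorem IsArgument.exists_int {φ : ℝ → ℝ} (hφ : IsArgument B β₁ βm₁ φ) (hB1 : B 1 ≠ 0)
    (hB₁ : B 1 = ‖B 1‖ * (-I * exp (Real.pi * β₁ * I))) :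
    ∃ k : ℤ, φ (2 * Real.pi) - φ 0 = Real.pi * k := by
  have hp := Real.pi_pos
  have h0 := hφ.upper 0 ⟨le_rfl, hp.le⟩
  have h1 := hφ.lower (2 * Real.pi) ⟨by linarith, le_rfl⟩
  rw [ofReal_zero, zero_mul, Complex.exp_zero] at h0
  have hn : ((‖B 1‖ : ℝ) : ℂ) ≠ 0 := by exact_mod_cast norm_ne_zero_iff.2 hB1
  nth_rewrite 2 [hB₁] at h0
  rw [mul_assoc] at h0
  have h2 := mul_left_cancel₀ hn h0
  have hs : ((lowerSign βm₁ : ℝ) : ℂ) * lowerSign βm₁ = 1 := by exact_mod_cast lowerSign_sq βm₁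
  obtain ⟨j, hj⟩ : ∃ j : ℤ, deltaOf β₁ + β₁ = j := by
    rw [deltaOf]
    split_ifs with h
    · exact ⟨1, by push_cast; ring⟩
    · exact ⟨0, by rw [abs_of_nonpos (not_lt.1 h)]; push_cast; ring⟩
  -- Doubling removes the sign on L. The angles at 2π and at 0 differ by πδ₁, and β₁ + δ₁ is an
  -- integer, so the doubled arguments agree modulo 2π.
  have h3 : exp ((2 * φ (2 * Real.pi) : ℝ) * I) = exp ((2 * φ 0 : ℝ) * I) := by
    have e1 : ∀ x : ℝ, exp ((2 * x : ℝ) * I) = exp (x * I) * exp (x * I) := fun x => by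
      rw [← Complex.exp_add]; congr 1; push_cast; ring
    have e2 : ∀ x : ℂ, exp (-x) * exp (-x) = exp (-(2 * x)) := fun x => by
      rw [← Complex.exp_add]; congr 1; ring
    have e3 : exp (Real.pi * β₁ * I) * exp (Real.pi * β₁ * I) = exp (2 * (Real.pi * β₁ * I)) := by
      rw [← Complex.exp_add]; congr 1; ring
    have e4 : exp (-(2 * (lowerAngle (deltaOf β₁) (deltaOf βm₁) (2 * Real.pi) * I))) =
        exp (2 * (Real.pi * β₁ * I)) *
          exp (-(2 * (upperAngle (deltaOf β₁) (deltaOf βm₁) 0 * I))) := by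
      rw [← Complex.exp_add, Complex.exp_eq_exp_iff_exists_int]
      refine ⟨-j, ?_⟩
      have hj' : (deltaOf β₁ : ℂ) + β₁ = j := by exact_mod_cast hj
      rw [lowerAngle, upperAngle]
      push_cast
      rw [← hj']
      ring
    rw [e1, e1, h1, h2]
    linear_combination (I * I) * (exp (-(lowerAngle (deltaOf β₁) (deltaOf βm₁) (2 * Real.pi) * I)) *
      exp (-(lowerAngle (deltaOf β₁) (deltaOf βm₁) (2 * Real.pi) * I))) * hs +
      (I * I) * e2 (lowerAngle (deltaOf β₁) (deltaOf βm₁) (2 * Real.pi) * I) + (I * I) * e4 -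
      (I * I) * exp (2 * (Real.pi * β₁ * I)) * e2 (upperAngle (deltaOf β₁) (deltaOf βm₁) 0 * I) -
      (I * I) * (exp (-(upperAngle (deltaOf β₁) (deltaOf βm₁) 0 * I)) *
        exp (-(upperAngle (deltaOf β₁) (deltaOf βm₁) 0 * I))) * e3
  obtain ⟨k, hk⟩ := Complex.exp_eq_exp_iff_exists_int.1 h3
  refine ⟨k, ?_⟩
  have h5 := congrArg im hk
  simp at h5
  linarith

theorem isHolder_comp_exp {E : Type*} [PseudoMetricSpace E] {β : ℝ} (hβ : 0 ≤ β) {s : Set ℝ}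
    {t : Set ℂ} {g : ℂ → E} (hg : IsHolder β t g) (h : MapsTo (fun θ : ℝ => exp (θ * I)) s t) :
    IsHolder β s (fun θ : ℝ => g (exp (θ * I))) := by
  have hlip : LipschitzOnWith 1 (fun θ : ℝ => exp (θ * I)) s := by
    refine (LipschitzWith.of_dist_le_mul fun x y => ?_).lipschitzOnWith
    have h1 := (lipschitzWith_circleMap 0 1).dist_le_mul x y
    simpa [circleMap] using h1
  exact hg.comp_lipschitz hβ hlip h

theorem isCompact_upperArc : IsCompact upperArc := by
  refine (isCompact_sphere (0 : ℂ) 1).of_isClosed_subset ?_ fun z hz => by simpa using hz.1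
  exact (isClosed_eq continuous_norm continuous_const).inter
    (isClosed_le continuous_const Complex.continuous_im)

theorem isHolder_inv_norm {β : ℝ} (hβ : 0 < β) (hB : IsHolder β upperArc B)
    (hB0 : ∀ ξ ∈ upperArc, B ξ ≠ 0) : IsHolder β upperArc (fun ξ => ‖B ξ‖⁻¹) := by
  have hne : upperArc.Nonempty := ⟨1, by simp [upperArc]⟩
  obtain ⟨ξ₀, hξ₀, hmin⟩ := isCompact_upperArc.exists_isMinOn hne (hB.continuousOn hβ).norm
  exact IsHolder.inv (norm_pos_iff.2 (hB0 ξ₀ hξ₀)) (fun x hx => hmin hx) hB.norm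

theorem isHolder_exp_affine {β : ℝ} (hβ : 0 < β) (hβ1 : β ≤ 1) (c d a b : ℝ) :
    IsHolder β (Icc a b) (fun θ : ℝ => exp (-((c * θ + d : ℝ) * I))) := by
  have h1 : IsHolder β (Icc a b) (fun θ : ℝ => ((c * θ + d : ℝ) : ℂ) * (-I)) :=
    (((isHolder_linear hβ hβ1 c a b).add (IsHolder.const d)).ofReal).mul hβ.le (isBounded_Icc _ _)
      (IsHolder.const (-I))
  have h2 := h1.exp_comp hβ.le (isBounded_Icc _ _)
  simpa only [mul_neg] using h2

/-- On each semicircle e^{iφ} is explicit: B/|B| times an affine phase above, a constant times such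
a phase below. The two pieces glue, and the continuous φ inherits the exponent through
`IsHolder.of_exp_mul_I`. -/
theorem IsArgument.isHolder {φ : ℝ → ℝ} (hφ : IsArgument B β₁ βm₁ φ) {β : ℝ} (hβ : 0 < β)
    (hβ1 : β ≤ 1) (hB : IsHolder β upperArc B) (hB0 : ∀ ξ ∈ upperArc, B ξ ≠ 0) :
    IsHolder β (Icc 0 (2 * Real.pi)) φ := by
  have hp := Real.pi_pos
  refine IsHolder.of_exp_mul_I hβ.le isCompact_Icc hφ.continuousOn ?_
  refine IsHolder.Icc_union (b := Real.pi) hβ.le ?_ ?_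
  · have hmaps : MapsTo (fun θ : ℝ => exp (θ * I)) (Icc 0 Real.pi) upperArc :=
      fun θ hθ => exp_mem_upperArc hθ
    have h1 := (isHolder_comp_exp hβ.le (isHolder_inv_norm hβ hB hB0) hmaps).ofReal
    have h2 := isHolder_comp_exp hβ.le hB hmaps
    have h3 := isHolder_exp_affine hβ hβ1 ((deltaOf β₁ + deltaOf βm₁) / 2)
      (deltaOf β₁ * (Real.pi / 2)) 0 Real.pi
    refine ((h1.mul hβ.le (isBounded_Icc _ _) h2).mul hβ.le (isBounded_Icc _ _) h3).congr
      fun θ hθ => ?_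
    have h4 := hφ.upper θ hθ
    have hn : ((‖B (exp (θ * I))‖ : ℝ) : ℂ) ≠ 0 := by
      exact_mod_cast norm_ne_zero_iff.2 (hB0 _ (exp_mem_upperArc hθ))
    have h5 : (deltaOf β₁ + deltaOf βm₁) / 2 * θ + deltaOf β₁ * (Real.pi / 2) =
        upperAngle (deltaOf β₁) (deltaOf βm₁) θ := by rw [upperAngle]; ring
    simp only [h5]
    rw [mul_assoc, ← h4, ofReal_inv, inv_mul_cancel_left₀ hn]
  · have h3 := isHolder_exp_affine hβ hβ1 ((deltaOf β₁ + deltaOf βm₁) / 2)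
      (deltaOf β₁ * (Real.pi / 2) - deltaOf βm₁ * Real.pi) Real.pi (2 * Real.pi)
    refine (IsHolder.mul hβ.le (isBounded_Icc _ _)
      (IsHolder.const (-((lowerSign βm₁ : ℂ) * I))) h3).congr fun θ hθ => ?_
    have h5 : (deltaOf β₁ + deltaOf βm₁) / 2 * θ + (deltaOf β₁ * (Real.pi / 2) -
        deltaOf βm₁ * Real.pi) = lowerAngle (deltaOf β₁) (deltaOf βm₁) θ := by rw [lowerAngle]; ring
    simp only [h5]
    exact hφ.lower θ hθ

end Argument

/-! ### Reduction of the Cherepanov problem to the Riemann–Hilbert problem. -/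

theorem exists_exp_eq_of_mem_upperArc {ξ : ℂ} (hξ : ξ ∈ upperArc) :
    ∃ θ ∈ Icc 0 Real.pi, exp (θ * I) = ξ := by
  refine ⟨ξ.arg, ⟨Complex.arg_nonneg_iff.2 hξ.2, Complex.arg_le_pi ξ⟩, ?_⟩
  have := Complex.norm_mul_exp_arg_mul_I ξ
  rwa [hξ.1, ofReal_one, one_mul] at this

theorem exists_exp_eq_of_mem_lowerArc {ξ : ℂ} (hξ : ξ ∈ lowerArc) :
    ∃ θ ∈ Icc Real.pi (2 * Real.pi), exp (θ * I) = ξ := by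
  have hneg : -ξ ∈ upperArc := ⟨by rw [norm_neg, hξ.1], by rw [neg_im]; linarith [hξ.2]⟩
  obtain ⟨θ, hθ, h⟩ := exists_exp_eq_of_mem_upperArc hneg
  refine ⟨θ + Real.pi, ⟨by linarith [hθ.1], by linarith [hθ.2]⟩, ?_⟩
  push_cast
  rw [add_mul, Complex.exp_add, Complex.exp_pi_mul_I, h]
  ring

/-- The right-hand side of the Riemann–Hilbert problem belonging to `bt`. -/
noncomputable def boundaryDatum (B : ℂ → ℂ) (bt : ℂ → ℝ) (θ : ℝ) : ℝ :=
  if θ ≤ Real.pi then bt (exp (θ * I)) * ‖B (exp (θ * I))‖⁻¹ else 0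

theorem boundaryDatum_lower (B : ℂ → ℂ) {bt : ℂ → ℝ} (hbt : ∀ ξ ∈ lowerArc, bt ξ = 0) {θ : ℝ}
    (hθ : θ ∈ Icc Real.pi (2 * Real.pi)) : boundaryDatum B bt θ = 0 := by
  rw [boundaryDatum]
  split_ifs with h
  · rw [hbt _ (exp_mem_lowerArc hθ), zero_mul]
  · rfl

theorem one_mem_lowerArc : (1 : ℂ) ∈ lowerArc := by simp [lowerArc]

theorem boundaryDatum_zero (B : ℂ → ℂ) {bt : ℂ → ℝ} (hbt : ∀ ξ ∈ lowerArc, bt ξ = 0) :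
    boundaryDatum B bt 0 = 0 := by
  rw [boundaryDatum, if_pos Real.pi_pos.le, ofReal_zero, zero_mul, Complex.exp_zero,
    hbt 1 one_mem_lowerArc, zero_mul]

theorem isHolder_boundaryDatum {β : ℝ} (hβ : 0 < β) {B : ℂ → ℂ} (hB : IsHolder β upperArc B)
    (hB0 : ∀ ξ ∈ upperArc, B ξ ≠ 0) {bt : ℂ → ℝ} (hbtH : IsHolder β (sphere (0 : ℂ) 1) bt)
    (hbt : ∀ ξ ∈ lowerArc, bt ξ = 0) :
    IsHolder β (Icc 0 (2 * Real.pi)) (boundaryDatum B bt) := by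
  refine IsHolder.Icc_union (b := Real.pi) hβ.le ?_ ?_
  · have hmaps : MapsTo (fun θ : ℝ => exp (θ * I)) (Icc 0 Real.pi) upperArc :=
      fun θ hθ => exp_mem_upperArc hθ
    have h1 := isHolder_comp_exp hβ.le (isHolder_inv_norm hβ hB hB0) hmaps
    have h2 := isHolder_comp_exp (s := Icc 0 Real.pi) hβ.le hbtH fun θ _ => by simp
    exact (h2.mul hβ.le (isBounded_Icc _ _) h1).congr fun θ hθ => if_pos hθ.2
  · exact (IsHolder.const (0 : ℝ)).congr fun θ hθ => boundaryDatum_lower B hbt hθ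

/-- For functions of the form `(ξ - 1) ^ δ₁ * (ξ + 1) ^ δm₁ * F`, the Cherepanov problem is a
Riemann–Hilbert problem for `F`. -/
theorem solvesCherepanov_iff {β : ℝ} (hβ : 0 < β) {B : ℂ → ℂ} {β₁ βm₁ : ℝ} {φ : ℝ → ℝ}
    (hφ : IsArgument B β₁ βm₁ φ) (h₁ : 0 < deltaOf β₁) (hm₁ : 0 < deltaOf βm₁)
    (hB : IsHolder β upperArc B) (hB0 : ∀ ξ ∈ upperArc, B ξ ≠ 0)
    {bt : ℂ → ℝ} (hbtH : IsHolder β (sphere (0 : ℂ) 1) bt) (hbt : ∀ ξ ∈ lowerArc, bt ξ = 0)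
    {F : ℂ → ℂ} (hF : HolderDisc β F) :
    SolvesCherepanov B (fun ξ => ‖ξ - 1‖ ^ deltaOf β₁ * ‖ξ + 1‖ ^ deltaOf βm₁ * bt ξ)
        (fun z : ClosedDisc => weight (deltaOf β₁) (deltaOf βm₁) z * F z) ↔
      ∀ θ ∈ Icc 0 (2 * Real.pi),
        (exp (-(φ θ * I)) * F (exp (θ * I))).re = boundaryDatum B bt θ := by
  have hp := Real.pi_pos
  have hsph : ∀ θ : ℝ, exp (θ * I) ∈ closedBall (0 : ℂ) 1 := fun θ => by simp
  set W : ℝ → ℝ := fun θ => ‖exp (θ * I) - 1‖ ^ deltaOf β₁ * ‖exp (θ * I) + 1‖ ^ deltaOf βm₁ with hW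
  -- By the definition of φ, conj B times the weight is W|B|e^{-iφ} on the upper semicircle.
  have hupper : ∀ θ ∈ Icc 0 Real.pi,
      (conj (B (exp (θ * I))) * (weight (deltaOf β₁) (deltaOf βm₁) (exp (θ * I)) *
        F (exp (θ * I)))).re =
      W θ * (‖B (exp (θ * I))‖ * (exp (-(φ θ * I)) * F (exp (θ * I))).re) := by
    intro θ hθ
    have h1 := congrArg conj (hφ.upper θ hθ)
    rw [map_mul, map_mul, conj_ofReal, conj_exp_mul_I, ← conj_exp_mul_I (upperAngle _ _ _),
      Complex.conj_conj] at h1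
    have h2 : conj (B (exp (θ * I))) * (weight (deltaOf β₁) (deltaOf βm₁) (exp (θ * I)) *
        F (exp (θ * I))) = ((W θ * ‖B (exp (θ * I))‖ : ℝ) : ℂ) *
          (exp (-(φ θ * I)) * F (exp (θ * I))) := by
      have h3 := weight_upper h₁.ne' hm₁.ne' hθ
      rw [← upperAngle] at h3
      rw [h3, ofReal_mul (W θ)]
      linear_combination -(((‖exp (θ * I) - 1‖ ^ deltaOf β₁ * ‖exp (θ * I) + 1‖ ^ deltaOf βm₁ : ℝ)
        : ℂ) * F (exp (θ * I))) * h1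
    rw [h2, re_ofReal_mul, mul_assoc]
  -- On the lower semicircle the weight is a real multiple of i e^{-iφ}; the factor i exchanges the
  -- imaginary part of f for a real part.
  have hlower : ∀ θ ∈ Icc Real.pi (2 * Real.pi),
      (weight (deltaOf β₁) (deltaOf βm₁) (exp (θ * I)) * F (exp (θ * I))).im =
      -(lowerSign βm₁ * W θ) * (exp (-(φ θ * I)) * F (exp (θ * I))).re := by
    intro θ hθ
    have h1 := congrArg conj (hφ.lower θ hθ)
    rw [map_mul, map_neg, map_mul, conj_ofReal, conj_I, conj_exp_mul_I,
      ← conj_exp_mul_I (lowerAngle _ _ _), Complex.conj_conj] at h1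
    have hs : ((lowerSign βm₁ : ℝ) : ℂ) * lowerSign βm₁ = 1 := by exact_mod_cast lowerSign_sq βm₁
    have h2 : weight (deltaOf β₁) (deltaOf βm₁) (exp (θ * I)) * F (exp (θ * I)) =
        ((-(lowerSign βm₁ * W θ) : ℝ) : ℂ) * (exp (-(φ θ * I)) * F (exp (θ * I))) * I := by
      have h3 := weight_lower h₁.ne' hm₁.ne' hθ
      rw [← lowerAngle] at h3
      rw [h3, h1, hW, ofReal_neg, ofReal_mul (lowerSign βm₁)]
      set V : ℂ := ((‖exp (θ * I) - 1‖ ^ deltaOf β₁ * ‖exp (θ * I) + 1‖ ^ deltaOf βm₁ : ℝ) : ℂ)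
      set E := exp (lowerAngle (deltaOf β₁) (deltaOf βm₁) θ * I)
      linear_combination (-V * E * F (exp (θ * I))) * hs +
        (V * E * F (exp (θ * I))) * lowerSign βm₁ * lowerSign βm₁ * I_mul_I
    rw [h2, Complex.mul_I_im, re_ofReal_mul]
  have hWpos : ∀ θ : ℝ, exp (θ * I) - 1 ≠ 0 → exp (θ * I) + 1 ≠ 0 → 0 < W θ := fun θ ha hb =>
    mul_pos (Real.rpow_pos_of_pos (norm_pos_iff.2 ha) _) (Real.rpow_pos_of_pos (norm_pos_iff.2 hb) _)
  have hBpos : ∀ θ ∈ Icc 0 Real.pi, 0 < ‖B (exp (θ * I))‖ := fun θ hθ =>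
    norm_pos_iff.2 (hB0 _ (exp_mem_upperArc hθ))
  constructor
  · intro hf
    have hc1 : ContinuousOn (fun θ : ℝ => (exp (-(φ θ * I)) * F (exp (θ * I))).re)
        (Icc 0 (2 * Real.pi)) := by
      have h1 := hφ.continuousOn
      have h2 : ContinuousOn (fun θ : ℝ => F (exp (θ * I))) (Icc 0 (2 * Real.pi)) :=
        continuousOn_comp_exp (hF.continuousOn hβ) fun θ _ => hsph θ
      exact Complex.continuous_re.comp_continuousOn (ContinuousOn.mul (by fun_prop) h2)
    have hc2 := (isHolder_boundaryDatum hβ hB hB0 hbtH hbt).continuousOn hβ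
    have h1 : EqOn (fun θ : ℝ => (exp (-(φ θ * I)) * F (exp (θ * I))).re) (boundaryDatum B bt)
        (Icc 0 Real.pi) := by
      have hsub : Icc 0 Real.pi ⊆ Icc 0 (2 * Real.pi) := Icc_subset_Icc le_rfl (by linarith)
      -- At ±1 the factor W vanishes and the boundary condition says nothing; the relation there is
      -- recovered by continuity.
      refine EqOn.of_subset_closure (s := Ioo 0 Real.pi) (fun θ hθ => ?_) (hc1.mono hsub)
        (hc2.mono hsub) Ioo_subset_Icc_self (by rw [closure_Ioo hp.ne])
      have hθ' := Ioo_subset_Icc_self hθ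
      have h2 := hf.re_eq ⟨exp (θ * I), hsph θ⟩ (exp_mem_upperArc hθ')
      simp only at h2
      rw [hupper θ hθ'] at h2
      have hw := hWpos θ (exp_mul_I_sub_one_ne_zero ⟨hθ.1, by linarith [hθ.2]⟩)
        (exp_mul_I_add_one_ne_zero_of_lt hθ)
      have h3 := mul_left_cancel₀ hw.ne' h2
      simp only [boundaryDatum]
      rw [if_pos hθ.2.le, ← h3, mul_comm ‖_‖, mul_inv_cancel_right₀ (hBpos θ hθ').ne']
    have h2 : EqOn (fun θ : ℝ => (exp (-(φ θ * I)) * F (exp (θ * I))).re) (boundaryDatum B bt)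
        (Icc Real.pi (2 * Real.pi)) := by
      have hsub : Icc Real.pi (2 * Real.pi) ⊆ Icc 0 (2 * Real.pi) := Icc_subset_Icc hp.le le_rfl
      refine EqOn.of_subset_closure (s := Ioo Real.pi (2 * Real.pi)) (fun θ hθ => ?_)
        (hc1.mono hsub) (hc2.mono hsub) Ioo_subset_Icc_self (by rw [closure_Ioo (by linarith)])
      have hθ' := Ioo_subset_Icc_self hθ
      have h2 := hf.im_eq_zero ⟨exp (θ * I), hsph θ⟩ (exp_mem_lowerArc hθ')
      simp only at h2
      rw [hlower θ hθ'] at h2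
      have hw := hWpos θ (exp_mul_I_sub_one_ne_zero ⟨by linarith [hθ.1], hθ.2⟩)
        (exp_mul_I_add_one_ne_zero_of_gt hθ)
      have hs : lowerSign βm₁ ≠ 0 := fun h => by
        have := lowerSign_sq βm₁
        rw [h] at this
        norm_num at this
      rw [boundaryDatum_lower B hbt hθ']
      exact (mul_eq_zero.1 h2).resolve_left (neg_ne_zero.2 (mul_ne_zero hs hw.ne'))
    intro θ hθ
    rcases le_total θ Real.pi with h | h
    · exact h1 ⟨hθ.1, h⟩
    · exact h2 ⟨h, hθ.2⟩
  · intro h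
    refine ⟨weight_mul_mem_discAlgebra h₁ hm₁ hF.differentiableOn (hF.continuousOn hβ), ?_, ?_⟩
    · rintro ⟨ξ, hξ'⟩ hξ
      obtain ⟨θ, hθ, rfl⟩ := exists_exp_eq_of_mem_lowerArc hξ
      simp only
      rw [hlower θ hθ, h θ ⟨by linarith [hθ.1], hθ.2⟩, boundaryDatum_lower B hbt hθ, mul_zero]
    · rintro ⟨ξ, hξ'⟩ hξ
      obtain ⟨θ, hθ, rfl⟩ := exists_exp_eq_of_mem_upperArc hξ
      simp only
      rw [hupper θ hθ, h θ ⟨hθ.1, by linarith [hθ.2]⟩, boundaryDatum, if_pos hθ.2]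
      rw [mul_comm (bt _), mul_inv_cancel_left₀ (hBpos θ hθ).ne']

/-! ### The solution space and the conclusion. -/

theorem weightedSolutions_eq_translate {β : ℝ≥0} {δ₁ δm₁ : ℝ} {B : ℂ → ℂ} {b : ℂ → ℝ}
    {f : ClosedDisc → ℂ} (hf : f ∈ weightedSolutions β δ₁ δm₁ B b) :
    weightedSolutions β δ₁ δm₁ B b = {g | ∃ h ∈ homogeneousSolutions β δ₁ δm₁ B, g = f + h} := by
  obtain ⟨hf, κ, hκ, hfκ⟩ := hf
  ext g
  constructor
  · rintro ⟨hg, μ, hμ, hgμ⟩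
    refine ⟨g - f, ⟨⟨discAlgebra.sub_mem hg.1 hf.1, fun ξ hξ => ?_, fun ξ hξ => ?_⟩,
      μ - κ, (holderDiscAlgebra β).sub_mem hμ hκ, fun z => ?_⟩, (add_sub_cancel f g).symm⟩
    · rw [Pi.sub_apply, sub_im, hg.2 ξ hξ, hf.2 ξ hξ, sub_zero]
    · rw [Pi.sub_apply, mul_sub, sub_re, hg.3 ξ hξ, hf.3 ξ hξ, sub_self]
    · rw [Pi.sub_apply, Pi.sub_apply, hfκ z, hgμ z, mul_sub]
  · rintro ⟨h, ⟨hh, μ, hμ, hhμ⟩, rfl⟩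
    refine ⟨⟨discAlgebra.add_mem hf.1 hh.1, fun ξ hξ => ?_, fun ξ hξ => ?_⟩,
      κ + μ, (holderDiscAlgebra β).add_mem hκ hμ, fun z => ?_⟩
    · rw [Pi.add_apply, add_im, hf.2 ξ hξ, hh.2 ξ hξ, add_zero]
    · rw [Pi.add_apply, mul_add, add_re, hf.3 ξ hξ, hh.3 ξ hξ, add_zero]
    · rw [Pi.add_apply, Pi.add_apply, hfκ z, hhμ z, mul_add]

theorem weightedSolutions_subset_holderDiscAlgebra {β : ℝ≥0} (hβ : 0 < β) {δ₁ δm₁ : ℝ}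
    (h₁ : δ₁ ≤ 1) (hm₁ : δm₁ ≤ 1) (hβ₁ : (β : ℝ) ≤ δ₁) (hβm₁ : (β : ℝ) ≤ δm₁) {B : ℂ → ℂ}
    {b : ℂ → ℝ} {f : ClosedDisc → ℂ} (hf : f ∈ weightedSolutions β δ₁ δm₁ B b) :
    f ∈ holderDiscAlgebra β := by
  obtain ⟨-, κ, hκ, hfκ⟩ := hf
  obtain ⟨F, hF, hκF⟩ := exists_holderDisc_of_mem hκ
  have h := ((holderDisc_weight (by exact_mod_cast hβ) hβ₁ h₁ hβm₁ hm₁).mul β.coe_nonneg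
    hF).mem_holderDiscAlgebra hβ
  have hfe : f = fun z : ClosedDisc => weight δ₁ δm₁ z * F z := by
    funext z
    rw [hfκ z, hκF z]
  rwa [hfe]

/-- The parametrization of the homogeneous solutions. -/
noncomputable def homogeneousParam (δ₁ δm₁ : ℝ) (h : ℂ → ℂ) (n : ℕ) :
    (Fin n → ℝ) →ₗ[ℝ] (ClosedDisc → ℂ) where
  toFun t z := weight δ₁ δm₁ z * (exp (h z * I) * selfReciprocal t z)
  map_add' s t := by
    funext z
    have : selfReciprocal (s + t) z = selfReciprocal s z + selfReciprocal t z := by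
      simp only [selfReciprocal, ← Finset.sum_add_distrib]
      refine Finset.sum_congr rfl fun k _ => ?_
      simp only [selfReciprocalCoeff, Pi.add_apply]
      push_cast
      ring
    simp only [this, Pi.add_apply, mul_add]
  map_smul' c t := by
    funext z
    have : selfReciprocal (c • t) z = c * selfReciprocal t z := by
      simp only [selfReciprocal, Finset.mul_sum]
      refine Finset.sum_congr rfl fun k _ => ?_
      simp only [selfReciprocalCoeff, Pi.smul_apply, smul_eq_mul]
      push_cast
      ring
    simp only [this, Pi.smul_apply, real_smul, RingHom.id_apply]
    ring

/-- The weight and the exponential have no zeros in the open disc, which leaves the injectivity of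
`selfReciprocal`. -/
theorem homogeneousParam_injective (δ₁ δm₁ : ℝ) (h : ℂ → ℂ) (n : ℕ) :
    Function.Injective (homogeneousParam δ₁ δm₁ h n) := by
  rw [injective_iff_map_eq_zero]
  intro t ht
  refine selfReciprocal_injective fun z hz => ?_
  have h1 := congrFun ht ⟨z, ball_subset_closedBall hz⟩
  exact ((mul_eq_zero.1 ((mul_eq_zero.1 h1).resolve_left (weight_ne_zero hz))).resolve_left
    (Complex.exp_ne_zero _))

theorem proposition2 (β : ℝ≥0) (hβ0 : 0 < β) (hβ1 : β < 1)
    (B : ℂ → ℂ) (hB : HolderClassOn β upperArc B) (hB0 : ∀ ξ ∈ upperArc, B ξ ≠ 0)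
    (β₁ βm₁ : ℝ) (hβ₁ : β₁ ∈ Ioo (-1 : ℝ) 1) (hβ₁0 : β₁ ≠ 0)
    (hβm₁ : βm₁ ∈ Ioo (-1 : ℝ) 1) (hβm₁0 : βm₁ ≠ 0)
    (hB₁ : B 1 = ‖B 1‖ * (-I * exp (Real.pi * β₁ * I)))
    (hBm₁ : B (-1) = ‖B (-1)‖ * (-I * exp (-(Real.pi * βm₁ * I))))
    (hW : -(1 / 2 : ℝ) ≤ windingNumber B β₁ βm₁) :
    (∀ bt : ℂ → ℝ, HolderClassOn β (sphere (0 : ℂ) 1) bt → (∀ ξ ∈ lowerArc, bt ξ = 0) →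
      ∃ f, f ∈ weightedSolutions β (deltaOf β₁) (deltaOf βm₁) B
          (fun ξ => ‖ξ - 1‖ ^ deltaOf β₁ * ‖ξ + 1‖ ^ deltaOf βm₁ * bt ξ) ∧
        weightedSolutions β (deltaOf β₁) (deltaOf βm₁) B
          (fun ξ => ‖ξ - 1‖ ^ deltaOf β₁ * ‖ξ + 1‖ ^ deltaOf βm₁ * bt ξ) =
            {g | ∃ h ∈ homogeneousSolutions β (deltaOf β₁) (deltaOf βm₁) B, g = f + h} ∧
        ((β : ℝ) ≤ deltaOf β₁ → (β : ℝ) ≤ deltaOf βm₁ → f ∈ holderDiscAlgebra β)) ∧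
    FiniteDimensional ℝ (homogeneousSolutions β (deltaOf β₁) (deltaOf βm₁) B) ∧
    (Module.finrank ℝ (homogeneousSolutions β (deltaOf β₁) (deltaOf βm₁) B) : ℝ) =
      2 * windingNumber B β₁ βm₁ + 1 ∧
    ((β : ℝ) ≤ deltaOf β₁ → (β : ℝ) ≤ deltaOf βm₁ →
      homogeneousSolutions β (deltaOf β₁) (deltaOf βm₁) B ≤ holderDiscAlgebra β) := by
  have hp := Real.pi_pos
  have hβ : (0 : ℝ) < β := by exact_mod_cast hβ0
  have hβ' : (β : ℝ) < 1 := by exact_mod_cast hβ1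
  have hδ₁ := deltaOf_mem_Ioo hβ₁ hβ₁0
  have hδm₁ := deltaOf_mem_Ioo hβm₁ hβm₁0
  have hBH : IsHolder (β : ℝ) upperArc B := isHolder_iff_holderOnWith.2 hB
  obtain ⟨φ, hφ, hw⟩ := exists_isArgument_windingNumber hδ₁.1.ne' hβm₁ hβm₁0
    (hBH.continuousOn hβ) hB0 hBm₁
  obtain ⟨k, hk⟩ := hφ.exists_int (hB0 1 (by simp [upperArc])) hB₁
  have hwk : windingNumber B β₁ βm₁ = k / 2 := by
    rw [hw, hk]; field_simp
  -- The hypothesis on the winding number is exactly that the number n = k + 1 of real parameters is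
  -- nonnegative; n = 0 is the case of unique solvability.
  have hk1 : 0 ≤ k + 1 := by
    rw [hwk] at hW
    have : (-1 : ℝ) ≤ k := by linarith
    have : (-1 : ℤ) ≤ k := by exact_mod_cast this
    linarith
  obtain ⟨n, hn⟩ := Int.eq_ofNat_of_zero_le hk1
  have hnk : (k : ℝ) = (n : ℝ) - 1 := by
    have : ((k + 1 : ℤ) : ℝ) = ((n : ℤ) : ℝ) := by rw [hn]
    push_cast at this
    linarith
  rw [hnk] at hk
  obtain ⟨h, hh, hsolve, hhom⟩ := exists_riemannHilbert hβ hβ' (hφ.isHolder hβ hβ'.le hBH hB0) hk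
  have hzero : ∀ F, HolderDisc β F →
      (SolvesCherepanov B (fun _ => 0)
        (fun z : ClosedDisc => weight (deltaOf β₁) (deltaOf βm₁) z * F z) ↔
      ∃ t : Fin n → ℝ, ∀ z ∈ closedBall (0 : ℂ) 1, F z = exp (h z * I) * selfReciprocal t z) := by
    intro F hF
    have h1 := solvesCherepanov_iff hβ hφ hδ₁.1 hδm₁.1 hBH hB0 (bt := fun _ => 0)
      (IsHolder.const 0) (fun _ _ => rfl) hF
    simp only [mul_zero] at h1
    rw [h1, ← hhom F hF]
    simp [boundaryDatum]
  -- The weighted form of the solutions is what makes `hzero` applicable; the dimension is then that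
  -- of the parameter space, as the parametrization is injective.
  have hrange : homogeneousSolutions β (deltaOf β₁) (deltaOf βm₁) B =
      LinearMap.range (homogeneousParam (deltaOf β₁) (deltaOf βm₁) h n) := by
    ext f
    constructor
    · rintro ⟨hf, κ, hκ, hfκ⟩
      obtain ⟨F, hF, hκF⟩ := exists_holderDisc_of_mem hκ
      have hfe : f = fun z : ClosedDisc => weight (deltaOf β₁) (deltaOf βm₁) z * F z := by
        funext z
        rw [hfκ z, hκF z]
      rw [hfe] at hf
      obtain ⟨t, ht⟩ := (hzero F hF).1 hf
      refine ⟨t, ?_⟩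
      rw [hfe]
      funext z
      rw [ht z z.2]
      rfl
    · rintro ⟨t, rfl⟩
      have hF : HolderDisc β (fun z => exp (h z * I) * selfReciprocal t z) := by
        refine ((hh.mul hβ.le (HolderDisc.const I)).exp_comp hβ.le).mul hβ.le ?_
        exact HolderDisc.sum _ fun k _ => (HolderDisc.const _).mul hβ.le
          ((HolderDisc.id hβ hβ'.le).pow hβ.le k)
      exact ⟨(hzero _ hF).2 ⟨t, fun _ _ => rfl⟩, _, hF.mem_holderDiscAlgebra hβ0, fun _ => rfl⟩
  refine ⟨fun bt hbtH hbt => ?_, ?_, ?_, fun h1 h2 f hf => ?_⟩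
  · have hbtH' : IsHolder (β : ℝ) (sphere (0 : ℂ) 1) bt := isHolder_iff_holderOnWith.2 hbtH
    obtain ⟨κ, hκ, hκe⟩ := hsolve (boundaryDatum B bt)
      (isHolder_boundaryDatum hβ hBH hB0 hbtH' hbt) (boundaryDatum_zero B hbt)
      (boundaryDatum_lower B hbt ⟨by linarith, le_rfl⟩)
    have hf : (fun z : ClosedDisc => weight (deltaOf β₁) (deltaOf βm₁) z * κ z) ∈
        weightedSolutions β (deltaOf β₁) (deltaOf βm₁) B
          (fun ξ => ‖ξ - 1‖ ^ deltaOf β₁ * ‖ξ + 1‖ ^ deltaOf βm₁ * bt ξ) :=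
      ⟨(solvesCherepanov_iff hβ hφ hδ₁.1 hδm₁.1 hBH hB0 hbtH' hbt hκ).2 hκe,
        _, hκ.mem_holderDiscAlgebra hβ0, fun _ => rfl⟩
    exact ⟨_, hf, weightedSolutions_eq_translate hf,
      fun h1 h2 => weightedSolutions_subset_holderDiscAlgebra hβ0 hδ₁.2.le hδm₁.2.le h1 h2 hf⟩
  · rw [hrange]
    infer_instance
  · rw [hrange, LinearMap.finrank_range_of_inj (homogeneousParam_injective _ _ _ _),
      Module.finrank_fin_fun, hwk, hnk]
    ring
  · exact weightedSolutions_subset_holderDiscAlgebra hβ0 hδ₁.2.le hδm₁.2.le h1 h2 hf
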